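/- Let $F$ be a totally real number field of degree $n\ge 2$ with narrow class number $1$ (every nonzero ideal of $\mathcal O_F$ has a totally positive generator). Let $v_1,\dots,v_n$ be its real embeddings, $a_k:=v_k(a)$ for $a\in F$, $d_F$ its discriminant, $R_F$ its regulator, $\zeta_F$ its Dedekind zeta function (analytically continued), and $\delta$ a totally positive generator of the different of $F$. Let $\Gamma=\mathrm{SL}_2(\mathcal O_F)$ act on $\mathcal H^n$ (a product of $n$ upper half planes, with coordinates $z_k=x_k+iy_k$) by homographies through $v_1,\dots,v_n$. A $C^\infty$ form on $\mathcal X=\Gamma\backslash\mathcal H^n$ is a $\Gamma$-invariant $C^\infty$ complex-valued differential form on $\mathcal H^n$, and a form is exact on $\mathcal X$ if it is $d$ of a $C^\infty$ form on $\mathcal X$. Put $\sigma_k(\mu)=\sum_{\mathfrak a\mid(\mu)}N(\mathfrak a)^k$ (sum over integral ideals) and $$E_2(z)=\zeta_F(-1)+2^n\sum_{\mu\in\mathcal O_F,\ \mu\gg0}\sigma_1(\mu)\,e^{2i\pi\sum_k \frac{\mu_k}{\delta_k}z_k},$$ $$\tilde h(z)=\frac{(-4\pi)^n\zeta_F(-1)}{\sqrt{d_F}}\,y_1\cdots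 y_n+2^n\sqrt{d_F}\sum_{\mu\in\mathcal O_F\setminus\{0\}}\sigma_{-1}(\mu)\,e^{2i\pi\sum_k\left(\frac{\mu_k}{\delta_k}x_k+\left|\frac{\mu_k}{\delta_k}\right|iy_k\right)},$$ $$\omega_{\mathrm{Eis}}=\frac{(2i\pi)^n}{\sqrt{d_F}}E_2(z)\,dz_1\wedge\cdots\wedge dz_n+\begin{cases}\dfrac{R_F}{2}\left(\dfrac{dz_1\wedge d\bar z_1}{y_1^2}-\dfrac{dz_2\wedge d\bar z_2}{y_2^2}\right)&\text{if } n=2,\\[2mm] 0&\text{if } n\ge3.\end{cases}$$ Fix $1\le j\le n$, let $\epsilon\in\mathcal O_F^\times$ be any unit with $\epsilon_j<0$ and $\epsilon_k>0$ for all $k\ne j$, and let $T_{v_j}(z)=(\epsilon_1z_1,\dots,\epsilon_j\bar z_j,\dots,\epsilon_nz_n)$. Then $(\mathrm{Id}+T_{v_j}^*)\,\omega_{\mathrm{Eis}}$ is exact on $\mathcal X$. More precisely, set $$\eta_j=(-1)^{j-1}\,\frac{\partial^{n-1}\tilde h}{\partial z_1\cdots\widehat{\partial z_j}\cdots\partial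 z_n}\;dz_1\wedge\cdots\wedge\widehat{dz_j}\wedge\cdots\wedge dz_n\quad\text{if } n\ge3,$$ $$\eta_j=(-1)^{j-1}\left(\frac{\partial\tilde h}{\partial z_k}-\frac{2R_F}{i\,y_k}\right)dz_k,\quad \{j,k\}=\{1,2\},\quad\text{if } n=2.$$ Then $\eta_j$ is a $\Gamma$-invariant $C^\infty$ form of degree $n-1$ on $\mathcal H^n$, and $d\eta_j=(\mathrm{Id}+T_{v_j}^*)\,\omega_{\mathrm{Eis}}$. -/

import Mathlib

open NumberField
open scoped ContDiff

noncomputable section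

namespace HilbertEisenstein

/-! ### Differential forms on a product of upper half planes -/

/-- The product `ℋ₁ × ⋯ × ℋₙ` of `n` copies of the Poincaré upper half plane. -/
def upperHalfProd (n : ℕ) : Set (Fin n → ℂ) := {z | ∀ k, 0 < (z k).im}

/-- Complex-valued differential forms of degree `k` on `ℂⁿ`, seen as a real manifold. -/
abbrev DForm (n k : ℕ) : Type := (Fin n → ℂ) → (Fin n → ℂ) [⋀^Fin k]→L[ℝ] ℂ

/-- The constant `1`-form `dz_j`. -/
def dz {n : ℕ} (j : Fin n) : (Fin n → ℂ) →L[ℝ] ℂ :=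
  ContinuousLinearMap.proj j

/-- The constant `1`-form `dz̄_j`. -/
def dzbar {n : ℕ} (j : Fin n) : (Fin n → ℂ) →L[ℝ] ℂ :=
  (Complex.conjCLE : ℂ →L[ℝ] ℂ).comp (ContinuousLinearMap.proj j)

/-- The determinant of `k` vectors of `ℂᵏ` as a continuous `ℝ`-multilinear alternating map. -/
def detForm (k : ℕ) : (Fin k → ℂ) [⋀^Fin k]→L[ℝ] ℂ where
  toFun w := (Matrix.of w).det
  map_update_add' := by
    intro _ m i x y
    have h : (‹_› : DecidableEq (Fin k)) = instDecidableEqFin k := Subsingleton.elim _ _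
    subst h
    exact (Matrix.detRowAlternating (n := Fin k) (R := ℂ)).map_update_add m i x y
  map_update_smul' := by
    intro _ m i c x
    have h : (‹_› : DecidableEq (Fin k)) = instDecidableEqFin k := Subsingleton.elim _ _
    subst h
    have := (Matrix.detRowAlternating (n := Fin k) (R := ℂ)).map_update_smul m i (c : ℂ) x
    rw [Complex.real_smul, ← smul_eq_mul]
    exact this
  map_eq_zero_of_eq' := fun w i j h hij =>
    (Matrix.detRowAlternating (n := Fin k) (R := ℂ)).map_eq_zero_of_eq w h hij
  cont := by
    change Continuous fun w : Fin k → Fin k → ℂ => (Matrix.of w).det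
    exact Continuous.matrix_det (by fun_prop)

/-- The exterior product `ℓ₀ ∧ ⋯ ∧ ℓ_{k-1}` of `1`-forms. -/
def wedge {n k : ℕ} (l : Fin k → ((Fin n → ℂ) →L[ℝ] ℂ)) : (Fin n → ℂ) [⋀^Fin k]→L[ℝ] ℂ :=
  (detForm k).compContinuousLinearMap (ContinuousLinearMap.pi l)

theorem wedge_apply {n k : ℕ} (l : Fin k → ((Fin n → ℂ) →L[ℝ] ℂ)) (w : Fin k → (Fin n → ℂ)) :
    wedge l w = (Matrix.of fun i j => l j (w i)).det := rfl

/-- The pullback `φ^* θ` of a differential form. -/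
def pullback {n k : ℕ} (φ : (Fin n → ℂ) → (Fin n → ℂ)) (θ : DForm n k) : DForm n k :=
  fun z => (θ (φ z)).compContinuousLinearMap (fderiv ℝ φ z)

/-- The operator `∂/∂z_j = (∂/∂x_j - i ∂/∂y_j) / 2`. -/
def dWirt {n : ℕ} (j : Fin n) (f : (Fin n → ℂ) → ℂ) (z : Fin n → ℂ) : ℂ :=
  (1 / 2) * (fderiv ℝ f z (Pi.single j 1) - Complex.I * fderiv ℝ f z (Pi.single j Complex.I))

/-- The iterated derivative `∂^r f / ∂z_{j_1} ⋯ ∂z_{j_r}`. -/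
def dWirtIter {n : ℕ} (l : List (Fin n)) (f : (Fin n → ℂ) → ℂ) : (Fin n → ℂ) → ℂ :=
  l.foldr dWirt f

/-! ### The totally real field and the Hilbert modular group -/

section Field

variable (F : Type*) [Field F] [NumberField F]

/-- The class number of `F` in the narrow sense is one: every nonzero ideal of the ring of
integers has a totally positive generator. -/
def NarrowClassNumberOne : Prop :=
  ∀ I : Ideal (𝓞 F), I ≠ ⊥ → ∃ a : 𝓞 F, (∀ σ : F →+* ℝ, 0 < σ a) ∧ I = Ideal.span {a}

/-- `Z` is an analytic continuation of the Dedekind zeta function of `F` to `ℂ ∖ {1}`. -/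
def IsZetaContinuation (Z : ℂ → ℂ) : Prop :=
  DifferentiableOn ℂ Z {1}ᶜ ∧ ∀ s : ℂ, 1 < s.re → Z s = dedekindZeta F s

theorem IsZetaContinuation.eqOn {Z W : ℂ → ℂ} (hZ : IsZetaContinuation F Z)
    (hW : IsZetaContinuation F W) : Set.EqOn Z W {1}ᶜ := by
  have ho : IsOpen ({1}ᶜ : Set ℂ) := isOpen_compl_singleton
  have hc : IsPreconnected ({1}ᶜ : Set ℂ) :=
    (isConnected_compl_singleton_of_one_lt_rank (by simp) 1).isPreconnected
  refine (hZ.1.analyticOnNhd ho).eqOn_of_preconnected_of_eventuallyEq (hW.1.analyticOnNhd ho) hc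
    (z₀ := 2) (by norm_num) ?_
  have h2 : {s : ℂ | 1 < s.re} ∈ nhds (2 : ℂ) :=
    (isOpen_lt continuous_const Complex.continuous_re).mem_nhds (by norm_num)
  filter_upwards [h2] with s hs
  rw [hZ.2 s hs, hW.2 s hs]

open Classical in
/-- The Dedekind zeta function `ζ_F(s)`, `s ≠ 1`, as the value of its (unique) analytic
continuation. -/
def zetaF (s : ℂ) : ℂ :=
  if h : ∃ Z : ℂ → ℂ, IsZetaContinuation F Z then h.choose s else 0

theorem zetaF_eq {Z : ℂ → ℂ} (hZ : IsZetaContinuation F Z) {s : ℂ} (hs : s ≠ 1) :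
    zetaF F s = Z s := by
  have h : ∃ Z : ℂ → ℂ, IsZetaContinuation F Z := ⟨Z, hZ⟩
  rw [zetaF, dif_pos h]
  exact IsZetaContinuation.eqOn F h.choose_spec hZ hs

variable {F}

/-- `σ_k(μ)`, the sum of `N(𝔞)^k` over the integral ideals `𝔞` dividing `(μ)`. -/
def sigma (k : ℤ) (μ : 𝓞 F) : ℂ :=
  ∑ᶠ I : {I : Ideal (𝓞 F) // I ∣ Ideal.span {μ}}, (Ideal.absNorm I.1 : ℂ) ^ k

variable {n : ℕ} (v : Fin n → (F →+* ℝ))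

/-- The action of `SL₂(𝓞_F)` by homographies, through the embeddings `v_1, …, v_n`. -/
def moebius (A : Matrix.SpecialLinearGroup (Fin 2) (𝓞 F)) (z : Fin n → ℂ) : Fin n → ℂ :=
  fun k => (((v k (A 0 0) : ℝ) : ℂ) * z k + ((v k (A 0 1) : ℝ) : ℂ)) /
    (((v k (A 1 0) : ℝ) : ℂ) * z k + ((v k (A 1 1) : ℝ) : ℂ))

/-- A `C^∞` differential form of degree `k` on `𝒳 = SL₂(𝓞_F) \ ℋⁿ`: a smooth form on `ℋⁿ` that is
invariant under the group. -/
def IsFormOnX {k : ℕ} (θ : DForm n k) : Prop :=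
  ContDiffOn ℝ ∞ θ (upperHalfProd n) ∧
    ∀ A : Matrix.SpecialLinearGroup (Fin 2) (𝓞 F),
      Set.EqOn (pullback (moebius v A) θ) θ (upperHalfProd n)

/-- `θ = dη` on `ℋⁿ`. -/
def IsPrimitive {k : ℕ} (η : DForm n k) (θ : DForm n (k + 1)) : Prop :=
  Set.EqOn (extDeriv η) θ (upperHalfProd n)

/-- `θ` is exact in the de Rham complex of `C^∞` forms on `𝒳`. -/
def IsExactOnX {k : ℕ} (θ : DForm n (k + 1)) : Prop :=
  ∃ η : DForm n k, IsFormOnX v η ∧ IsPrimitive η θ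

/-- The map `T_{v_j}`, attached to a unit `ε` that is negative exactly at the place `v_j`. -/
def heckeInfty (j : Fin n) (ε : (𝓞 F)ˣ) (z : Fin n → ℂ) : Fin n → ℂ :=
  fun k => ((v k ((ε : 𝓞 F) : F) : ℝ) : ℂ) *
    (if k = j then (starRingEnd ℂ) (z k) else z k)

/-! ### The Eisenstein series and Asai's function -/

/-- The holomorphic Eisenstein series of weight `(2, …, 2)`; here `δ` is a totally positive
generator of the different of `F`. -/
def E2 (δ : 𝓞 F) (z : Fin n → ℂ) : ℂ :=
  zetaF F (-1) + 2 ^ n * ∑' μ : {μ : 𝓞 F // ∀ k, 0 < v k μ},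
    sigma 1 μ.1 * Complex.exp (2 * Complex.I * Real.pi *
      ∑ k, ((v k μ.1 / v k δ : ℝ) : ℂ) * z k)

/-- The normalised function `h̃` of Asai. -/
def hTilde (δ : 𝓞 F) (z : Fin n → ℂ) : ℂ :=
  (-4 * Real.pi) ^ n * zetaF F (-1) / (Real.sqrt (discr F) : ℂ) * ((∏ k, (z k).im : ℝ) : ℂ) +
    2 ^ n * (Real.sqrt (discr F) : ℂ) * ∑' μ : {μ : 𝓞 F // μ ≠ 0},
      sigma (-1) μ.1 * Complex.exp (2 * Complex.I * Real.pi *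
        ∑ k, (((v k μ.1 / v k δ * (z k).re : ℝ) : ℂ) +
          ((|v k μ.1 / v k δ| : ℝ) : ℂ) * Complex.I * ((z k).im : ℂ)))

variable (F) in
/-- The additional term of `ω_Eis` in degree `n = m + 1`; it is zero unless `n = 2`. -/
def eisCorrection : (m : ℕ) → DForm (m + 1) (m + 1)
  | 1 => fun z => ((Units.regulator F / 2 : ℝ) : ℂ) •
      ((1 / ((z 0).im : ℂ) ^ 2) • wedge ![dz 0, dzbar 0] -
        (1 / ((z 1).im : ℂ) ^ 2) • wedge ![dz 1, dzbar 1])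
  | _ => fun _ => 0

variable (F) in
/-- The term subtracted from `∂h̃/∂z_k`, `k ≠ j`, when `n = m + 1 = 2`; it is zero otherwise. -/
def etaCorrection : (m : ℕ) → Fin (m + 1) → (Fin (m + 1) → ℂ) → ℂ
  | 1, j, z => 2 * (Units.regulator F : ℂ) / (Complex.I * ((z (j.succAbove 0)).im : ℂ))
  | _, _, _ => 0

variable {m : ℕ} (w : Fin (m + 1) → (F →+* ℝ))

/-- The `n`-form `ω_Eis`, for `n = m + 1`. -/
def omegaEis (δ : 𝓞 F) : DForm (m + 1) (m + 1) := fun z =>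
  ((2 * Complex.I * Real.pi) ^ (m + 1) / (Real.sqrt (discr F) : ℂ) * E2 w δ z) •
    wedge (fun k => dz k) + eisCorrection F m z

/-- The form `(Id + T_{v_j}^*) ω_Eis`. -/
def omegaEisPlus (δ : 𝓞 F) (j : Fin (m + 1)) (ε : (𝓞 F)ˣ) : DForm (m + 1) (m + 1) := fun z =>
  omegaEis w δ z + pullback (heckeInfty w j ε) (omegaEis w δ) z

/-- The `(n-1)`-form
`(-1)^{j-1} (∂^{n-1} h̃ / ∂z_1 ⋯ (omit ∂z_j) ⋯ ∂z_n) dz_1 ∧ ⋯ (omit dz_j) ⋯ ∧ dz_n`, for `n = m + 1`,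
the coefficient being replaced by `∂h̃/∂z_k - 2 R_F / (i y_k)`, `k ≠ j`, when `n = 2`.
(The indices in the code start at `0`.) -/
def etaForm (δ : 𝓞 F) (j : Fin (m + 1)) : DForm (m + 1) m := fun z =>
  ((-1) ^ (j : ℕ) *
    (dWirtIter (List.ofFn j.succAbove) (hTilde w δ) z - etaCorrection F m j z)) •
    wedge (fun k => dz (j.succAbove k))

end Field

end HilbertEisenstein

end

open NumberField
open scoped ContDiff

set_option linter.unusedSectionVars false

/-! The mechanism is a Kronecker limit formula. Up to a multiple of `∑ log y_k`, Asai's function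
`h̃` is `Γ`-invariant, and its mixed derivative in all variables but `z_j` is a primitive of the
symmetrised Eisenstein form.

Invariance. Put `Y = ∏ y_k`, `q = d_F / π^n` and `Λ(s) = q^s Γ(s)^n ζ_F(2s)` (`complZeta`). The
series `E(z, s) = ∑ ∏ (y_k / |c_k z_k + d_k|²)^s`, over nonzero pairs `(c, d)` modulo units, is
`Γ`-invariant. Poisson summation in `d` for each `c ≠ 0` (`hasSum_row`) gives for real `s > 1` `q^s
Γ(s)^n E(z, s) = Y^s Λ(s) + Y^{1-s} Λ(s - 1/2) + φ(s, z)` (`exists_hasSum_eisTerm`). Here `φ`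
(`phiSum`) is a series of products of Bessel kernels over pairs of an ideal `I` and an integer `ν ≠
0`. It is entire in `s`, by exponential decay, and satisfies `φ(1 - s, z) = φ(s, z)`, because `(I,
ν)` may be exchanged for a pair with the same product and with the norms of the two factors
interchanged (`phiSum_one_sub`).

Continuation of `ζ_F`. Comparing two points of the diagonal exchanged by `z ↦ -1/z`, with `Y =
e^{±x}`, gives for every `x > 0` a linear equation `sinh(xs) Λ(s) + sinh(x(1-s)) Λ(s - 1/2) + Ψ_x(s)
= 0` with `Ψ_x` entire and symmetric under `s ↦ 1 - s` (`diag_equation`). The equations at `x` and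
`2x` determine `Λ(s)` by Cramer's rule as a quotient of entire functions, which continues `Λ`. The
symmetry of `Ψ_x` then yields `Λ(1 - s) = Λ(s - 1/2)` (`contFun_one_sub`). At `s = 0` this reads
`Λ(-1/2) = Λ(1)`, which relates `ζ_F(-1)` to `ζ_F(2)` (`zetaF_neg_one`).

Limit. As `s → 1` the only pole comes from `Λ(s - 1/2)`; its residue `2^n R_F / 4` is given by the
class number formula. Hence `Y Λ(1) + φ(1, z) - (2^n R_F / 4) log Y` is invariant
(`limit_invariant`). At `s = 1` the Bessel kernels are elementary, and `2^n (Y Λ(1) + φ(1, z)) =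
h̃(z)` (`hTilde_eq`). So `H = h̃ - (4^n R_F / 4) ∑ log y_k` is invariant (`hTilde_moebius`).

The primitive. Differentiating an invariant function once in each `z_k`, `k ≠ j`, produces the
automorphy factors inverse to those of the corresponding `dz_k` (`dWirtIter_moebius`). The form
obtained is therefore invariant, and it is `η_j`: two different derivatives kill the logarithms when
`n ≥ 3`, and one derivative leaves the correction term when `n = 2`. In `dη_j` no `dz̄_k` with `k ≠
j` occurs, since every exponential of `h̃` is holomorphic or antiholomorphic in each variable. The
`dz_j` component retains the totally positive `μ` and is the Eisenstein series, because `σ_{-1}(μ)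
N(μ) = σ_1(μ)`. The `dz̄_j` component retains the `μ` that are negative exactly at `v_j`;
multiplication by `ε⁻¹` makes these totally positive, so it is the pullback by `T_{v_j}`
(`hSeries_eq_E2`, `hSeries_eq_E2_heckeInfty`). -/

namespace HilbertEisenstein

open MeasureTheory Set Filter Topology

/-! ### Poisson summation on `ℤⁿ` -/

section Poisson

variable {ι : Type*} [Fintype ι]

/-- The half-open unit box with lower corner `a`. -/
def unitBox (a : ι → ℝ) : Set (ι → ℝ) := {x | ∀ i, x i ∈ Ioc (a i) (a i + 1)}

theorem measurableSet_unitBox (a : ι → ℝ) : MeasurableSet (unitBox a) :=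
  MeasurableSet.univ_pi' fun _ => measurableSet_Ioc

theorem iUnion_unitBox : ⋃ a : ι → ℤ, unitBox (fun i => (a i : ℝ)) = univ := by
  -- The boxes are open on the left and closed on the right, so the corner is `⌈x i⌉ - 1` and not
  -- the floor.
  refine eq_univ_of_forall fun x => mem_iUnion.2 ⟨fun i => ⌈x i⌉ - 1, fun i => ?_⟩
  have h1 := Int.ceil_lt_add_one (x i)
  have h2 := Int.le_ceil (x i)
  push_cast
  constructor <;> linarith

theorem pairwise_disjoint_unitBox :
    Pairwise (Function.onFun Disjoint fun a : ι → ℤ => unitBox (fun i => (a i : ℝ))) := by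
  intro a b hab
  refine Set.disjoint_left.2 fun x hx hy => hab ?_
  funext i
  obtain ⟨h1, h2⟩ := hx i
  obtain ⟨h3, h4⟩ := hy i
  have h5 : a i < b i + 1 := by
    have h := h1.trans_le h4
    dsimp only at h
    exact_mod_cast h
  have h6 : b i < a i + 1 := by
    have h := h3.trans_le h2
    dsimp only at h
    exact_mod_cast h
  omega

theorem setIntegral_unitBox {E : Type*} [NormedAddCommGroup E] [NormedSpace ℝ E]
    (f : (ι → ℝ) → E) (a : ι → ℝ) :
    ∫ x in unitBox a, f x = ∫ x in unitBox (0 : ι → ℝ), f (x + a) := by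
  have h := (measurePreserving_add_right (volume : Measure (ι → ℝ)) a).setIntegral_preimage_emb
    (measurableEmbedding_addRight a) f (unitBox a)
  rw [← h]
  congr 2
  ext x
  simp only [unitBox, mem_preimage, mem_ofPred_eq, Pi.add_apply, Pi.zero_apply, mem_Ioc]
  refine forall_congr' fun i => ⟨fun h => ⟨by linarith [h.1], by linarith [h.2]⟩,
    fun h => ⟨by linarith [h.1], by linarith [h.2]⟩⟩

theorem hasSum_setIntegral_unitBox {E : Type*} [NormedAddCommGroup E] [NormedSpace ℝ E]
    {f : (ι → ℝ) → E} (hf : Integrable f) :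
    HasSum (fun a : ι → ℤ => ∫ x in unitBox (0 : ι → ℝ), f (x + fun i => (a i : ℝ)))
      (∫ x, f x) := by
  have h := hasSum_integral_iUnion (μ := volume) (f := f)
    (fun a : ι → ℤ => measurableSet_unitBox (fun i => (a i : ℝ))) pairwise_disjoint_unitBox
    hf.integrableOn
  rw [iUnion_unitBox, setIntegral_univ] at h
  have heq : (fun a : ι → ℤ => ∫ x in unitBox (fun i => (a i : ℝ)), f x) = fun a : ι → ℤ =>
      ∫ x in unitBox (0 : ι → ℝ), f (x + fun i => (a i : ℝ)) :=
    funext fun a => setIntegral_unitBox f _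
  rwa [heq] at h

theorem volume_unitBox (a : ι → ℝ) : (volume : Measure (ι → ℝ)) (unitBox a) = 1 := by
  have : unitBox a = Set.pi univ fun i => Ioc (a i) (a i + 1) := by
    ext x
    exact ⟨fun h i _ => h i, fun h i => h i trivial⟩
  rw [this, volume_pi_pi]
  exact Finset.prod_eq_one fun i _ => by rw [Real.volume_Ioc, add_sub_cancel_left, ENNReal.ofReal_one]

/-- A nonnegative integrable function which is comparable to its values at points of the same
unit box is summable over `ℤⁿ`, locally uniformly. -/
theorem exists_summable_bound {f : (ι → ℝ) → ℝ} (hf : Integrable f) {C : ℝ}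
    (hC : ∀ x u, (∀ i, |x i - u i| ≤ 2) → f x ≤ C * f u) :
    ∃ B : (ι → ℤ) → ℝ, Summable B ∧ ∀ (a : ι → ℤ) (x : ι → ℝ), ‖x‖ ≤ 1 →
      f (x + fun i => (a i : ℝ)) ≤ B a := by
  refine ⟨fun a => C * ∫ x in unitBox (0 : ι → ℝ), f (x + fun i => (a i : ℝ)),
    (hasSum_setIntegral_unitBox hf).summable.mul_left C, fun a x hx => ?_⟩
  -- The box has volume 1, so the single value is its own average over the box and can be compared
  -- with the integrand pointwise.
  have hconst : f (x + fun i => (a i : ℝ)) =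
      ∫ _ in unitBox (0 : ι → ℝ), f (x + fun i => (a i : ℝ)) := by
    rw [setIntegral_const, Measure.real, volume_unitBox]
    simp
  dsimp only
  rw [← integral_const_mul, hconst]
  refine setIntegral_mono_on ?_ ?_ (measurableSet_unitBox _) ?_
  · exact integrableOn_const (by rw [volume_unitBox]; simp)
  · exact ((hf.comp_add_right _).integrableOn).const_mul C
  · intro u hu
    refine hC _ _ fun i => ?_
    have := hu i
    have h2 := abs_le.1 ((norm_le_pi_norm x i).trans hx)
    simp only [Pi.zero_apply, zero_add, mem_Ioc] at this
    simp only [Pi.add_apply, add_sub_add_right_eq_sub, abs_le]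
    constructor <;> linarith [h2.1, h2.2, this.1, this.2]

/-- The lift to the torus of a periodic continuous function. -/
theorem exists_torus_lift {F : (ι → ℝ) → ℂ} (hF : Continuous F)
    (hper : ∀ (x : ι → ℝ) (a : ι → ℤ), F (x + fun i => (a i : ℝ)) = F x) :
    ∃ G : C(UnitAddTorus ι, ℂ), ∀ x : ι → ℝ, G (fun i => (x i : UnitAddCircle)) = F x := by
  have hq : IsOpenQuotientMap (fun (x : ι → ℝ) (i : ι) => (x i : UnitAddCircle)) :=
    IsOpenQuotientMap.piMap fun _ => QuotientAddGroup.isOpenQuotientMap_mk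
  let G : UnitAddTorus ι → ℂ := fun t => F (Function.surjInv hq.surjective t)
  have hG : ∀ x : ι → ℝ, G (fun i => (x i : UnitAddCircle)) = F x := by
    intro x
    have h := Function.surjInv_eq hq.surjective (fun i => (x i : UnitAddCircle))
    set y := Function.surjInv hq.surjective (fun i => (x i : UnitAddCircle))
    have h2 : ∀ i, ∃ k : ℤ, (k : ℝ) = y i - x i := fun i => by
      have h3 : ((y i - x i : ℝ) : UnitAddCircle) = 0 := by
        have := congrFun h i
        rw [AddCircle.coe_sub, sub_eq_zero]
        exact this
      obtain ⟨k, hk⟩ := (AddCircle.coe_eq_zero_iff (1 : ℝ)).1 h3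
      exact ⟨k, by simpa using hk⟩
    choose a ha using h2
    change F y = F x
    rw [← hper x a]
    congr 1
    funext i
    simp [ha]
  refine ⟨⟨G, ?_⟩, hG⟩
  rw [hq.isQuotientMap.continuous_iff]
  have : G ∘ (fun (x : ι → ℝ) (i : ι) => (x i : UnitAddCircle)) = F := funext hG
  rw [this]
  exact hF

theorem mFourier_coe (m : ι → ℤ) (x : ι → ℝ) :
    UnitAddTorus.mFourier m (fun i => (x i : UnitAddCircle)) =
      Complex.exp (2 * Real.pi * Complex.I * ∑ i, (m i : ℂ) * x i) := by
  simp only [UnitAddTorus.mFourier, ContinuousMap.coe_mk, fourier_coe_apply, Finset.mul_sum,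
    Complex.exp_sum]
  refine Finset.prod_congr rfl fun i _ => ?_
  congr 1
  push_cast
  ring

/-- Poisson summation on `ℤⁿ`. -/
theorem poisson_summation {f : (ι → ℝ) → ℂ} (hf : Continuous f) (hfi : Integrable f)
    {B : (ι → ℤ) → ℝ} (hB : Summable B)
    (hfB : ∀ (a : ι → ℤ) (x : ι → ℝ), ‖x‖ ≤ 1 →
      ‖f (x + fun i => (a i : ℝ))‖ ≤ B a)
    (hsum : Summable fun m : ι → ℤ =>
      ∫ x, Complex.exp (-(2 * Real.pi * Complex.I * ∑ i, (m i : ℂ) * x i)) * f x) :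
    ∑' a : ι → ℤ, f (fun i => (a i : ℝ)) =
      ∑' m : ι → ℤ, ∫ x, Complex.exp (-(2 * Real.pi * Complex.I * ∑ i, (m i : ℂ) * x i)) * f x := by
  set F : (ι → ℝ) → ℂ := fun x => ∑' a : ι → ℤ, f (x + fun i => (a i : ℝ)) with hFdef
  have hper : ∀ (x : ι → ℝ) (b : ι → ℤ), F (x + fun i => (b i : ℝ)) = F x := by
    intro x b
    rw [hFdef]
    dsimp only
    rw [← (Equiv.addLeft b).tsum_eq (fun a : ι → ℤ => f (x + fun i => (a i : ℝ)))]
    refine tsum_congr fun a => ?_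
    congr 1
    funext i
    simp [add_assoc]
  have hcontOn : ContinuousOn F {x | ‖x‖ ≤ 1} := by
    refine continuousOn_tsum (fun a => ?_) hB fun a x hx => hfB a x hx
    exact (hf.comp (by fun_prop)).continuousOn
  have hcont : Continuous F := by
    refine continuous_iff_continuousAt.2 fun x₀ => ?_
    -- Translation by `b` moves `x₀` into `[0, 1)ⁿ`, inside the open unit ball of the sup norm,
    -- where the series converges uniformly.
    set b : ι → ℤ := fun i => -⌊x₀ i⌋
    have hF : F = fun x => F (x + fun i => (b i : ℝ)) := funext fun x => (hper x b).symm
    rw [hF]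
    have hmem : {x : ι → ℝ | ‖x‖ ≤ 1} ∈ 𝓝 (x₀ + fun i => (b i : ℝ)) := by
      refine mem_of_superset (Metric.isOpen_ball.mem_nhds (x := x₀ + fun i => (b i : ℝ))
        (s := Metric.ball 0 1) ?_) fun x hx => ?_
      · rw [mem_ball_zero_iff, pi_norm_lt_iff one_pos]
        intro i
        have h1 := Int.floor_le (x₀ i)
        have h2 := Int.lt_floor_add_one (x₀ i)
        simp only [Pi.add_apply, b, Real.norm_eq_abs]
        push_cast
        rw [abs_lt]
        constructor <;> linarith
      · exact (mem_ball_zero_iff.1 hx).le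
    exact ContinuousAt.comp (f := fun x => x + fun i => (b i : ℝ)) (hcontOn.continuousAt hmem)
      (by fun_prop)
  obtain ⟨G, hG⟩ := exists_torus_lift hcont hper
  -- Unfolding: the characters are `ℤⁿ`-periodic, so the integral of the periodised function over
  -- one box is the integral of `f` against the character over `ℝⁿ`.
  have hcoef : ∀ m : ι → ℤ, UnitAddTorus.mFourierCoeff G m =
      ∫ x, Complex.exp (-(2 * Real.pi * Complex.I * ∑ i, (m i : ℂ) * x i)) * f x := by
    intro m
    rw [UnitAddTorus.mFourierCoeff_eq_integral _ _ 0]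
    change ∫ x in unitBox 0, _ = _
    set g : (ι → ℝ) → ℂ := fun x =>
      Complex.exp (-(2 * Real.pi * Complex.I * ∑ i, (m i : ℂ) * x i)) * f x with hg
    have hgi : Integrable g := by
      refine hfi.bdd_mul (c := 1) (Continuous.aestronglyMeasurable (by fun_prop)) (Eventually.of_forall fun x => ?_)
      rw [Complex.norm_exp]
      simp [← Complex.ofReal_intCast, ← Complex.ofReal_mul, ← Complex.ofReal_sum]
    have h1 : ∀ x : ι → ℝ, UnitAddTorus.mFourier (-m) (fun i => (x i : UnitAddCircle)) •
        G (fun i => (x i : UnitAddCircle)) = ∑' a : ι → ℤ, g (x + fun i => (a i : ℝ)) := by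
      intro x
      rw [hG, mFourier_coe, smul_eq_mul, hFdef, ← tsum_mul_left]
      refine tsum_congr fun a => ?_
      rw [hg]
      congr 1
      rw [Complex.exp_eq_exp_iff_exists_int]
      refine ⟨∑ i, m i * a i, ?_⟩
      simp only [Pi.neg_apply, Int.cast_neg, neg_mul, Finset.sum_neg_distrib, mul_neg,
        Pi.add_apply, Complex.ofReal_add, mul_add, Finset.sum_add_distrib, Complex.ofReal_intCast]
      push_cast
      ring
    simp only [h1]
    rw [← integral_tsum_of_summable_integral_norm]
    · exact (hasSum_setIntegral_unitBox hgi).tsum_eq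
    · exact fun a => (hgi.comp_add_right _).integrableOn
    · exact (hasSum_setIntegral_unitBox hgi.norm).summable
  have hs : Summable (UnitAddTorus.mFourierCoeff G) := by
    simpa only [← hcoef] using hsum
  have h := UnitAddTorus.hasSum_mFourier_series_apply_of_summable hs
    (fun i => ((0 : ι → ℝ) i : UnitAddCircle))
  rw [hG] at h
  have h0 : F 0 = ∑' a : ι → ℤ, f (fun i => (a i : ℝ)) := by simp [hFdef]
  rw [← h0, ← h.tsum_eq]
  refine tsum_congr fun m => ?_
  rw [mFourier_coe, hcoef]
  simp

/-- A nonnegative integrable weight whose values at points of bounded distance are comparable. -/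
structure IsWeight (φ : ℝ → ℝ) : Prop where
  nonneg : ∀ y, 0 ≤ φ y
  cont : Continuous φ
  integrable : Integrable φ
  slow : ∀ R : ℝ, ∃ C : ℝ, 0 ≤ C ∧ ∀ y h, |h| ≤ R → φ (y + h) ≤ C * φ y

/-! ### Products of weights on a shifted lattice `p + A ℤⁿ` -/

variable [DecidableEq ι] {A : Matrix ι ι ℝ} (hA : A.det ≠ 0)

include hA in
theorem measurePreserving_mulVec :
    MeasurePreserving (fun u => A.mulVec u) volume
      (ENNReal.ofReal |A.det⁻¹| • (volume : Measure (ι → ℝ))) := by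
  refine ⟨by fun_prop, ?_⟩
  exact Real.map_matrix_volume_pi_eq_smul_volume_pi hA

include hA in
theorem measurableEmbedding_mulVec : MeasurableEmbedding (fun u => A.mulVec u) := by
  have h : Function.Injective (fun u => A.mulVec u) :=
    Matrix.mulVec_injective_iff_isUnit.2 ((Matrix.isUnit_iff_isUnit_det A).2 hA.isUnit)
  have hc : Continuous (fun u => A.mulVec u) := by fun_prop
  exact hc.measurableEmbedding h

include hA in
theorem integral_comp_add_mulVec {E : Type*} [NormedAddCommGroup E] [NormedSpace ℝ E]
    (p : ι → ℝ) (g : (ι → ℝ) → E) :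
    ∫ u, g (p + A.mulVec u) = |A.det|⁻¹ • ∫ y, g y := by
  have h := (measurePreserving_mulVec hA).integral_comp (measurableEmbedding_mulVec hA)
    (fun y => g (p + y))
  rw [h, integral_smul_measure, integral_add_left_eq_self, abs_inv,
    ENNReal.toReal_ofReal (by positivity)]

include hA in
theorem integrable_comp_add_mulVec {E : Type*} [NormedAddCommGroup E] 
    (p : ι → ℝ) {g : (ι → ℝ) → E} (hg : Integrable g) :
    Integrable fun u => g (p + A.mulVec u) := by
  have h := (measurePreserving_mulVec hA).integrable_comp_emb (measurableEmbedding_mulVec hA)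
    (g := fun y => g (p + y))
  exact h.2 ((hg.comp_add_left p).smul_measure (by simp))

include hA in
-- When `x` and `u` differ by at most 2 in each coordinate, the `k`-th coordinates of their images
-- differ by at most `2 ∑ |A k i|`. Slow variation with this radius gives the comparison required by
-- `exists_summable_bound`.
theorem exists_summable_bound_prod {φ : ι → ℝ → ℝ} (hφ : ∀ k, IsWeight (φ k)) (p : ι → ℝ) :
    ∃ B : (ι → ℤ) → ℝ, Summable B ∧ ∀ (a : ι → ℤ) (x : ι → ℝ), ‖x‖ ≤ 1 →
      ∏ k, φ k (p k + A.mulVec (x + fun i => (a i : ℝ)) k) ≤ B a := by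
  have hi : Integrable fun u : ι → ℝ => ∏ k, φ k ((p + A.mulVec u) k) :=
    integrable_comp_add_mulVec hA p (g := fun y => ∏ k, φ k (y k))
      (Integrable.fintype_prod fun k => (hφ k).integrable)
  choose C hC0 hC using fun k => (hφ k).slow (2 * ∑ i, |A k i|)
  refine exists_summable_bound hi (C := ∏ k, C k) fun x u hxu => ?_
  rw [← Finset.prod_mul_distrib]
  refine Finset.prod_le_prod (fun k _ => (hφ k).nonneg _) fun k _ => ?_
  have h1 : (p + A.mulVec x) k = (p + A.mulVec u) k + A.mulVec (x - u) k := by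
    simp only [Matrix.mulVec_sub, Pi.add_apply, Pi.sub_apply]
    ring
  rw [h1]
  refine hC k _ _ ?_
  rw [Matrix.mulVec, dotProduct, Finset.mul_sum]
  refine (Finset.abs_sum_le_sum_abs _ _).trans (Finset.sum_le_sum fun i _ => ?_)
  rw [abs_mul, mul_comm]
  exact mul_le_mul_of_nonneg_right (hxu i) (abs_nonneg _)

include hA in
theorem summable_prod_weight {φ : ι → ℝ → ℝ} (hφ : ∀ k, IsWeight (φ k)) (p : ι → ℝ) :
    Summable fun a : ι → ℤ => ∏ k, φ k (p k + A.mulVec (fun i => (a i : ℝ)) k) := by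
  obtain ⟨B, hB, h⟩ := exists_summable_bound_prod hA hφ p
  refine Summable.of_nonneg_of_le (fun a => Finset.prod_nonneg fun k _ => (hφ k).nonneg _)
    (fun a => ?_) hB
  simpa using h a 0 (by simp)

include hA in
/-- Poisson summation for a product of weights on a shifted lattice; the dual vectors are given by a
function `w` with `A ᵀ (w m) = m`. -/
theorem poisson_summation_prod {φ : ι → ℝ → ℝ} (hφ : ∀ k, IsWeight (φ k)) (p : ι → ℝ)
    {w : (ι → ℤ) → ι → ℝ} (hw : ∀ m i, A.transpose.mulVec (w m) i = m i)
    (hsum : Summable fun m : ι → ℤ =>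
      Complex.exp (2 * Real.pi * Complex.I * ∑ k, (w m k : ℂ) * p k) *
        ∏ k, ∫ x : ℝ, Complex.exp (-(2 * Real.pi * Complex.I * (w m k * x))) * (φ k x : ℂ)) :
    ∑' a : ι → ℤ, ((∏ k, φ k (p k + A.mulVec (fun i => (a i : ℝ)) k) : ℝ) : ℂ) =
      (|A.det|⁻¹ : ℝ) * ∑' m : ι → ℤ,
        (Complex.exp (2 * Real.pi * Complex.I * ∑ k, (w m k : ℂ) * p k) *
        ∏ k, ∫ x : ℝ, Complex.exp (-(2 * Real.pi * Complex.I * (w m k * x))) * (φ k x : ℂ)) := by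
  set f : (ι → ℝ) → ℂ := fun u => ((∏ k, φ k (p k + A.mulVec u k) : ℝ) : ℂ) with hf
  have hi : Integrable fun u : ι → ℝ => ∏ k, φ k ((p + A.mulVec u) k) :=
    integrable_comp_add_mulVec hA p (g := fun y => ∏ k, φ k (y k))
      (Integrable.fintype_prod fun k => (hφ k).integrable)
  have hcoef : ∀ m : ι → ℤ,
      ∫ x, Complex.exp (-(2 * Real.pi * Complex.I * ∑ i, (m i : ℂ) * x i)) * f x =
      (|A.det|⁻¹ : ℝ) * (Complex.exp (2 * Real.pi * Complex.I * ∑ k, (w m k : ℂ) * p k) *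
        ∏ k, ∫ x : ℝ, Complex.exp (-(2 * Real.pi * Complex.I * (w m k * x))) * (φ k x : ℂ)) := by
    intro m
    -- Since `Aᵀ w(m) = m`, the pairing `m · x` is `w(m) · A x`. After the substitution `y = p + A
    -- x` the coefficient splits into one-dimensional transforms times the phase coming from `p`.
    have h1 : ∀ x : ι → ℝ, ∑ i, (m i : ℂ) * x i = ∑ k, (w m k : ℂ) * (A.mulVec x k : ℝ) := by
      intro x
      have h2 : ∑ i, (m i : ℝ) * x i = ∑ k, w m k * A.mulVec x k := by
        have h3 : ∑ i, (m i : ℝ) * x i = dotProduct (A.transpose.mulVec (w m)) x := by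
          simp only [dotProduct, hw]
        rw [h3, Matrix.mulVec_transpose, ← Matrix.dotProduct_mulVec]
        rfl
      have := congrArg (fun r : ℝ => (r : ℂ)) h2
      push_cast at this
      exact this
    have h4 := integral_comp_add_mulVec hA p (fun y : ι → ℝ =>
      Complex.exp (2 * Real.pi * Complex.I * ∑ k, (w m k : ℂ) * p k) *
        ∏ k, (Complex.exp (-(2 * Real.pi * Complex.I * (w m k * y k))) * (φ k (y k) : ℂ)))
    rw [integral_const_mul, integral_const_mul, integral_fintype_prod_volume_eq_prod (fun k (y : ℝ) =>
      Complex.exp (-(2 * Real.pi * Complex.I * (w m k * y))) * (φ k y : ℂ)),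
      Complex.real_smul] at h4
    rw [← h4, ← integral_const_mul]
    refine congrArg (fun g : (ι → ℝ) → ℂ => ∫ x, g x) (funext fun x => ?_)
    rw [h1, hf, Finset.prod_mul_distrib, ← Complex.exp_sum, ← mul_assoc, ← Complex.exp_add]
    congr 1
    · congr 1
      simp only [Pi.add_apply, Complex.ofReal_add, mul_add, Finset.mul_sum,
        Finset.sum_neg_distrib, Finset.sum_add_distrib, neg_add]
      ring
    · push_cast
      rfl
  obtain ⟨B, hB, hb⟩ := exists_summable_bound_prod hA hφ p
  have hfc : Continuous f := by
    refine Complex.continuous_ofReal.comp (continuous_finsetProd _ fun k _ => ?_)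
    exact (hφ k).cont.comp (by fun_prop)
  have hmain := poisson_summation (f := f) hfc hi.ofReal hB (fun a x hx => by
    rw [hf, Complex.norm_real, Real.norm_of_nonneg (Finset.prod_nonneg fun k _ => (hφ k).nonneg _)]
    exact hb a x hx) (by simpa only [hcoef] using hsum.mul_left _)
  rw [hmain, ← tsum_mul_left]
  exact tsum_congr hcoef

end Poisson

/-! ### The Bessel kernel -/

section Bessel

/-- `K_s(a) = ∫₀^∞ u^{s-3/2} e^{-a(u + 1/u)} du`. -/
noncomputable def besselK (s : ℂ) (a : ℝ) : ℂ :=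
  mellin (fun u : ℝ => ((Real.exp (-(a * (u + u⁻¹))) : ℝ) : ℂ)) (s - 1 / 2)

theorem locallyIntegrableOn_besselKernel (a : ℝ) :
    LocallyIntegrableOn (fun u : ℝ => ((Real.exp (-(a * (u + u⁻¹))) : ℝ) : ℂ)) (Ioi 0) := by
  refine ContinuousOn.locallyIntegrableOn ?_ measurableSet_Ioi
  refine Complex.continuous_ofReal.comp_continuousOn (Real.continuous_exp.comp_continuousOn ?_)
  refine (continuousOn_const.mul (continuousOn_id.add (continuousOn_inv₀.mono ?_))).neg
  intro x hx
  exact (ne_of_gt hx : x ≠ 0)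

theorem besselKernel_isBigO_top {a : ℝ} (ha : 0 < a) :
    (fun u : ℝ => ((Real.exp (-(a * (u + u⁻¹))) : ℝ) : ℂ)) =O[atTop]
      fun t => Real.exp (-a * t) := by
  refine Asymptotics.IsBigO.of_bound 1 ?_
  filter_upwards [eventually_gt_atTop 0] with u hu
  rw [Complex.norm_real, one_mul, Real.norm_of_nonneg (Real.exp_pos _).le,
    Real.norm_of_nonneg (Real.exp_pos _).le, Real.exp_le_exp]
  have : 0 < a * u⁻¹ := by positivity
  nlinarith

/-- The factor `e^{-a/u}` beats every power at 0, as one sees by inverting `u`. Together with the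
decay at infinity this makes the Mellin transform converge everywhere, so `besselK` is entire in
`s`. -/
theorem besselKernel_isBigO_zero {a : ℝ} (ha : 0 < a) (b : ℝ) :
    (fun u : ℝ => ((Real.exp (-(a * (u + u⁻¹))) : ℝ) : ℂ)) =O[𝓝[>] 0] (· ^ (-b) : ℝ → ℝ) := by
  have h := ((isLittleO_exp_neg_mul_rpow_atTop ha b).comp_tendsto
    tendsto_inv_nhdsGT_zero).isBigO
  have h2 : ((fun x : ℝ => x ^ b) ∘ fun x => x⁻¹) =ᶠ[𝓝[>] (0 : ℝ)] (· ^ (-b) : ℝ → ℝ) := by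
    filter_upwards [self_mem_nhdsWithin] with u hu
    rw [Function.comp_apply, Real.inv_rpow (le_of_lt hu), Real.rpow_neg (le_of_lt hu)]
  refine Asymptotics.IsBigO.trans ?_ (h.trans_eventuallyEq h2)
  refine Asymptotics.IsBigO.of_bound 1 ?_
  filter_upwards [self_mem_nhdsWithin] with u hu
  rw [Complex.norm_real, one_mul, Real.norm_of_nonneg (Real.exp_pos _).le, Function.comp_apply,
    Real.norm_of_nonneg (Real.exp_pos _).le, Real.exp_le_exp]
  have : 0 < a * u := mul_pos ha hu
  nlinarith

theorem mellinConvergent_besselKernel {a : ℝ} (ha : 0 < a) (w : ℂ) :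
    MellinConvergent (fun u : ℝ => ((Real.exp (-(a * (u + u⁻¹))) : ℝ) : ℂ)) w :=
  mellinConvergent_of_isBigO_rpow_exp ha (locallyIntegrableOn_besselKernel a)
    (besselKernel_isBigO_top ha) (besselKernel_isBigO_zero ha (w.re - 1)) (by linarith)

theorem differentiable_besselK {a : ℝ} (ha : 0 < a) : Differentiable ℂ fun s => besselK s a := by
  intro s
  have h := mellin_differentiableAt_of_isBigO_rpow_exp (s := s - 1 / 2) ha
    (locallyIntegrableOn_besselKernel a)
    (besselKernel_isBigO_top ha) (besselKernel_isBigO_zero ha ((s - 1 / 2).re - 1)) (by linarith)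
  exact h.comp s ((differentiableAt_id).sub_const _)

/-- The substitution `u ↦ 1/u` fixes the kernel and negates the Mellin exponent. All functional
equations below start from here. -/
theorem besselK_one_sub (s : ℂ) (a : ℝ) : besselK (1 - s) a = besselK s a := by
  rw [besselK, besselK, show 1 - s - 1 / 2 = -(s - 1 / 2) by ring, ← mellin_comp_inv]
  congr 1
  funext u
  rw [inv_inv, add_comm]

theorem besselK_ofReal (σ a : ℝ) :
    besselK σ a =
      ((∫ u in Ioi 0, u ^ (σ - 1 / 2 - 1) * Real.exp (-(a * (u + u⁻¹))) : ℝ) : ℂ) := by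
  rw [besselK, mellin, ← integral_complex_ofReal]
  refine setIntegral_congr_fun measurableSet_Ioi fun u hu => ?_
  rw [smul_eq_mul, Complex.ofReal_mul, Complex.ofReal_cpow (le_of_lt hu)]
  push_cast
  rfl

theorem integrableOn_besselKernel {a : ℝ} (ha : 0 < a) (σ : ℝ) :
    IntegrableOn (fun u : ℝ => u ^ (σ - 1) * Real.exp (-(a * (u + u⁻¹)))) (Ioi 0) := by
  have h : IntegrableOn (fun u : ℝ => ‖(u : ℂ) ^ ((σ : ℂ) - 1) •
      ((Real.exp (-(a * (u + u⁻¹))) : ℝ) : ℂ)‖) (Ioi 0) := (mellinConvergent_besselKernel ha (σ : ℂ)).norm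
  refine h.congr_fun (fun u hu => ?_) measurableSet_Ioi
  dsimp only
  rw [norm_smul, Complex.norm_cpow_eq_rpow_re_of_pos hu, Complex.norm_real,
    Real.norm_of_nonneg (Real.exp_pos _).le]
  simp

/-- In the strip the power of `u` is dominated by the sum of the two extreme powers, whose integrals
agree by the symmetry `u ↦ 1/u`. From `u + 2/u ≥ 2` follows `a (u + 1/u) ≥ a + a u / 2`: the first
term gives the decay `e^{-a}`, the second leaves a Gamma integral. Uniformity in the strip is what
makes `phiSum` holomorphic in `s`. -/
theorem norm_besselK_le {a P : ℝ} (ha : 0 < a) (hP : 0 < P) {s : ℂ} (hs : |s.re - 1 / 2| ≤ P) :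
    ‖besselK s a‖ ≤ 2 * ((2 / a) ^ P * Real.Gamma P) * Real.exp (-a) := by
  set M : ℝ → ℝ := fun σ => ∫ u in Ioi 0, u ^ (σ - 1) * Real.exp (-(a * (u + u⁻¹))) with hM
  have hsymm : M (-P) = M P := by
    have h1 := besselK_ofReal (1 / 2 + P) a
    have h2 := besselK_ofReal (1 / 2 - P) a
    have h3 := besselK_one_sub ((1 / 2 + P : ℝ) : ℂ) a
    rw [show 1 - (((1 / 2 + P : ℝ)) : ℂ) = ((1 / 2 - P : ℝ) : ℂ) by push_cast; ring, h1, h2] at h3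
    have h4 := Complex.ofReal_injective h3
    rw [hM]
    dsimp only
    convert h4 using 5 <;> ring
  have hMP : M P ≤ Real.exp (-a) * ((2 / a) ^ P * Real.Gamma P) := by
    have h1 := Real.integral_rpow_mul_exp_neg_mul_Ioi hP (half_pos ha)
    rw [one_div_div] at h1
    rw [← h1, ← integral_const_mul, hM]
    refine setIntegral_mono_on (integrableOn_besselKernel ha P) ?_ measurableSet_Ioi ?_
    · refine Integrable.const_mul ?_ _
      by_contra hcon
      rw [integral_undef hcon] at h1
      have : 0 < (2 / a) ^ P * Real.Gamma P := by
        have := Real.Gamma_pos_of_pos hP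
        positivity
      linarith
    · intro u hu
      rw [mul_left_comm]
      refine mul_le_mul_of_nonneg_left ?_ (Real.rpow_nonneg (le_of_lt hu) _)
      rw [← Real.exp_add, Real.exp_le_exp]
      have hu' : (0 : ℝ) < u := hu
      have h3 : u * u⁻¹ = 1 := mul_inv_cancel₀ hu'.ne'
      have h4 : 0 < u⁻¹ := by positivity
      have h5 : u + 2 * u⁻¹ ≥ 2 := by nlinarith [sq_nonneg (u - 1), sq_nonneg (u⁻¹ - 1)]
      nlinarith
  calc ‖besselK s a‖ ≤ ∫ u : ℝ in Ioi 0, ‖(u : ℂ) ^ (s - 1 / 2 - 1) •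
        ((Real.exp (-(a * (u + u⁻¹))) : ℝ) : ℂ)‖ := norm_integral_le_integral_norm _
    _ ≤ ∫ u in Ioi 0, (u ^ (P - 1) * Real.exp (-(a * (u + u⁻¹))) +
        u ^ (-P - 1) * Real.exp (-(a * (u + u⁻¹)))) := by
      refine setIntegral_mono_on (mellinConvergent_besselKernel ha _).norm
        ((integrableOn_besselKernel ha P).add (integrableOn_besselKernel ha (-P)))
        measurableSet_Ioi fun u hu => ?_
      rw [norm_smul, Complex.norm_cpow_eq_rpow_re_of_pos hu, Complex.norm_real,
        Real.norm_of_nonneg (Real.exp_pos _).le, ← add_mul]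
      refine mul_le_mul_of_nonneg_right ?_ (Real.exp_pos _).le
      have hu' : (0 : ℝ) < u := hu
      have hre : (s - 1 / 2 - 1).re = s.re - 1 / 2 - 1 := by simp
      rw [hre]
      obtain ⟨h1, h2⟩ := abs_le.1 hs
      rcases le_total 1 u with h | h
      · exact (Real.rpow_le_rpow_of_exponent_le h (by linarith)).trans
          (le_add_of_nonneg_right (by positivity))
      · exact (Real.rpow_le_rpow_of_exponent_ge hu' h (by linarith)).trans
          (le_add_of_nonneg_left (by positivity))
    _ = M P + M (-P) :=
      integral_add (integrableOn_besselKernel ha P) (integrableOn_besselKernel ha (-P))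
    _ ≤ _ := by rw [hsymm]; linarith

/-- By the symmetry the integrals at `s = 1` and `s = 0` coincide, so each equals their average.
With `w = √u - 1/√u` one has `u + 1/u = w² + 2` and `dw = (u^{-1/2} + u^{-3/2}) / 2 du`, so the
average is a Gaussian integral over `ℝ`. -/
theorem besselK_one {a : ℝ} (ha : 0 < a) :
    besselK 1 a = ((Real.sqrt (Real.pi / a) * Real.exp (-(2 * a)) : ℝ) : ℂ) := by
  have h1 : besselK 1 a = ((∫ u in Ioi 0, u ^ (-(1 / 2) : ℝ) * Real.exp (-(a * (u + u⁻¹))) : ℝ) : ℂ) := by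
    have := besselK_ofReal 1 a
    rw [Complex.ofReal_one] at this
    rw [this]
    norm_num
  have h0 : besselK 1 a = ((∫ u in Ioi 0, u ^ (-(3 / 2) : ℝ) * Real.exp (-(a * (u + u⁻¹))) : ℝ) : ℂ) := by
    have := besselK_ofReal 0 a
    rw [Complex.ofReal_zero] at this
    rw [← besselK_one_sub, sub_self, this]
    norm_num
  set A := ∫ u in Ioi 0, u ^ (-(1 / 2) : ℝ) * Real.exp (-(a * (u + u⁻¹)))
  set B := ∫ u in Ioi 0, u ^ (-(3 / 2) : ℝ) * Real.exp (-(a * (u + u⁻¹)))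
  have hAB : A = B := Complex.ofReal_injective (h1.symm.trans h0)
  set f : ℝ → ℝ := fun u => Real.sqrt u - (Real.sqrt u)⁻¹ with hf
  set f' : ℝ → ℝ := fun u => (u ^ (-(1 / 2) : ℝ) + u ^ (-(3 / 2) : ℝ)) / 2 with hf'
  have hpos : ∀ u ∈ Ioi (0 : ℝ), 0 < f' u := fun u hu => by
    have hu' : (0 : ℝ) < u := hu
    rw [hf']; positivity
  have hder : ∀ u ∈ Ioi (0 : ℝ), HasDerivAt f (f' u) u := by
    intro u hu
    have hu' : (0 : ℝ) < u := hu
    have hd := (Real.hasDerivAt_sqrt hu'.ne').sub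
      ((Real.hasDerivAt_sqrt hu'.ne').inv (Real.sqrt_pos.2 hu').ne')
    refine hd.congr_deriv ?_
    rw [hf']
    dsimp only
    have e1 : u ^ (-(1 / 2) : ℝ) = (Real.sqrt u)⁻¹ := by
      rw [Real.rpow_neg hu'.le, Real.sqrt_eq_rpow]
    have e2 : u ^ (-(3 / 2) : ℝ) = (Real.sqrt u)⁻¹ * u⁻¹ := by
      rw [← e1, ← Real.rpow_neg_one, ← Real.rpow_add hu']
      norm_num
    rw [e1, e2, Real.sq_sqrt hu'.le]
    have : Real.sqrt u ≠ 0 := (Real.sqrt_pos.2 hu').ne'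
    field_simp
    ring
  have hmono : StrictMonoOn f (Ioi 0) := by
    intro u hu w hw huw
    have hu' : (0 : ℝ) < u := hu
    have h3 : Real.sqrt u < Real.sqrt w := Real.sqrt_lt_sqrt hu'.le huw
    have h4 : (Real.sqrt w)⁻¹ < (Real.sqrt u)⁻¹ :=
      inv_strictAnti₀ (Real.sqrt_pos.2 hu') h3
    simp only [hf]
    linarith
  have himg : f '' Ioi 0 = univ := by
    refine eq_univ_of_forall fun w => ?_
    -- `r` plays the role of `√u`: it is the positive root of `r - 1/r = w`.
    set r := (w + Real.sqrt (w ^ 2 + 4)) / 2 with hr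
    have h5 : |w| < Real.sqrt (w ^ 2 + 4) := by
      rw [← Real.sqrt_sq_eq_abs]
      exact Real.sqrt_lt_sqrt (sq_nonneg _) (by linarith)
    have hrpos : 0 < r := by
      have := neg_abs_le w
      rw [hr]; linarith
    have hr2 : r ^ 2 = w * r + 1 := by
      have := Real.sq_sqrt (show 0 ≤ w ^ 2 + 4 by positivity)
      rw [hr]; nlinarith
    refine ⟨r ^ 2, show (0 : ℝ) < r ^ 2 by positivity, ?_⟩
    simp only [hf]
    rw [Real.sqrt_sq hrpos.le]
    field_simp
    linarith
  have hint := integral_image_eq_integral_abs_deriv_smul measurableSet_Ioi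
    (fun u hu => (hder u hu).hasDerivWithinAt) hmono.injOn (fun w => Real.exp (-a * w ^ 2))
  rw [himg, setIntegral_univ, integral_gaussian] at hint
  have h6 : ∫ u in Ioi 0, |f' u| • Real.exp (-a * f u ^ 2) = Real.exp (2 * a) * ((A + B) / 2) := by
    have hA1 := integrableOn_besselKernel ha (1 / 2)
    have hB1 := integrableOn_besselKernel ha (-(1 / 2))
    rw [show (1 / 2 - 1 : ℝ) = -(1 / 2) by norm_num] at hA1
    rw [show (-(1 / 2) - 1 : ℝ) = -(3 / 2) by norm_num] at hB1
    rw [← integral_add hA1 hB1, ← integral_div, ← integral_const_mul]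
    refine setIntegral_congr_fun measurableSet_Ioi fun u hu => ?_
    have hu' : (0 : ℝ) < u := hu
    have h7 : -a * f u ^ 2 = 2 * a + -(a * (u + u⁻¹)) := by
      simp only [hf]
      have h8 : (Real.sqrt u) ^ 2 = u := Real.sq_sqrt hu'.le
      have h9 : Real.sqrt u ≠ 0 := (Real.sqrt_pos.2 hu').ne'
      have h10 : u⁻¹ = (Real.sqrt u)⁻¹ ^ 2 := by rw [inv_pow, h8]
      rw [h10]
      nth_rewrite 3 [← h8]
      field_simp
      ring
    rw [h7, Real.exp_add, abs_of_pos (hpos u hu), smul_eq_mul, hf']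
    dsimp only
    ring
  rw [h6, ← hAB] at hint
  rw [h1, hint]
  congr 1
  rw [Real.exp_neg]
  field_simp
  ring

end Bessel

/-! ### The Fourier transform of `(x² + b²)^{-s}` -/

section Fourier

variable {s b : ℝ}

theorem integrable_rpow_neg_sq_add_sq (hs : 1 / 2 < s) (hb : 0 < b) :
    Integrable fun x : ℝ => (x ^ 2 + b ^ 2) ^ (-s) := by
  have h := integrable_rpow_neg_one_add_norm_sq (E := ℝ) (μ := volume) (r := 2 * s)
    (by simp; linarith)
  have h2 := (h.comp_div hb.ne').const_mul ((b ^ 2) ^ (-s))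
  refine h2.congr (Eventually.of_forall fun x => ?_)
  dsimp only
  rw [Real.norm_eq_abs, sq_abs, show -(2 * s) / 2 = -s by ring,
    ← Real.mul_rpow (by positivity) (by positivity)]
  congr 1
  field_simp
  ring

theorem isWeight_rpow_neg_sq_add_sq (hs : 1 / 2 < s) (hb : 0 < b) :
    IsWeight fun x : ℝ => (x ^ 2 + b ^ 2) ^ (-s) where
  nonneg y := by positivity
  cont := Continuous.rpow_const (by fun_prop) fun x => Or.inl (by positivity)
  integrable := integrable_rpow_neg_sq_add_sq hs hb
  slow R := by
    -- From `y² ≤ 2 (y + h)² + 2 h²`, where `2 h² ≤ 2 R²` is absorbed as `(2 R² / b²) b²`.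
    set C := 3 + 2 * R ^ 2 / b ^ 2 with hC
    have hCpos : 0 < C := by positivity
    refine ⟨C ^ s, by positivity, fun y h hh => ?_⟩
    have key : y ^ 2 + b ^ 2 ≤ C * ((y + h) ^ 2 + b ^ 2) := by
      have h1 : C * ((y + h) ^ 2 + b ^ 2) = 3 * ((y + h) ^ 2 + b ^ 2) +
          2 * R ^ 2 / b ^ 2 * (y + h) ^ 2 + 2 * R ^ 2 := by
        rw [hC]; field_simp; ring
      have h2 : h ^ 2 ≤ R ^ 2 := by
        rw [← sq_abs h]
        exact pow_le_pow_left₀ (abs_nonneg _) hh 2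
      have h3 : 0 ≤ 2 * R ^ 2 / b ^ 2 * (y + h) ^ 2 := by positivity
      rw [h1]
      nlinarith [sq_nonneg (y + 2 * h), sq_nonneg (y + h), sq_nonneg b]
    have h4 : ((y + h) ^ 2 + b ^ 2) ^ (-s) = C ^ s * (C * ((y + h) ^ 2 + b ^ 2)) ^ (-s) := by
      rw [Real.mul_rpow hCpos.le (by positivity), ← mul_assoc, ← Real.rpow_add hCpos]
      simp
    rw [h4]
    refine mul_le_mul_of_nonneg_left ?_ (by positivity)
    exact Real.rpow_le_rpow_of_nonpos (by positivity) key (by linarith)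

/-- The Fourier transform of `(x² + b²)^{-s}` as a Mellin transform. -/
theorem fourier_rpow_neg_sq_add_sq (hs : 1 / 2 < s) (hb : 0 < b) (ξ : ℝ) :
    ∫ x : ℝ, Complex.exp (-(2 * Real.pi * Complex.I * (ξ * x))) *
        (((x ^ 2 + b ^ 2) ^ (-s) : ℝ) : ℂ) =
      ((Real.sqrt Real.pi / Real.Gamma s : ℝ) : ℂ) *
        mellin (fun t : ℝ => ((Real.exp (-(t * b ^ 2 + Real.pi ^ 2 * ξ ^ 2 / t)) : ℝ) : ℂ))
          (s - 1 / 2) := by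
  have hs0 : 0 < s := by linarith
  have hG : Real.Gamma s ≠ 0 := (Real.Gamma_pos_of_pos hs0).ne'
  -- `Γ(s) (x² + b²)^{-s}` is written as an integral over `t > 0`. Fubini then leaves the Fourier
  -- transform of a Gaussian in `x`; the hypothesis `1/2 < s` provides integrability on the product.
  set g : ℝ → ℝ → ℂ := fun x t => Complex.exp (-(2 * Real.pi * Complex.I * (ξ * x))) *
    ((t ^ (s - 1) * Real.exp (-((x ^ 2 + b ^ 2) * t)) : ℝ) : ℂ) with hg
  have hgamma : ∀ x : ℝ, ∫ t in Ioi 0, t ^ (s - 1) * Real.exp (-((x ^ 2 + b ^ 2) * t)) =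
      (x ^ 2 + b ^ 2) ^ (-s) * Real.Gamma s := by
    intro x
    rw [Real.integral_rpow_mul_exp_neg_mul_Ioi hs0 (by positivity), one_div,
      Real.inv_rpow (by positivity), Real.rpow_neg (by positivity)]
  have hnorm : ∀ x, ∀ t ∈ Ioi (0 : ℝ), ‖g x t‖ = t ^ (s - 1) * Real.exp (-((x ^ 2 + b ^ 2) * t)) := by
    intro x t ht
    rw [hg, norm_mul, Complex.norm_exp, Complex.norm_real, Real.norm_of_nonneg]
    · simp
    · have : (0 : ℝ) < t := ht
      positivity
  have hint : ∀ x, IntegrableOn (g x) (Ioi 0) := by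
    intro x
    have h0 : IntegrableOn (fun t => t ^ (s - 1) * Real.exp (-((x ^ 2 + b ^ 2) * t))) (Ioi 0) := by
      by_contra hcon
      have h1 := hgamma x
      rw [integral_undef hcon] at h1
      exact (mul_pos (show 0 < (x ^ 2 + b ^ 2) ^ (-s) by positivity)
        (Real.Gamma_pos_of_pos hs0)).ne h1
    exact Integrable.const_mul (Integrable.ofReal h0) _
  have hmeas : AEStronglyMeasurable (Function.uncurry g)
      ((volume : Measure ℝ).prod (volume.restrict (Ioi 0))) := by
    refine Measurable.aestronglyMeasurable ?_
    rw [hg]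
    simp only [Function.uncurry_def]
    fun_prop
  have hprod : Integrable (Function.uncurry g)
      ((volume : Measure ℝ).prod (volume.restrict (Ioi 0))) := by
    rw [integrable_prod_iff hmeas]
    refine ⟨Eventually.of_forall hint, ?_⟩
    refine ((integrable_rpow_neg_sq_add_sq hs hb).mul_const (Real.Gamma s)).congr
      (Eventually.of_forall fun x => ?_)
    dsimp only
    rw [← hgamma x]
    exact setIntegral_congr_fun measurableSet_Ioi fun t ht => (hnorm x t ht).symm
  have hswap := integral_integral_swap hprod
  have hleft : ∀ x : ℝ, ∫ t in Ioi 0, g x t = (Real.Gamma s : ℂ) *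
      (Complex.exp (-(2 * Real.pi * Complex.I * (ξ * x))) * (((x ^ 2 + b ^ 2) ^ (-s) : ℝ) : ℂ)) := by
    intro x
    rw [hg]
    dsimp only
    rw [integral_const_mul, integral_complex_ofReal, hgamma, Complex.ofReal_mul]
    ring
  have hright : ∀ t ∈ Ioi (0 : ℝ), ∫ x, g x t = (Real.sqrt Real.pi : ℂ) *
      ((t : ℂ) ^ ((s : ℂ) - 1 / 2 - 1) •
        ((Real.exp (-(t * b ^ 2 + Real.pi ^ 2 * ξ ^ 2 / t)) : ℝ) : ℂ)) := by
    intro t ht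
    have ht' : (0 : ℝ) < t := ht
    have h1 := fourierIntegral_gaussian (b := (t : ℂ)) (by simpa using ht')
      (-(2 * Real.pi * ξ : ℝ) : ℂ)
    have h2 : ∀ x : ℝ, g x t = ((t ^ (s - 1) * Real.exp (-(t * b ^ 2)) : ℝ) : ℂ) *
        (Complex.exp (Complex.I * (-(2 * Real.pi * ξ : ℝ) : ℂ) * x) *
          Complex.exp (-(t : ℂ) * x ^ 2)) := by
      intro x
      rw [hg]
      dsimp only
      rw [show -((x ^ 2 + b ^ 2) * t) = -(t * b ^ 2) + -t * x ^ 2 by ring, Real.exp_add]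
      push_cast
      rw [show -(2 * (Real.pi : ℂ) * Complex.I * (ξ * x)) =
        Complex.I * -(2 * Real.pi * ξ) * x by ring]
      ring
    simp only [h2]
    rw [integral_const_mul, h1]
    have h3 : ((Real.pi : ℂ) / t) ^ (1 / 2 : ℂ) =
        ((Real.sqrt Real.pi * t ^ (-(1 / 2) : ℝ) : ℝ) : ℂ) := by
      rw [← Complex.ofReal_div, show (1 / 2 : ℂ) = ((1 / 2 : ℝ) : ℂ) by push_cast; rfl,
        ← Complex.ofReal_cpow (by positivity), Real.div_rpow (by positivity) ht'.le,
        ← Real.sqrt_eq_rpow, Real.rpow_neg ht'.le]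
      rfl
    have h4 : Complex.exp (-(-((2 * Real.pi * ξ : ℝ) : ℂ)) ^ 2 / (4 * t)) =
        ((Real.exp (-(Real.pi ^ 2 * ξ ^ 2 / t)) : ℝ) : ℂ) := by
      push_cast
      congr 1
      field_simp
      ring
    have h5 : (t : ℂ) ^ ((s : ℂ) - 1 / 2 - 1) = ((t ^ (s - 1) * t ^ (-(1 / 2) : ℝ) : ℝ) : ℂ) := by
      rw [← Real.rpow_add ht', Complex.ofReal_cpow ht'.le]
      congr 1
      push_cast
      ring
    rw [h3, h4, h5, neg_add, Real.exp_add, smul_eq_mul]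
    push_cast
    ring
  simp only [hleft] at hswap
  rw [integral_const_mul, setIntegral_congr_fun measurableSet_Ioi hright, integral_const_mul]
    at hswap
  rw [Complex.ofReal_div, mellin, div_mul_eq_mul_div, eq_div_iff (by exact_mod_cast hG), mul_comm]
  exact hswap

/-- At frequency 0 the term in `1/t` disappears from the exponent and the Mellin transform is a
Gamma integral. This is the origin of the second constant term of the Eisenstein series. -/
theorem fourier_rpow_neg_sq_add_sq_zero (hs : 1 / 2 < s) (hb : 0 < b) :
    ∫ x : ℝ, Complex.exp (-(2 * Real.pi * Complex.I * ((0 : ℝ) * x))) *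
        (((x ^ 2 + b ^ 2) ^ (-s) : ℝ) : ℂ) =
      ((Real.sqrt Real.pi / Real.Gamma s * (Real.Gamma (s - 1 / 2) * b ^ (1 - 2 * s)) : ℝ) : ℂ) := by
  rw [fourier_rpow_neg_sq_add_sq hs hb, Complex.ofReal_mul _ (Real.Gamma _ * _)]
  congr 1
  have h := Real.integral_rpow_mul_exp_neg_mul_Ioi (a := s - 1 / 2) (r := b ^ 2)
    (by linarith) (by positivity)
  have h1 : (1 / b ^ 2) ^ (s - 1 / 2) = b ^ (1 - 2 * s) := by
    rw [one_div, ← Real.rpow_natCast, ← Real.rpow_neg hb.le, ← Real.rpow_mul hb.le]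
    congr 1
    push_cast
    ring
  rw [h1, mul_comm] at h
  rw [← h, mellin, ← integral_complex_ofReal]
  refine setIntegral_congr_fun measurableSet_Ioi fun t ht => ?_
  rw [smul_eq_mul, Complex.ofReal_mul, Complex.ofReal_cpow (le_of_lt ht)]
  rw [show t * b ^ 2 + Real.pi ^ 2 * 0 ^ 2 / t = b ^ 2 * t by ring]
  push_cast
  rfl

/-- The scaling `t = (π |ξ| / b) u` symmetrises the exponent: `t b² + π² ξ² / t = π |ξ| b (u +
1/u)`. -/
theorem fourier_rpow_neg_sq_add_sq_ne_zero (hs : 1 / 2 < s) (hb : 0 < b) {ξ : ℝ} (hξ : ξ ≠ 0) :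
    ∫ x : ℝ, Complex.exp (-(2 * Real.pi * Complex.I * (ξ * x))) *
        (((x ^ 2 + b ^ 2) ^ (-s) : ℝ) : ℂ) =
      ((Real.sqrt Real.pi / Real.Gamma s * (Real.pi * |ξ| / b) ^ (s - 1 / 2) : ℝ) : ℂ) *
        besselK s (Real.pi * |ξ| * b) := by
  rw [fourier_rpow_neg_sq_add_sq hs hb, Complex.ofReal_mul _ (_ ^ (_ : ℝ)), mul_assoc]
  congr 1
  have hξ' : 0 < |ξ| := abs_pos.2 hξ
  have hc : 0 < (Real.pi * |ξ| / b)⁻¹ := by positivity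
  have h := mellin_comp_mul_left (fun u : ℝ =>
    ((Real.exp (-((Real.pi * |ξ| * b) * (u + u⁻¹))) : ℝ) : ℂ)) (s - 1 / 2) hc
  rw [besselK]
  have h1 : (((Real.pi * |ξ| / b)⁻¹ : ℝ) : ℂ) ^ (-((s : ℂ) - 1 / 2)) =
      (((Real.pi * |ξ| / b) ^ (s - 1 / 2) : ℝ) : ℂ) := by
    rw [show -((s : ℂ) - 1 / 2) = ((-(s - 1 / 2) : ℝ) : ℂ) by push_cast; ring,
      ← Complex.ofReal_cpow hc.le, Real.inv_rpow (by positivity), Real.rpow_neg (by positivity),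
      inv_inv]
  rw [h1, smul_eq_mul] at h
  rw [← h]
  congr 1
  funext t
  congr 2
  rw [← sq_abs ξ]
  -- The functions are compared on all of `ℝ`; at `t = 0` both exponents vanish because division by
  -- 0 gives 0.
  rcases eq_or_ne t 0 with rfl | ht
  · simp
  · field_simp

end Fourier

/-! ### The real embeddings of a totally real field -/

section Embeddings

variable {F : Type*} [Field F] [NumberField F] [IsTotallyReal F]
variable {n : ℕ} {v : Fin n → (F →+* ℝ)} (hv : Function.Bijective v)

include hv in
theorem bijective_toComplex : Function.Bijective fun k =>
    RingHom.equivRatAlgHom F ℂ (Complex.ofRealHom.comp (v k)) := by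
  refine (RingHom.equivRatAlgHom F ℂ).bijective.comp ⟨fun k l h => hv.1 ?_, fun φ => ?_⟩
  · ext x
    have h1 := RingHom.congr_fun h x
    exact Complex.ofReal_injective h1
  · have hφ : ComplexEmbedding.IsReal φ := IsTotallyReal.complexEmbedding_isReal φ
    obtain ⟨k, hk⟩ := hv.2 hφ.embedding
    refine ⟨k, ?_⟩
    ext x
    simp only [hk]
    exact hφ.coe_embedding_apply x

/-- The embeddings into `ℂ`, numbered by the real ones. -/
noncomputable def embEquiv : Fin n ≃ (F →ₐ[ℚ] ℂ) :=
  Equiv.ofBijective _ (bijective_toComplex hv)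

theorem embEquiv_apply (k : Fin n) (x : F) : embEquiv hv k x = (v k x : ℂ) := rfl

include hv in
theorem trace_eq_sum (x : F) : ((Algebra.trace ℚ F x : ℚ) : ℝ) = ∑ k, v k x := by
  have h := trace_eq_sum_embeddings (K := ℚ) (L := F) ℂ (x := x)
  rw [← (embEquiv hv).sum_comp] at h
  simp only [embEquiv_apply] at h
  have h2 : (((Algebra.trace ℚ F x : ℚ) : ℝ) : ℂ) = ((∑ k, v k x : ℝ) : ℂ) := by
    push_cast
    simpa using h
  exact Complex.ofReal_injective h2

include hv in
theorem norm_eq_prod (x : F) : ((Algebra.norm ℚ x : ℚ) : ℝ) = ∏ k, v k x := by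
  have h := Algebra.norm_eq_prod_embeddings (K := ℚ) (L := F) ℂ x
  rw [← (embEquiv hv).prod_comp] at h
  simp only [embEquiv_apply] at h
  have h2 : (((Algebra.norm ℚ x : ℚ) : ℝ) : ℂ) = ((∏ k, v k x : ℝ) : ℂ) := by
    push_cast
    simpa using h
  exact Complex.ofReal_injective h2

include hv in
theorem absNorm_span_eq_prod (a : 𝓞 F) :
    (Ideal.absNorm (Ideal.span {a}) : ℝ) = ∏ k, |v k a| := by
  rw [Ideal.absNorm_span_singleton, ← Finset.abs_prod, ← norm_eq_prod hv, ← Algebra.coe_norm_int]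
  simp [Nat.cast_natAbs]

include hv in
theorem finrank_eq : Module.finrank ℚ F = n := by
  rw [← AlgHom.card ℚ F ℂ, ← Fintype.card_congr (embEquiv hv), Fintype.card_fin]

/-- An integral basis numbered like the embeddings. -/
noncomputable def intBasis : Module.Basis (Fin n) ℤ (𝓞 F) :=
  (RingOfIntegers.basis F).reindex <| Fintype.equivFinOfCardEq <| by
    rw [← Module.finrank_eq_card_chooseBasisIndex, RingOfIntegers.rank, finrank_eq hv]

/-- The matrix of the lattice of integers. -/
noncomputable def latMatrix : Matrix (Fin n) (Fin n) ℝ :=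
  Matrix.of fun k i => v k (intBasis hv i : 𝓞 F)

/-- The discriminant of an integral basis is the square of its embedding determinant, and here all
embeddings are real. Hence `d_F > 0`, and `√d_F` is the covolume that enters Poisson summation. -/
theorem det_latMatrix_sq : (latMatrix hv).det ^ 2 = (discr F : ℝ) := by
  have h := Algebra.discr_eq_det_embeddingsMatrixReindex_pow_two ℚ ℂ
    (fun i => ((intBasis hv i : 𝓞 F) : F)) (embEquiv hv)
  have h1 : Algebra.discr ℚ (fun i => ((intBasis hv i : 𝓞 F) : F)) = (discr F : ℚ) := by
    rw [← discr_eq_discr F (intBasis hv)]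
    have h := Algebra.discr_localizationLocalization ℤ (nonZeroDivisors ℤ) F (Rₘ := ℚ) (intBasis hv)
    rw [eq_intCast] at h
    rw [← h]
    congr 1
    funext i
    rw [Module.Basis.localizationLocalization_apply]
  have h2 : Algebra.embeddingsMatrixReindex ℚ ℂ (fun i => ((intBasis hv i : 𝓞 F) : F))
      (embEquiv hv) = (latMatrix hv).transpose.map Complex.ofRealHom := by
    ext i k
    rfl
  rw [h1, h2, ← RingHom.mapMatrix_apply, ← RingHom.map_det, Matrix.det_transpose] at h
  have h3 : (((discr F : ℝ)) : ℂ) = (((latMatrix hv).det ^ 2 : ℝ) : ℂ) := by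
    push_cast
    simpa using h
  exact (Complex.ofReal_injective h3).symm

theorem det_latMatrix_ne_zero : (latMatrix hv).det ≠ 0 := by
  intro h
  have h1 := det_latMatrix_sq hv
  rw [h] at h1
  have := discr_ne_zero F
  exact this (by exact_mod_cast (by simpa using h1.symm : (discr F : ℝ) = 0))

include hv in
theorem discr_pos : (0 : ℝ) < discr F := by
  rw [← det_latMatrix_sq hv]
  exact even_two.pow_pos (det_latMatrix_ne_zero hv)

theorem abs_det_latMatrix : |(latMatrix hv).det| = Real.sqrt (discr F) := by
  rw [← det_latMatrix_sq hv, Real.sqrt_sq_eq_abs]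

theorem latMatrix_mulVec (a : Fin n → ℤ) (k : Fin n) :
    (latMatrix hv).mulVec (fun i => (a i : ℝ)) k = v k ((intBasis hv).equivFun.symm a : 𝓞 F) := by
  have h : ((∑ i, a i • intBasis hv i : 𝓞 F) : F) = ∑ i, (a i : F) * (intBasis hv i : 𝓞 F) := by
    refine (map_sum (algebraMap (𝓞 F) F) _ _).trans (Finset.sum_congr rfl fun i _ => ?_)
    simp
  rw [Module.Basis.equivFun_symm_apply, h, map_sum]
  simp only [Matrix.mulVec, dotProduct, latMatrix, Matrix.of_apply]
  refine Finset.sum_congr rfl fun i _ => ?_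
  simp [mul_comm]

variable {δ : 𝓞 F} (hδ : Ideal.span {δ} = differentIdeal ℤ (𝓞 F))

include hδ in
theorem delta_ne_zero : δ ≠ 0 := by
  rintro rfl
  have h : differentIdeal ℤ (𝓞 F) ≠ ⊥ := differentIdeal_ne_bot
  exact h (by rw [← hδ]; simp)

include hδ in
/-- An element has integral traces against the integers iff it is an integer divided by `δ`. -/
theorem forall_trace_int_iff {x : F} :
    (∀ a : 𝓞 F, ∃ k : ℤ, Algebra.trace ℚ F (x * a) = k) ↔ ∃ ν : 𝓞 F, x = (ν : F) / δ := by
  -- The trace dual of the integers is the inverse different, hence generated by `δ⁻¹`.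
  have h1 : FractionalIdeal.dual ℤ ℚ (1 : FractionalIdeal (nonZeroDivisors (𝓞 F)) F) =
      FractionalIdeal.spanSingleton (nonZeroDivisors (𝓞 F)) ((δ : F)⁻¹) := by
    rw [← FractionalIdeal.spanSingleton_inv, ← FractionalIdeal.coeIdeal_span_singleton, hδ,
      coeIdeal_differentIdeal ℤ ℚ, inv_inv]
  have h2 : x ∈ FractionalIdeal.dual ℤ ℚ (1 : FractionalIdeal (nonZeroDivisors (𝓞 F)) F) ↔
      ∀ a : 𝓞 F, ∃ k : ℤ, Algebra.trace ℚ F (x * a) = k := by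
    rw [FractionalIdeal.mem_dual
      (@one_ne_zero (FractionalIdeal (nonZeroDivisors (𝓞 F)) F) _ _ _)]
    constructor
    · intro h a
      obtain ⟨k, hk⟩ := h a (FractionalIdeal.mem_one_iff _ |>.2 ⟨a, rfl⟩)
      exact ⟨k, by simpa using hk.symm⟩
    · intro h a ha
      obtain ⟨a', rfl⟩ := (FractionalIdeal.mem_one_iff _).1 ha
      obtain ⟨k, hk⟩ := h a'
      exact ⟨k, by simpa using hk.symm⟩
  rw [← h2, h1, FractionalIdeal.mem_spanSingleton]
  refine exists_congr fun ν => ?_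
  rw [Algebra.smul_def, div_eq_mul_inv, eq_comm]

/-- The vector of traces of `ν / δ` against the integral basis. -/
noncomputable def traceVec (δ ν : 𝓞 F) (i : Fin n) : ℤ :=
  -- The rounding only produces an integer type: when `δ` generates the different the trace is
  -- already an integer.
  round (Algebra.trace ℚ F ((ν : F) / δ * (intBasis hv i : 𝓞 F)))

include hδ in
theorem traceVec_spec (ν : 𝓞 F) (i : Fin n) :
    (traceVec hv δ ν i : ℚ) = Algebra.trace ℚ F ((ν : F) / δ * (intBasis hv i : 𝓞 F)) := by
  obtain ⟨k, hk⟩ := (forall_trace_int_iff hδ).2 ⟨ν, rfl⟩ (intBasis hv i)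
  rw [traceVec, hk, round_intCast]

/-- The integral basis as a basis of the field. -/
noncomputable def ratBasis : Module.Basis (Fin n) ℚ F :=
  (intBasis hv).localizationLocalization ℚ (nonZeroDivisors ℤ) F

theorem ratBasis_apply (i : Fin n) : ratBasis hv i = (intBasis hv i : 𝓞 F) :=
  Module.Basis.localizationLocalization_apply ..

include hδ in
-- Injectivity is nondegeneracy of the trace form. For surjectivity, the dual basis supplies an
-- element of `F` with prescribed integral traces on the basis; its traces against all integers are
-- then integral, so it has the form `ν / δ`.
theorem bijective_traceVec : Function.Bijective (traceVec hv δ) := by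
  have hδ0 : (δ : F) ≠ 0 := by
    simpa using delta_ne_zero hδ
  have hnd := traceForm_nondegenerate ℚ F
  constructor
  · intro ν μ h
    have h1 : ∀ i, Algebra.trace ℚ F ((ν : F) / δ * ratBasis hv i) =
        Algebra.trace ℚ F ((μ : F) / δ * ratBasis hv i) := fun i => by
      rw [ratBasis_apply, ← traceVec_spec hv hδ, ← traceVec_spec hv hδ, h]
    have h2 : Algebra.traceForm ℚ F ((ν : F) / δ) = Algebra.traceForm ℚ F ((μ : F) / δ) :=
      (ratBasis hv).ext fun i => by simpa [Algebra.traceForm_apply] using h1 i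
    have h3 : (ν : F) / δ = (μ : F) / δ := by
      rw [← sub_eq_zero]
      refine hnd.1 _ fun y => ?_
      rw [map_sub, h2, sub_self, LinearMap.zero_apply]
    rw [div_left_inj' hδ0] at h3
    exact RingOfIntegers.ext h3
  · intro m
    let b' := (Algebra.traceForm ℚ F).dualBasis hnd (ratBasis hv)
    have hx : ∀ i, Algebra.trace ℚ F ((∑ l, (m l : ℚ) • b' l) * ratBasis hv i) = m i := by
      intro i
      have h1 : ∀ l, Algebra.trace ℚ F (b' l * ratBasis hv i) = if i = l then 1 else 0 := fun l => by
        have := LinearMap.BilinForm.apply_dualBasis_left (B := Algebra.traceForm ℚ F) hnd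
          (ratBasis hv) l i
        simpa [Algebra.traceForm_apply] using this
      rw [Finset.sum_mul, map_sum]
      simp only [smul_mul_assoc, map_smul, h1]
      simp
    obtain ⟨ν, hν⟩ := (forall_trace_int_iff hδ (x := ∑ l, (m l : ℚ) • b' l)).1 fun a => by
      refine ⟨∑ i, (intBasis hv).equivFun a i * m i, ?_⟩
      have ha : (a : F) = ∑ i, ((intBasis hv).equivFun a i : ℚ) • ratBasis hv i := by
        conv_lhs => rw [← (intBasis hv).sum_equivFun a]
        refine (map_sum (algebraMap (𝓞 F) F) _ _).trans (Finset.sum_congr rfl fun i _ => ?_)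
        rw [ratBasis_apply]
        simp [Algebra.smul_def]
      rw [ha, Finset.mul_sum, map_sum]
      simp only [mul_smul_comm, map_smul, hx]
      push_cast
      simp
    refine ⟨ν, funext fun i => ?_⟩
    have := traceVec_spec hv hδ ν i
    rw [← hν, ← ratBasis_apply, hx] at this
    exact_mod_cast this

include hδ in
-- Identifies the dual vectors for Poisson summation over the integers: `ν` gives the frequencies
-- `ν_k / δ_k`.
theorem transpose_mulVec_traceVec (ν : 𝓞 F) (i : Fin n) :
    (latMatrix hv).transpose.mulVec (fun k => v k ν / v k δ) i = traceVec hv δ ν i := by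
  have h := traceVec_spec hv hδ ν i
  have h1 : ((traceVec hv δ ν i : ℚ) : ℝ) =
      ∑ k, v k ((ν : F) / δ * (intBasis hv i : 𝓞 F)) := by
    rw [h, trace_eq_sum hv]
  rw [Rat.cast_intCast] at h1
  rw [h1]
  simp only [Matrix.mulVec, dotProduct, Matrix.transpose_apply, latMatrix, Matrix.of_apply,
    map_mul, map_div₀]
  exact Finset.sum_congr rfl fun k _ => mul_comm _ _

include hv in
theorem summable_integers_weight {φ : Fin n → ℝ → ℝ} (hφ : ∀ k, IsWeight (φ k)) (p : Fin n → ℝ) :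
    Summable fun a : 𝓞 F => ∏ k, φ k (p k + v k a) := by
  have h := summable_prod_weight (det_latMatrix_ne_zero hv) hφ p
  simp only [latMatrix_mulVec] at h
  exact ((intBasis hv).equivFun.symm.toEquiv.summable_iff
    (f := fun a : 𝓞 F => ∏ k, φ k (p k + v k a))).1 h

include hv hδ in
/-- Poisson summation on the ring of integers. -/
theorem poisson_summation_integers {φ : Fin n → ℝ → ℝ} (hφ : ∀ k, IsWeight (φ k)) (p : Fin n → ℝ)
    (hsum : Summable fun ν : 𝓞 F =>
      Complex.exp (2 * Real.pi * Complex.I * ∑ k, ((v k ν / v k δ : ℝ) : ℂ) * p k) *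
        ∏ k, ∫ x : ℝ, Complex.exp (-(2 * Real.pi * Complex.I * ((v k ν / v k δ : ℝ) * x))) *
          (φ k x : ℂ)) :
    ∑' a : 𝓞 F, ((∏ k, φ k (p k + v k a) : ℝ) : ℂ) =
      ((Real.sqrt (discr F))⁻¹ : ℝ) * ∑' ν : 𝓞 F,
        (Complex.exp (2 * Real.pi * Complex.I * ∑ k, ((v k ν / v k δ : ℝ) : ℂ) * p k) *
        ∏ k, ∫ x : ℝ, Complex.exp (-(2 * Real.pi * Complex.I * ((v k ν / v k δ : ℝ) * x))) *
          (φ k x : ℂ)) := by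
  let e : 𝓞 F ≃ (Fin n → ℤ) := Equiv.ofBijective _ (bijective_traceVec hv hδ)
  have he : ∀ ν, e ν = traceVec hv δ ν := fun ν => rfl
  have h := poisson_summation_prod (det_latMatrix_ne_zero hv) hφ p
    (w := fun m k => v k (e.symm m) / v k δ) (fun m i => by
      rw [transpose_mulVec_traceVec hv hδ, ← he, e.apply_symm_apply])
    ((e.symm.summable_iff (f := fun ν : 𝓞 F =>
      Complex.exp (2 * Real.pi * Complex.I * ∑ k, ((v k ν / v k δ : ℝ) : ℂ) * p k) *
        ∏ k, ∫ x : ℝ, Complex.exp (-(2 * Real.pi * Complex.I * ((v k ν / v k δ : ℝ) * x))) *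
          (φ k x : ℂ))).2 hsum)
  rw [abs_det_latMatrix] at h
  rw [e.symm.tsum_eq (fun ν : 𝓞 F =>
      Complex.exp (2 * Real.pi * Complex.I * ∑ k, ((v k ν / v k δ : ℝ) : ℂ) * p k) *
        ∏ k, ∫ x : ℝ, Complex.exp (-(2 * Real.pi * Complex.I * ((v k ν / v k δ : ℝ) * x))) *
          (φ k x : ℂ))] at h
  rw [← h, ← (intBasis hv).equivFun.symm.toEquiv.tsum_eq]
  simp only [latMatrix_mulVec]
  rfl

end Embeddings

/-! ### Sums over ideals -/

section IdealSums

variable (F : Type*) [Field F] [NumberField F]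

/-- The nonzero ideals of the ring of integers. -/
abbrev NZIdeal : Type _ := {I : Ideal (𝓞 F) // I ≠ ⊥}

variable {F}

theorem absNorm_pos (I : NZIdeal F) : 0 < Ideal.absNorm I.1 :=
  Nat.pos_of_ne_zero fun h => I.2 (Ideal.absNorm_eq_zero_iff.1 h)

theorem one_le_absNorm (I : NZIdeal F) : (1 : ℝ) ≤ Ideal.absNorm I.1 :=
  Nat.one_le_cast.2 (absNorm_pos I)

/-- The number of ideals of norm at most `N`, divided by `N`, has a limit, so the partial sums of
the nonnegative coefficients are `O(N)`; this gives convergence to the right of 1. -/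
theorem lseriesSummable_dedekindZeta {s : ℂ} (hs : 1 < s.re) :
    LSeriesSummable (fun n => (Nat.card {I : Ideal (𝓞 F) // Ideal.absNorm I = n} : ℂ)) s := by
  have h := LSeriesSummable_of_sum_norm_bigO_and_nonneg (r := 1) (s := s)
    (f := fun n => (Nat.card {I : Ideal (𝓞 F) // Ideal.absNorm I = n} : ℝ)) ?_
    (fun n => Nat.cast_nonneg _) zero_le_one hs
  · simpa using h
  have h1 := ((Ideal.tendsto_norm_le_div_atTop₀ F).comp tendsto_natCast_atTop_atTop).isBigO_one ℝ
  have h2 := h1.mul (Asymptotics.isBigO_refl (fun n : ℕ => (n : ℝ)) atTop)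
  have h3 : (fun n : ℕ => (n : ℝ) ^ (1 : ℝ)) = fun n : ℕ => (1 : ℝ) * n := by
    funext n; simp
  rw [h3]
  refine Asymptotics.IsBigO.trans ?_ h2
  refine Asymptotics.IsBigO.of_bound 1 ?_
  filter_upwards [eventually_gt_atTop 0] with n hn
  have hn' : (n : ℝ) ≠ 0 := by exact_mod_cast hn.ne'
  rw [one_mul, Function.comp_apply, div_mul_cancel₀ _ hn', ← Nat.cast_sum, Real.norm_natCast,
    Real.norm_natCast, Nat.cast_le]
  simp only [Nat.cast_le]
  refine le_of_eq ?_
  -- The added 1 accounts for the zero ideal, the only one of norm 0, which the asymptotic count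
  -- leaves out.
  rw [← add_left_inj 1, ← Ideal.card_norm_le_eq_card_norm_le_add_one,
    show Finset.Icc 1 n = Finset.Ioc 0 n from Finset.Icc_succ_left_eq_Ioc _ _,
    show 1 = Nat.card {I : Ideal (𝓞 F) // Ideal.absNorm I = 0} by
      simp [Ideal.absNorm_eq_zero_iff],
    Finset.sum_Ioc_add_eq_sum_Icc (n.zero_le),
    ← Finset.card_preimage_eq_sum_card_image_eq (fun k _ => Ideal.finite_setOfPred_absNorm_eq k)]
  simp [Set.coe_eq_subtype]

/-- The Dirichlet series groups ideals by norm, and absolute convergence allows the groups to be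
dissolved. The zero ideal may be dropped because `0 ^ (-s) = 0`. -/
theorem hasSum_absNorm_cpow {s : ℂ} (hs : 1 < s.re) :
    HasSum (fun I : NZIdeal F => (Ideal.absNorm I.1 : ℂ) ^ (-s)) (dedekindZeta F s) := by
  have hs0 : s ≠ 0 := by
    rintro rfl
    simp at hs
    linarith
  have h := lseriesSummable_dedekindZeta (F := F) hs
  set f : Ideal (𝓞 F) → ℂ := fun I => (Ideal.absNorm I : ℂ) ^ (-s) with hf
  have hfin : ∀ k : ℕ, Finite {I : Ideal (𝓞 F) // Ideal.absNorm I = k} := fun k =>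
    Ideal.finite_setOfPred_absNorm_eq k
  have hterm : ∀ k : ℕ, HasSum (fun I : {I : Ideal (𝓞 F) // Ideal.absNorm I = k} => f I.1)
      (LSeries.term (fun n => (Nat.card {I : Ideal (𝓞 F) // Ideal.absNorm I = n} : ℂ)) s k) := by
    intro k
    have := Fintype.ofFinite {I : Ideal (𝓞 F) // Ideal.absNorm I = k}
    have h1 : (LSeries.term (fun n => (Nat.card {I : Ideal (𝓞 F) // Ideal.absNorm I = n} : ℂ)) s k)
        = ∑ I : {I : Ideal (𝓞 F) // Ideal.absNorm I = k}, f I.1 := by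
      rw [Finset.sum_congr rfl fun I _ => show f I.1 = (k : ℂ) ^ (-s) by simp only [hf, I.2]]
      rw [LSeries.term_def, Finset.sum_const, Finset.card_univ, Nat.card_eq_fintype_card]
      split_ifs with hk
      · simp [hk, hs0]
      · rw [Complex.cpow_neg, nsmul_eq_mul, div_eq_mul_inv]
    rw [h1]
    exact hasSum_fintype _
  have hsig : Summable fun p : Σ k : ℕ, {I : Ideal (𝓞 F) // Ideal.absNorm I = k} => f p.2.1 := by
    refine Summable.of_norm ?_
    rw [summable_sigma_of_nonneg fun _ => norm_nonneg _]
    refine ⟨fun k => Summable.of_finite, ?_⟩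
    refine h.norm.congr fun k => ?_
    have := Fintype.ofFinite {I : Ideal (𝓞 F) // Ideal.absNorm I = k}
    rw [tsum_fintype, Finset.sum_congr rfl fun I _ =>
      show ‖f I.1‖ = ‖(k : ℂ) ^ (-s)‖ by simp only [hf, I.2],
      Finset.sum_const, Finset.card_univ, LSeries.term_def, Nat.card_eq_fintype_card]
    split_ifs with hk
    · simp [hk, hs0]
    · rw [Complex.cpow_neg, nsmul_eq_mul, div_eq_mul_inv, norm_mul, Complex.norm_natCast]
  have h2 : HasSum (fun p : Σ k : ℕ, {I : Ideal (𝓞 F) // Ideal.absNorm I = k} => f p.2.1)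
      (dedekindZeta F s) := by
    have h3 := hsig.hasSum
    have h4 := (h3.sigma hterm).unique h.hasSum
    rw [h4] at h3
    exact h3
  have h5 : HasSum f (dedekindZeta F s) :=
    (Equiv.sigmaFiberEquiv (fun I : Ideal (𝓞 F) => Ideal.absNorm I)).hasSum_iff.1 h2
  refine (Function.Injective.hasSum_iff Subtype.val_injective fun I hI => ?_).2 h5
  have : I = ⊥ := by
    by_contra hne
    exact hI ⟨⟨I, hne⟩, rfl⟩
  simp [hf, this, hs0]

theorem summable_absNorm_rpow {s : ℝ} (hs : 1 < s) :
    Summable fun I : NZIdeal F => (Ideal.absNorm I.1 : ℝ) ^ (-s) := by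
  have h := (hasSum_absNorm_cpow (F := F) (s := s) (by simpa using hs)).summable.norm
  refine h.congr fun I => ?_
  rw [Complex.norm_natCast_cpow_of_pos (absNorm_pos I)]
  simp

theorem summable_absNorm_sq : Summable fun I : NZIdeal F => ((Ideal.absNorm I.1 : ℝ) ^ 2)⁻¹ := by
  refine (summable_absNorm_rpow (F := F) one_lt_two).congr fun I => ?_
  rw [Real.rpow_neg (by positivity), Real.rpow_two]

theorem differentiableOn_dedekindZeta : DifferentiableOn ℂ (dedekindZeta F) {s | 1 < s.re} := by
  refine (LSeries_differentiableOn
    (fun n => (Nat.card {I : Ideal (𝓞 F) // Ideal.absNorm I = n} : ℂ))).mono fun s hs => ?_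
  refine lt_of_le_of_lt (LSeries.abscissaOfAbsConv_le_of_forall_lt_LSeriesSummable (x := 1)
    fun y hy => lseriesSummable_dedekindZeta (by simpa using hy)) ?_
  exact_mod_cast hs

variable (hF : NarrowClassNumberOne F)

/-- A generator of a nonzero ideal. -/
noncomputable def gen (I : NZIdeal F) : 𝓞 F := (hF I.1 I.2).choose

theorem span_gen (I : NZIdeal F) : Ideal.span {gen hF I} = I.1 :=
  (hF I.1 I.2).choose_spec.2.symm

theorem gen_ne_zero (I : NZIdeal F) : gen hF I ≠ 0 := by
  intro h
  have h1 := span_gen hF I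
  rw [h, Ideal.span_singleton_eq_bot.2 rfl] at h1
  exact I.2 h1.symm

variable [IsTotallyReal F] {n : ℕ} {v : Fin n → (F →+* ℝ)} (hv : Function.Bijective v)

include hv in
theorem absNorm_eq_prod_gen (I : NZIdeal F) :
    (Ideal.absNorm I.1 : ℝ) = ∏ k, |v k (gen hF I)| := by
  rw [← absNorm_span_eq_prod hv, span_gen]

theorem v_ne_zero {a : 𝓞 F} (ha : a ≠ 0) (k : Fin n) : v k a ≠ 0 := by
  rw [Ne, map_eq_zero]
  simpa using ha

include hv in
theorem one_le_prod_abs {a : 𝓞 F} (ha : a ≠ 0) : 1 ≤ ∏ k, |v k a| := by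
  rw [← absNorm_span_eq_prod hv]
  exact one_le_absNorm ⟨Ideal.span {a}, by simpa using ha⟩

theorem pow_le_mul_exp {κ : ℝ} (hκ : 0 < κ) (p : ℕ) {x : ℝ} (hx : 0 ≤ x) :
    x ^ p ≤ p.factorial / κ ^ p * Real.exp (κ * x) := by
  have h := Real.pow_div_factorial_le_exp (x := κ * x) (by positivity) p
  rw [div_le_iff₀ (by positivity), mul_pow] at h
  rw [div_mul_eq_mul_div, le_div_iff₀ (by positivity)]
  linarith

include hv in
-- Each factor `e^{-κ|x|}` is dominated by a multiple of the weight `(x² + 1)^{-1}`, whose products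
-- are summable over the lattice of integers.
theorem summable_exp_neg_abs {κ : Fin n → ℝ} (hκ : ∀ k, 0 < κ k) :
    Summable fun a : 𝓞 F => Real.exp (-∑ k, κ k * |v k a|) := by
  have h := summable_integers_weight hv (φ := fun _ x => (x ^ 2 + 1 ^ 2) ^ (-1 : ℝ))
    (fun k => isWeight_rpow_neg_sq_add_sq (by norm_num) one_pos) 0
  have hc : ∀ k, ∃ C : ℝ, 0 ≤ C ∧ ∀ x : ℝ, Real.exp (-(κ k * |x|)) ≤ C * (x ^ 2 + 1 ^ 2) ^ (-1 : ℝ) := by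
    intro k
    refine ⟨2 / κ k ^ 2 + 1, by positivity, fun x => ?_⟩
    have h1 := pow_le_mul_exp (hκ k) 2 (abs_nonneg x)
    have h2 : 1 ≤ Real.exp (κ k * |x|) := Real.one_le_exp (by have := hκ k; positivity)
    rw [Real.rpow_neg_one, Real.exp_neg, ← div_eq_mul_inv, le_div_iff₀ (by positivity),
      inv_mul_le_iff₀ (Real.exp_pos _)]
    rw [sq_abs] at h1
    simp only [Nat.factorial_two, Nat.cast_ofNat] at h1
    nlinarith
  choose C hC0 hC using hc
  refine Summable.of_nonneg_of_le (fun a => (Real.exp_pos _).le) (fun a => ?_) (h.mul_left (∏ k, C k))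
  rw [← Finset.sum_neg_distrib, Real.exp_sum, ← Finset.prod_mul_distrib]
  refine Finset.prod_le_prod (fun k _ => (Real.exp_pos _).le) fun k _ => ?_
  simpa using hC k (v k a)

/-- Polynomial factors are absorbed by the exponential. -/
theorem prod_abs_pow_mul_exp_le {κ : Fin n → ℝ} (hκ : ∀ k, 0 < κ k) (p : ℕ) :
    ∃ C : ℝ, 0 ≤ C ∧ ∀ a : Fin n → ℝ,
      (∏ k, |a k|) ^ p * Real.exp (-(2 * ∑ k, κ k * |a k|)) ≤ C * Real.exp (-∑ k, κ k * |a k|) := by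
  refine ⟨∏ k, (p.factorial / κ k ^ p), Finset.prod_nonneg fun k _ => by
    have := hκ k; positivity, fun a => ?_⟩
  have h1 : (∏ k, |a k|) ^ p ≤ (∏ k, (p.factorial / κ k ^ p)) * Real.exp (∑ k, κ k * |a k|) := by
    rw [← Finset.prod_pow, Real.exp_sum, ← Finset.prod_mul_distrib]
    exact Finset.prod_le_prod (fun k _ => by positivity) fun k _ =>
      pow_le_mul_exp (hκ k) p (abs_nonneg _)
  calc _ ≤ ((∏ k, (p.factorial / κ k ^ p)) * Real.exp (∑ k, κ k * |a k|)) *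
        Real.exp (-(2 * ∑ k, κ k * |a k|)) := mul_le_mul_of_nonneg_right h1 (Real.exp_pos _).le
    _ = _ := by
      rw [mul_assoc, ← Real.exp_add]
      congr 2
      ring

include hv in
-- Half of the exponential pays for a factor `N(I)⁻²`, since `|N(gen I · ν)| ≥ N(I)`. The other half
-- is summed over the integer `gen I · ν`, which together with `I` determines `ν`.
theorem summable_pair_exp {κ : Fin n → ℝ} (hκ : ∀ k, 0 < κ k) :
    Summable fun x : NZIdeal F × {ν : 𝓞 F // ν ≠ 0} =>
      Real.exp (-∑ k, κ k * |v k (gen hF x.1 * x.2.1 : 𝓞 F)|) := by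
  have hκ' : ∀ k, 0 < κ k / 2 := fun k => half_pos (hκ k)
  obtain ⟨C, hC0, hC⟩ := prod_abs_pow_mul_exp_le hκ' 2
  have h1 := (summable_absNorm_sq (F := F)).mul_of_nonneg (summable_exp_neg_abs hv hκ')
    (fun _ => by positivity) (fun _ => (Real.exp_pos _).le)
  have hinj : Function.Injective fun x : NZIdeal F × {ν : 𝓞 F // ν ≠ 0} =>
      ((x.1, gen hF x.1 * x.2.1) : NZIdeal F × 𝓞 F) := by
    rintro ⟨I, ν⟩ ⟨J, μ⟩ h
    simp only [Prod.mk.injEq] at h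
    obtain ⟨rfl, h⟩ := h
    rw [Prod.mk.injEq]
    exact ⟨rfl, Subtype.ext (mul_left_cancel₀ (gen_ne_zero hF I) h)⟩
  refine Summable.of_nonneg_of_le (fun _ => (Real.exp_pos _).le) (fun x => ?_)
    ((h1.comp_injective hinj).mul_left C)
  obtain ⟨I, ν⟩ := x
  simp only [Function.comp_apply]
  set a : Fin n → ℝ := fun k => v k (gen hF I * ν.1 : 𝓞 F) with ha
  have h2 := hC a
  have h3 : (Ideal.absNorm I.1 : ℝ) ≤ ∏ k, |a k| := by
    rw [ha, absNorm_eq_prod_gen hF hv]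
    have h4 := one_le_prod_abs hv ν.2
    have h5 : 0 ≤ ∏ k, |v k (gen hF I)| := Finset.prod_nonneg fun _ _ => abs_nonneg _
    simp only [map_mul, abs_mul, Finset.prod_mul_distrib]
    exact le_mul_of_one_le_right h5 h4
  have h4 : (0 : ℝ) < Ideal.absNorm I.1 := by exact_mod_cast absNorm_pos I
  have h5 : -∑ k, κ k * |a k| = -(2 * ∑ k, κ k / 2 * |a k|) := by
    rw [Finset.mul_sum]
    congr 1
    exact Finset.sum_congr rfl fun k _ => by ring
  rw [h5, mul_left_comm, inv_mul_eq_div, le_div_iff₀ (by positivity)]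
  refine le_trans ?_ h2
  rw [mul_comm]
  exact mul_le_mul_of_nonneg_right (pow_le_pow_left₀ h4.le h3 2) (Real.exp_pos _).le

end IdealSums

/-! ### The nonconstant part of the Eisenstein series -/

section Phi

variable {F : Type*} [Field F] [NumberField F]
variable (hF : NarrowClassNumberOne F)

/-- Pairs of a nonzero ideal and a nonzero integer. -/
abbrev PairIdx (F : Type*) [Field F] [NumberField F] : Type _ := NZIdeal F × {ν : 𝓞 F // ν ≠ 0}

/-- The unit `u` with `ν = u * gen (ν)`. -/
theorem exists_unit_mul_gen {ν : 𝓞 F} {I : NZIdeal F} (h : Ideal.span {ν} = I.1) :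
    ∃ u : (𝓞 F)ˣ, ν = u * gen hF I := by
  have h1 : Associated (gen hF I) ν := by
    rw [← Ideal.span_singleton_eq_span_singleton, span_gen, h]
  obtain ⟨u, hu⟩ := h1
  exact ⟨u, by rw [← hu, mul_comm]⟩

/-- If `ν = u · gen (ν)` with a unit `u`, then `gen I · ν = gen (ν) · (u · gen I)`. The new pair is
`((ν), u · gen I)`: same product, with the ideals generated by the two factors exchanged. -/
theorem exists_swap (x : PairIdx F) : ∃ y : PairIdx F,
    Ideal.span {x.2.1} = y.1.1 ∧ Ideal.span {y.2.1} = x.1.1 ∧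
      gen hF y.1 * y.2.1 = gen hF x.1 * x.2.1 := by
  obtain ⟨I, ν, hν⟩ := x
  obtain ⟨u, hu⟩ := exists_unit_mul_gen hF (ν := ν)
    (I := ⟨Ideal.span {ν}, by simpa using hν⟩) rfl
  refine ⟨(⟨Ideal.span {ν}, by simpa using hν⟩, ⟨u * gen hF I, mul_ne_zero u.ne_zero
    (gen_ne_zero hF I)⟩), rfl, ?_, ?_⟩
  · dsimp only
    rw [← span_gen hF I, Ideal.span_singleton_eq_span_singleton]
    exact ⟨u⁻¹, by rw [mul_comm (u : 𝓞 F), mul_assoc, Units.mul_inv, mul_one]⟩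
  · dsimp only
    conv_rhs => rw [hu]
    ring

/-- The involution exchanging the two factors of `gen I * ν`. -/
noncomputable def swapIdx (x : PairIdx F) : PairIdx F := (exists_swap hF x).choose

theorem swapIdx_swapIdx (x : PairIdx F) : swapIdx hF (swapIdx hF x) = x := by
  obtain ⟨h1, h2, h3⟩ := (exists_swap hF x).choose_spec
  obtain ⟨h4, h5, h6⟩ := (exists_swap hF (swapIdx hF x)).choose_spec
  have hI : (swapIdx hF (swapIdx hF x)).1 = x.1 := Subtype.ext (h4.symm.trans h2)
  have h7 := h6.trans h3
  change gen hF (swapIdx hF (swapIdx hF x)).1 * (swapIdx hF (swapIdx hF x)).2.1 = _ at h7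
  rw [hI] at h7
  exact Prod.ext hI (Subtype.ext (mul_left_cancel₀ (gen_ne_zero hF _) h7))

/-- `swapIdx` as a permutation. -/
noncomputable def swapEquiv : PairIdx F ≃ PairIdx F :=
  Function.Involutive.toPerm _ (swapIdx_swapIdx hF)

variable {n : ℕ} (v : Fin n → (F →+* ℝ)) (δ : 𝓞 F)

/-- A term of the nonconstant part of the completed Eisenstein series. -/
noncomputable def phiTerm (s : ℂ) (z : Fin n → ℂ) (x : PairIdx F) : ℂ :=
  (((∏ k, |v k x.2.1|) / Ideal.absNorm x.1.1 : ℝ) : ℂ) ^ (s - 1 / 2) *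
    (∏ k, besselK s (Real.pi * |v k (gen hF x.1 * x.2.1 : 𝓞 F) / v k δ| * (z k).im)) *
    Complex.exp (2 * Complex.I * Real.pi *
      ∑ k, ((v k (gen hF x.1 * x.2.1 : 𝓞 F) / v k δ * (z k).re : ℝ) : ℂ))

/-- The nonconstant part of the completed Eisenstein series. -/
noncomputable def phiSum (s : ℂ) (z : Fin n → ℂ) : ℂ :=
  (Real.sqrt (∏ k, (z k).im) : ℂ) * ∑' x : PairIdx F, phiTerm hF v δ s z x

variable {v δ} [IsTotallyReal F] (hv : Function.Bijective v) (hδ0 : δ ≠ 0)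
variable {z : Fin n → ℂ} (hz : z ∈ upperHalfProd n)

include hδ0 hz in
theorem phiArg_pos (x : PairIdx F) (k : Fin n) :
    0 < Real.pi * |v k (gen hF x.1 * x.2.1 : 𝓞 F) / v k δ| * (z k).im := by
  have h1 : (v k (gen hF x.1 * x.2.1 : 𝓞 F)) ≠ 0 :=
    v_ne_zero (mul_ne_zero (gen_ne_zero hF _) x.2.2) k
  have h2 : v k δ ≠ 0 := v_ne_zero hδ0 k
  have h3 := hz k
  have h4 : 0 < |v k (gen hF x.1 * x.2.1 : 𝓞 F) / v k δ| := abs_pos.2 (div_ne_zero h1 h2)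
  have := Real.pi_pos
  positivity

include hv in
theorem prod_abs_gen_mul (x : PairIdx F) :
    ∏ k, |v k (gen hF x.1 * x.2.1 : 𝓞 F)| = Ideal.absNorm x.1.1 * ∏ k, |v k x.2.1| := by
  rw [absNorm_eq_prod_gen hF hv, ← Finset.prod_mul_distrib]
  simp only [map_mul, abs_mul]

include hδ0 hz hv in
-- Let `M` be the absolute norm of `gen I · ν`. The Bessel bounds contribute `M^{-P}`, and the power
-- of `N(ν) / N(I)` is at most `M^P` because both norms are at least 1; only the exponential
-- remains, with a constant uniform in the strip.
theorem exists_norm_phiTerm_le {P : ℝ} (hP : 0 < P) : ∃ C : ℝ, 0 ≤ C ∧ ∀ (s : ℂ) (x : PairIdx F),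
    |s.re - 1 / 2| ≤ P → ‖phiTerm hF v δ s z x‖ ≤
      C * Real.exp (-∑ k, Real.pi * (z k).im / |v k δ| * |v k (gen hF x.1 * x.2.1 : 𝓞 F)|) := by
  have hκ : ∀ k, 0 < Real.pi * (z k).im / |v k δ| := fun k => by
    have h1 : 0 < |v k δ| := abs_pos.2 (v_ne_zero hδ0 k)
    have h2 := hz k
    have := Real.pi_pos
    positivity
  have hG := Real.Gamma_pos_of_pos hP
  refine ⟨∏ k, (2 * ((2 / (Real.pi * (z k).im / |v k δ|)) ^ P * Real.Gamma P)),
    Finset.prod_nonneg fun k _ => by have := hκ k; positivity, fun s x hs => ?_⟩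
  set κ : Fin n → ℝ := fun k => Real.pi * (z k).im / |v k δ| with hκdef
  set M : ℝ := ∏ k, |v k (gen hF x.1 * x.2.1 : 𝓞 F)| with hM
  have hMne : ∀ k, 0 < |v k (gen hF x.1 * x.2.1 : 𝓞 F)| := fun k =>
    abs_pos.2 (v_ne_zero (mul_ne_zero (gen_ne_zero hF _) x.2.2) k)
  have hMpos : 0 < M := Finset.prod_pos fun k _ => hMne k
  have harg : ∀ k, Real.pi * |v k (gen hF x.1 * x.2.1 : 𝓞 F) / v k δ| * (z k).im =
      κ k * |v k (gen hF x.1 * x.2.1 : 𝓞 F)| := fun k => by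
    rw [hκdef, abs_div]
    ring
  have hN := one_le_absNorm x.1
  have hν := one_le_prod_abs hv x.2.2
  have hexp : ‖Complex.exp (2 * Complex.I * Real.pi *
      ∑ k, ((v k (gen hF x.1 * x.2.1 : 𝓞 F) / v k δ * (z k).re : ℝ) : ℂ))‖ = 1 := by
    rw [← Complex.ofReal_sum, Complex.norm_exp]
    simp
  have hr : 0 < (∏ k, |v k x.2.1|) / (Ideal.absNorm x.1.1 : ℝ) := by positivity
  have hpow : ‖(((∏ k, |v k x.2.1|) / Ideal.absNorm x.1.1 : ℝ) : ℂ) ^ (s - 1 / 2)‖ ≤ M ^ P := by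
    rw [Complex.norm_cpow_eq_rpow_re_of_pos hr]
    have hre : (s - 1 / 2).re = s.re - 1 / 2 := by simp
    rw [hre, hM, prod_abs_gen_mul hF hv]
    obtain ⟨h1, h2⟩ := abs_le.1 hs
    rcases le_total 1 ((∏ k, |v k x.2.1|) / (Ideal.absNorm x.1.1 : ℝ)) with h | h
    · refine (Real.rpow_le_rpow_of_exponent_le h h2).trans
        (Real.rpow_le_rpow hr.le ?_ hP.le)
      rw [div_le_iff₀ (by positivity)]
      nlinarith [mul_le_mul hN hN zero_le_one (by positivity)]
    · refine (Real.rpow_le_rpow_of_exponent_ge hr h h1).trans ?_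
      rw [Real.rpow_neg hr.le, ← Real.inv_rpow hr.le]
      refine Real.rpow_le_rpow (by positivity) ?_ hP.le
      rw [inv_div, div_le_iff₀ (by positivity)]
      nlinarith [mul_le_mul hν hν zero_le_one (by positivity)]
  have hK : ∏ k, ‖besselK s (Real.pi * |v k (gen hF x.1 * x.2.1 : 𝓞 F) / v k δ| * (z k).im)‖ ≤
      (∏ k, (2 * ((2 / κ k) ^ P * Real.Gamma P))) * (M ^ P)⁻¹ *
        Real.exp (-∑ k, κ k * |v k (gen hF x.1 * x.2.1 : 𝓞 F)|) := by
    rw [← Finset.sum_neg_distrib, Real.exp_sum, hM, ← Real.finsetProd_rpow _ _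
      (fun k _ => (hMne k).le), ← Finset.prod_inv_distrib, ← Finset.prod_mul_distrib,
      ← Finset.prod_mul_distrib]
    refine Finset.prod_le_prod (fun k _ => norm_nonneg _) fun k _ => ?_
    refine (norm_besselK_le (phiArg_pos hF hδ0 hz x k) hP hs).trans (le_of_eq ?_)
    have hk := hκ k
    have hm := hMne k
    rw [harg, ← div_div, Real.div_rpow (by positivity) (abs_nonneg _)]
    ring
  rw [phiTerm, norm_mul, norm_mul, hexp, mul_one, norm_prod]
  calc _ ≤ M ^ P * ((∏ k, (2 * ((2 / κ k) ^ P * Real.Gamma P))) * (M ^ P)⁻¹ *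
        Real.exp (-∑ k, κ k * |v k (gen hF x.1 * x.2.1 : 𝓞 F)|)) :=
        mul_le_mul hpow hK (Finset.prod_nonneg fun k _ => norm_nonneg _) (by positivity)
    _ = _ := by
      have h : ∀ A E m : ℝ, m ≠ 0 → m * (A * m⁻¹ * E) = A * E := fun A E m hm => by field_simp
      exact h _ _ _ (by positivity)

include hδ0 hz hv in
theorem summable_norm_phiTerm (s : ℂ) : Summable fun x => ‖phiTerm hF v δ s z x‖ := by
  obtain ⟨C, hC0, hC⟩ := exists_norm_phiTerm_le hF hv hδ0 hz (P := |s.re - 1 / 2| + 1)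
    (by positivity)
  refine Summable.of_nonneg_of_le (fun _ => norm_nonneg _)
    (fun x => hC s x (by linarith [abs_nonneg (s.re - 1 / 2)]))
    ((summable_pair_exp hF hv fun k => ?_).mul_left C)
  have h1 : 0 < |v k δ| := abs_pos.2 (v_ne_zero hδ0 k)
  have h2 := hz k
  have := Real.pi_pos
  positivity

include hδ0 hz hv in
theorem differentiable_phiSum : Differentiable ℂ fun s => phiSum hF v δ s z := by
  refine Differentiable.const_mul ?_ _
  intro s₀
  -- The added 1 makes `P` positive and the strip a neighbourhood of `s₀`, on which the bound is
  -- uniform.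
  set P : ℝ := |s₀.re - 1 / 2| + 1 with hP
  obtain ⟨C, hC0, hC⟩ := exists_norm_phiTerm_le hF hv hδ0 hz (P := P) (by positivity)
  have hsum := (summable_pair_exp hF hv (κ := fun k => Real.pi * (z k).im / |v k δ|) fun k => by
    have h1 : 0 < |v k δ| := abs_pos.2 (v_ne_zero hδ0 k)
    have h2 := hz k
    have := Real.pi_pos
    positivity).mul_left C
  have hopen : IsOpen {s : ℂ | |s.re - 1 / 2| < P} :=
    isOpen_lt (by fun_prop) continuous_const
  have h := Complex.differentiableOn_tsum_of_summable_norm hsum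
    (F := fun x s => phiTerm hF v δ s z x) (fun x => ?_) hopen
    (fun x s hs => hC s x (le_of_lt hs))
  · exact h.differentiableAt (hopen.mem_nhds (by
      change |s₀.re - 1 / 2| < P
      rw [hP]; linarith))
  · refine Differentiable.differentiableOn ?_
    have hN := one_le_absNorm x.1
    have hν := one_le_prod_abs hv x.2.2
    have hr : 0 < (∏ k, |v k x.2.1|) / (Ideal.absNorm x.1.1 : ℝ) := by positivity
    refine Differentiable.mul_const (Differentiable.mul ?_ ?_) _
    · exact Differentiable.const_cpow (by fun_prop) (Or.inl (by exact_mod_cast hr.ne'))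
    · exact Differentiable.fun_finsetProd fun k _ => differentiable_besselK
        (phiArg_pos hF hδ0 hz x k)

include hv in
-- Exchanging the factors keeps their product, hence the exponential and the Bessel arguments, and
-- inverts `N(ν) / N(I)`, which turns the exponent `s - 1/2` into `1/2 - s`. The Bessel kernels are
-- symmetric themselves.
theorem phiTerm_swap (s : ℂ) (x : PairIdx F) :
    phiTerm hF v δ s z (swapIdx hF x) = phiTerm hF v δ (1 - s) z x := by
  obtain ⟨h1, h2, h3⟩ := (exists_swap hF x).choose_spec
  change Ideal.span {x.2.1} = (swapIdx hF x).1.1 at h1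
  change Ideal.span {(swapIdx hF x).2.1} = x.1.1 at h2
  change gen hF (swapIdx hF x).1 * (swapIdx hF x).2.1 = _ at h3
  have hN := one_le_absNorm x.1
  have hν := one_le_prod_abs hv x.2.2
  have h4 : (∏ k, |v k (swapIdx hF x).2.1|) / (Ideal.absNorm (swapIdx hF x).1.1 : ℝ) =
      ((∏ k, |v k x.2.1|) / (Ideal.absNorm x.1.1 : ℝ))⁻¹ := by
    rw [← absNorm_span_eq_prod hv, h2, ← h1, absNorm_span_eq_prod hv, inv_div]
  rw [phiTerm, phiTerm, h3, h4]
  simp only [besselK_one_sub]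
  congr 2
  rw [Complex.ofReal_inv, Complex.inv_cpow _ _ (by
    rw [Complex.arg_ofReal_of_nonneg (by positivity)]
    exact Real.pi_pos.ne), ← Complex.cpow_neg]
  congr 1
  ring

include hv in
theorem phiSum_one_sub (s : ℂ) : phiSum hF v δ (1 - s) z = phiSum hF v δ s z := by
  rw [phiSum, phiSum, ← (swapEquiv hF).tsum_eq (fun x => phiTerm hF v δ s z x)]
  congr 1
  exact tsum_congr fun x => (phiTerm_swap hF hv s x).symm

end Phi

/-! ### The Eisenstein series and its invariance -/

section Eisenstein

variable {F : Type*} [Field F] [NumberField F]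
variable {n : ℕ} (v : Fin n → (F →+* ℝ))

/-- The summand of the Eisenstein series attached to a pair `(c, d)`. -/
noncomputable def eisTerm (s : ℝ) (z : Fin n → ℂ) (p : 𝓞 F × 𝓞 F) : ℝ :=
  ∏ k, ((z k).im / ‖((v k p.1 : ℝ) : ℂ) * z k + ((v k p.2 : ℝ) : ℂ)‖ ^ 2) ^ s

/-- The right action of `SL₂` on pairs. -/
def pairAct (A : Matrix.SpecialLinearGroup (Fin 2) (𝓞 F)) (p : 𝓞 F × 𝓞 F) : 𝓞 F × 𝓞 F :=
  (p.1 * A 0 0 + p.2 * A 1 0, p.1 * A 0 1 + p.2 * A 1 1)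

theorem det_eq_one (A : Matrix.SpecialLinearGroup (Fin 2) (𝓞 F)) :
    A 0 0 * A 1 1 - A 0 1 * A 1 0 = 1 := by
  have := A.2
  rwa [Matrix.det_fin_two] at this

theorem pairAct_inv (A : Matrix.SpecialLinearGroup (Fin 2) (𝓞 F)) (p : 𝓞 F × 𝓞 F) :
    pairAct A⁻¹ (pairAct A p) = p := by
  have h := det_eq_one A
  obtain ⟨c, d⟩ := p
  simp only [pairAct, Matrix.SpecialLinearGroup.SL2_inv_expl, Matrix.cons_val', Matrix.cons_val_zero, Matrix.cons_val_one,
    Matrix.cons_val_fin_one, Prod.mk.injEq]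
  constructor
  · linear_combination c * h
  · linear_combination d * h

theorem pairAct_ne_zero (A : Matrix.SpecialLinearGroup (Fin 2) (𝓞 F)) {p : 𝓞 F × 𝓞 F}
    (hp : p ≠ 0) : pairAct A p ≠ 0 := by
  intro h
  have h1 := pairAct_inv A p
  rw [h] at h1
  exact hp (by rw [← h1]; simp [pairAct])

theorem pairAct_unit (A : Matrix.SpecialLinearGroup (Fin 2) (𝓞 F)) (u : (𝓞 F)ˣ)
    (p : 𝓞 F × 𝓞 F) : pairAct A (u * p.1, u * p.2) = (u * (pairAct A p).1, u * (pairAct A p).2) := by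
  simp only [pairAct]
  ext <;> ring_nf

variable (F) in
/-- Index set for pairs up to units. -/
abbrev EisIdx : Type _ := NZIdeal F ⊕ (NZIdeal F × 𝓞 F)

variable (hF : NarrowClassNumberOne F)

/-- The pair represented by an index. -/
noncomputable def eisRep : EisIdx F → 𝓞 F × 𝓞 F
  | Sum.inl I => (0, gen hF I)
  | Sum.inr x => (gen hF x.1, x.2)

theorem eisRep_ne_zero (j : EisIdx F) : eisRep hF j ≠ 0 := by
  rcases j with I | ⟨I, d⟩ <;> simp [eisRep, gen_ne_zero hF I]

/-- This explains the shape of `EisIdx`. A pair `(0, d)` modulo units is the ideal `(d)`; when `c ≠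
0`, the unit is spent on making `c` the chosen generator of its ideal, after which `d` is
unrestricted. -/
theorem exists_eisRep {p : 𝓞 F × 𝓞 F} (hp : p ≠ 0) :
    ∃ j : EisIdx F, ∃ u : (𝓞 F)ˣ, eisRep hF j = (u * p.1, u * p.2) := by
  obtain ⟨c, d⟩ := p
  have key : ∀ a : 𝓞 F, a ≠ 0 → ∃ I : NZIdeal F, ∃ u : (𝓞 F)ˣ, gen hF I = u * a := fun a ha => by
    obtain ⟨u, hu⟩ := exists_unit_mul_gen hF (ν := a)
      (I := ⟨Ideal.span {a}, by simpa using ha⟩) rfl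
    refine ⟨⟨Ideal.span {a}, by simpa using ha⟩, u⁻¹, ?_⟩
    conv_rhs => rw [hu]
    rw [Units.inv_mul_cancel_left]
  by_cases hc : c = 0
  · have hd : d ≠ 0 := fun h => hp (by rw [hc, h]; rfl)
    obtain ⟨I, u, hu⟩ := key d hd
    exact ⟨Sum.inl I, u, by rw [eisRep, hu, hc, mul_zero]⟩
  · obtain ⟨I, u, hu⟩ := key c hc
    exact ⟨Sum.inr (I, u * d), u, by rw [eisRep, hu]⟩

theorem gen_injective_of_unit {I J : NZIdeal F} {u w : (𝓞 F)ˣ} {a : 𝓞 F} (h1 : gen hF I = u * a)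
    (h2 : gen hF J = w * a) : I = J := by
  refine Subtype.ext ?_
  rw [← span_gen hF I, ← span_gen hF J, Ideal.span_singleton_eq_span_singleton, h1, h2]
  exact (associated_unit_mul_left _ _ u.isUnit).trans
    (associated_unit_mul_left _ _ w.isUnit).symm

theorem eisRep_unique {i j : EisIdx F} {u w : (𝓞 F)ˣ} {p : 𝓞 F × 𝓞 F}
    (hi : eisRep hF i = (u * p.1, u * p.2)) (hj : eisRep hF j = (w * p.1, w * p.2)) : i = j := by
  have hu := u.ne_zero
  have hw := w.ne_zero
  rcases i with I | ⟨I, d⟩ <;> rcases j with J | ⟨J, e⟩ <;>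
    simp only [eisRep, Prod.mk.injEq] at hi hj
  · rw [gen_injective_of_unit hF hi.2 hj.2]
  · have h0 : p.1 = 0 := by simpa [hu] using hi.1.symm
    exact absurd (by rw [hj.1, h0, mul_zero]) (gen_ne_zero hF J)
  · have h0 : p.1 = 0 := by simpa [hw] using hj.1.symm
    exact absurd (by rw [hi.1, h0, mul_zero]) (gen_ne_zero hF I)
  · have hIJ := gen_injective_of_unit hF hi.1 hj.1
    subst hIJ
    have hp : p.1 ≠ 0 := fun h0 => gen_ne_zero hF I (by rw [hi.1, h0, mul_zero])
    have huw : (u : 𝓞 F) = w := mul_right_cancel₀ hp (hi.1.symm.trans hj.1)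
    rw [hi.2, hj.2, huw]

/-- The index of a nonzero pair. -/
noncomputable def eisIdx {p : 𝓞 F × 𝓞 F} (hp : p ≠ 0) : EisIdx F := (exists_eisRep hF hp).choose

theorem eisIdx_spec {p : 𝓞 F × 𝓞 F} (hp : p ≠ 0) :
    ∃ u : (𝓞 F)ˣ, eisRep hF (eisIdx hF hp) = (u * p.1, u * p.2) :=
  (exists_eisRep hF hp).choose_spec

/-- The map on indices induced by an element of `SL₂`. -/
noncomputable def eisMap (A : Matrix.SpecialLinearGroup (Fin 2) (𝓞 F)) (j : EisIdx F) : EisIdx F :=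
  eisIdx hF (pairAct_ne_zero A (eisRep_ne_zero hF j))

theorem eisMap_inv (A : Matrix.SpecialLinearGroup (Fin 2) (𝓞 F)) (j : EisIdx F) :
    eisMap hF A⁻¹ (eisMap hF A j) = j := by
  obtain ⟨u, hu⟩ := eisIdx_spec hF (pairAct_ne_zero A (eisRep_ne_zero hF j))
  change eisRep hF (eisMap hF A j) = _ at hu
  obtain ⟨w, hw⟩ := eisIdx_spec hF (pairAct_ne_zero A⁻¹ (eisRep_ne_zero hF (eisMap hF A j)))
  change eisRep hF (eisMap hF A⁻¹ (eisMap hF A j)) = _ at hw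
  rw [hu, pairAct_unit, pairAct_inv, ← mul_assoc, ← mul_assoc, ← Units.val_mul] at hw
  exact eisRep_unique hF hw (w := 1) (by simp)

/-- The permutation of indices induced by an element of `SL₂`. -/
noncomputable def eisEquiv (A : Matrix.SpecialLinearGroup (Fin 2) (𝓞 F)) : EisIdx F ≃ EisIdx F where
  toFun := eisMap hF A
  invFun := eisMap hF A⁻¹
  left_inv := eisMap_inv hF A
  right_inv j := by
    have := eisMap_inv hF A⁻¹ j
    rwa [inv_inv] at this

variable {v} [IsTotallyReal F] (hv : Function.Bijective v)

include hv in
theorem prod_abs_unit (u : (𝓞 F)ˣ) : ∏ k, |v k ((u : 𝓞 F) : F)| = 1 := by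
  rw [← absNorm_span_eq_prod hv, Ideal.span_singleton_eq_top.2 u.isUnit]
  simp

variable {z : Fin n → ℂ} (hz : z ∈ upperHalfProd n)

include hz in
theorem eisTerm_base_nonneg (p : 𝓞 F × 𝓞 F) (k : Fin n) :
    0 ≤ (z k).im / ‖((v k p.1 : ℝ) : ℂ) * z k + ((v k p.2 : ℝ) : ℂ)‖ ^ 2 :=
  div_nonneg (hz k).le (by positivity)

include hz in
theorem eisTerm_nonneg (s : ℝ) (p : 𝓞 F × 𝓞 F) : 0 ≤ eisTerm v s z p :=
  Finset.prod_nonneg fun k _ => Real.rpow_nonneg (eisTerm_base_nonneg hz p k) _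

include hz hv in
-- A unit scales the product over the places by `|N(u)|^{-2s}`, and a unit has norm of absolute
-- value 1. The series over pairs modulo units is therefore meaningful.
theorem eisTerm_unit (s : ℝ) (u : (𝓞 F)ˣ) (p : 𝓞 F × 𝓞 F) :
    eisTerm v s z (u * p.1, u * p.2) = eisTerm v s z p := by
  rw [eisTerm, eisTerm, Real.finsetProd_rpow _ _ (fun k _ => eisTerm_base_nonneg hz _ k),
    Real.finsetProd_rpow _ _ (fun k _ => eisTerm_base_nonneg hz _ k)]
  congr 1
  have h1 : ∀ k, (z k).im / ‖((v k ((u : 𝓞 F) * p.1 : 𝓞 F) : ℝ) : ℂ) * z k +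
      ((v k ((u : 𝓞 F) * p.2 : 𝓞 F) : ℝ) : ℂ)‖ ^ 2 = (|v k ((u : 𝓞 F) : F)| ^ 2)⁻¹ *
      ((z k).im / ‖((v k p.1 : ℝ) : ℂ) * z k + ((v k p.2 : ℝ) : ℂ)‖ ^ 2) := by
    intro k
    have h2 : ((v k ((u : 𝓞 F) * p.1 : 𝓞 F) : ℝ) : ℂ) * z k +
      ((v k ((u : 𝓞 F) * p.2 : 𝓞 F) : ℝ) : ℂ) = ((v k ((u : 𝓞 F) : F) : ℝ) : ℂ) *
        (((v k p.1 : ℝ) : ℂ) * z k + ((v k p.2 : ℝ) : ℂ)) := by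
      simp only [map_mul, Complex.ofReal_mul]
      ring
    rw [h2, norm_mul, Complex.norm_real, mul_pow, Real.norm_eq_abs]
    rw [div_mul_eq_div_div, div_eq_inv_mul (_ / _), div_eq_inv_mul, ]
    ring
  simp only [h1]
  rw [Finset.prod_mul_distrib, Finset.prod_inv_distrib, Finset.prod_pow, prod_abs_unit hv]
  simp

theorem denom_ne_zero {c d : ℝ} (h : c ≠ 0 ∨ d ≠ 0) {w : ℂ} (hw : 0 < w.im) :
    (c : ℂ) * w + d ≠ 0 := by
  intro h0
  have h1 := congrArg Complex.im h0
  have h2 := congrArg Complex.re h0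
  simp at h1 h2
  rcases h1 with h1 | h1
  · rw [h1] at h2
    simp [h1] at h h2
    exact h h2
  · exact hw.ne' h1

theorem v_det (A : Matrix.SpecialLinearGroup (Fin 2) (𝓞 F)) (k : Fin n) :
    v k (A 0 0) * v k (A 1 1) - v k (A 0 1) * v k (A 1 0) = 1 := by
  have h := congrArg (fun a : 𝓞 F => v k a) (det_eq_one A)
  simpa using h

theorem moebius_denom_ne_zero (A : Matrix.SpecialLinearGroup (Fin 2) (𝓞 F)) (k : Fin n) {w : ℂ}
    (hw : 0 < w.im) : ((v k (A 1 0) : ℝ) : ℂ) * w + ((v k (A 1 1) : ℝ) : ℂ) ≠ 0 := by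
  refine denom_ne_zero ?_ hw
  by_contra! h
  have := v_det (v := v) A k
  rw [h.1, h.2] at this
  simp at this

include hz in
theorem moebius_im (A : Matrix.SpecialLinearGroup (Fin 2) (𝓞 F)) (k : Fin n) :
    (moebius v A z k).im =
      (z k).im / ‖((v k (A 1 0) : ℝ) : ℂ) * z k + ((v k (A 1 1) : ℝ) : ℂ)‖ ^ 2 := by
  have h := v_det (v := v) A k
  rw [moebius, Complex.div_im, ← Complex.normSq_eq_norm_sq, ← sub_div]
  congr 1
  simp
  linear_combination (z k).im * h

include hz in
theorem moebius_mem (A : Matrix.SpecialLinearGroup (Fin 2) (𝓞 F)) :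
    moebius v A z ∈ upperHalfProd n := by
  intro k
  rw [moebius_im hz]
  have h1 := norm_pos_iff.2 (moebius_denom_ne_zero (v := v) A k (hz k))
  have h2 := hz k
  positivity

include hz in
-- The cocycle relation for `c z + d`: a Möbius transformation divides the denominator and the
-- imaginary part by compatible factors, leaving the right action on pairs.
theorem eisTerm_moebius (s : ℝ) (A : Matrix.SpecialLinearGroup (Fin 2) (𝓞 F)) (p : 𝓞 F × 𝓞 F) :
    eisTerm v s (moebius v A z) p = eisTerm v s z (pairAct A p) := by
  refine Finset.prod_congr rfl fun k _ => ?_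
  congr 1
  have h1 := moebius_denom_ne_zero (v := v) A k (hz k)
  have h2 : ((v k p.1 : ℝ) : ℂ) * moebius v A z k + ((v k p.2 : ℝ) : ℂ) =
      (((v k (pairAct A p).1 : ℝ) : ℂ) * z k + ((v k (pairAct A p).2 : ℝ) : ℂ)) /
        (((v k (A 1 0) : ℝ) : ℂ) * z k + ((v k (A 1 1) : ℝ) : ℂ)) := by
    rw [eq_div_iff h1, moebius, add_mul, mul_assoc, div_mul_cancel₀ _ h1]
    simp only [pairAct, map_add, map_mul, Complex.ofReal_add, Complex.ofReal_mul]
    ring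
  rw [moebius_im hz, h2, norm_div, div_pow]
  have h3 := norm_ne_zero_iff.2 h1
  field_simp

include hz hv in
/-- The Eisenstein series is invariant. -/
theorem hasSum_eisTerm_moebius {s : ℝ} (A : Matrix.SpecialLinearGroup (Fin 2) (𝓞 F)) {S : ℝ}
    (h : HasSum (fun j => eisTerm v s z (eisRep hF j)) S) :
    HasSum (fun j => eisTerm v s (moebius v A z) (eisRep hF j)) S := by
  rw [← (eisEquiv hF A).hasSum_iff] at h
  refine h.congr_fun fun j => ?_
  obtain ⟨u, hu⟩ := eisIdx_spec hF (pairAct_ne_zero A (eisRep_ne_zero hF j))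
  change eisRep hF (eisEquiv hF A j) = _ at hu
  rw [Function.comp_apply, hu, eisTerm_unit hv hz, eisTerm_moebius hz]

end Eisenstein

/-! ### The Fourier expansion of the Eisenstein series -/

section Expansion

variable {F : Type*} [Field F] [NumberField F] [IsTotallyReal F]
variable (hF : NarrowClassNumberOne F)
variable {n : ℕ} {v : Fin n → (F →+* ℝ)} (hv : Function.Bijective v)
variable {δ : 𝓞 F} (hδ : Ideal.span {δ} = differentIdeal ℤ (𝓞 F))
variable {z : Fin n → ℂ} (hz : z ∈ upperHalfProd n) {s : ℝ}

include hδ hv in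
theorem prod_abs_delta : ∏ k, |v k δ| = (discr F : ℝ) := by
  rw [← absNorm_span_eq_prod hv, hδ, absNorm_differentIdeal (K := F) (𝒪 := 𝓞 F),
    Nat.cast_natAbs, Int.cast_abs, abs_of_pos (discr_pos hv)]

include hz in
theorem eisTerm_eq (s : ℝ) (c d : 𝓞 F) :
    eisTerm v s z (c, d) = (∏ k, (z k).im) ^ s *
      ∏ k, ((v k c * (z k).re + v k d) ^ 2 + (|v k c| * (z k).im) ^ 2) ^ (-s) := by
  rw [← Real.finsetProd_rpow _ _ (fun k _ => (hz k).le), ← Finset.prod_mul_distrib]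
  refine Finset.prod_congr rfl fun k _ => ?_
  have h1 : ‖((v k c : ℝ) : ℂ) * z k + ((v k d : ℝ) : ℂ)‖ ^ 2 =
      (v k c * (z k).re + v k d) ^ 2 + (|v k c| * (z k).im) ^ 2 := by
    rw [← Complex.normSq_eq_norm_sq, Complex.normSq_apply, mul_pow |v k c|, sq_abs]
    simp
    ring
  rw [h1, Real.div_rpow (hz k).le (by positivity), Real.rpow_neg (by positivity), div_eq_mul_inv]

include hz hv in
theorem summable_eisTerm_row (hs : 1 / 2 < s) {c : 𝓞 F} (hc : c ≠ 0) :
    Summable fun d => eisTerm v s z (c, d) := by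
  simp only [eisTerm_eq hz s c _]
  refine (summable_integers_weight hv
    (φ := fun k x => (x ^ 2 + (|v k c| * (z k).im) ^ 2) ^ (-s)) (fun k => ?_)
    (fun k => v k c * (z k).re)).mul_left _
  exact isWeight_rpow_neg_sq_add_sq hs (mul_pos (abs_pos.2 (v_ne_zero hc k)) (hz k))

variable (F n) in
/-- The normalising constant `d_F / π^n`. -/
noncomputable def normConst : ℝ := (discr F : ℝ) / Real.pi ^ n

include hv in
theorem normConst_pos : 0 < normConst F n := by
  have := discr_pos hv
  have := Real.pi_pos
  rw [normConst]
  positivity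

/-- The summand in the dual sum of Poisson summation. -/
theorem dual_term_eq (hs : 1 / 2 < s) (hδ0 : δ ≠ 0) (I : NZIdeal F) (ν : {ν : 𝓞 F // ν ≠ 0})
    (hv : Function.Bijective v) (hz : z ∈ upperHalfProd n) :
    Complex.exp (2 * Real.pi * Complex.I * ∑ k, ((v k ν.1 / v k δ : ℝ) : ℂ) *
        ((v k (gen hF I) * (z k).re : ℝ) : ℂ)) *
      ∏ k, ∫ x : ℝ, Complex.exp (-(2 * Real.pi * Complex.I * ((v k ν.1 / v k δ : ℝ) * x))) *
        (((x ^ 2 + (|v k (gen hF I)| * (z k).im) ^ 2) ^ (-s) : ℝ) : ℂ) =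
    (((Real.sqrt Real.pi / Real.Gamma s) ^ n *
      ∏ k, (Real.pi / (|v k δ| * (z k).im)) ^ (s - 1 / 2) : ℝ) : ℂ) * phiTerm hF v δ s z (I, ν) := by
  have hg := gen_ne_zero hF I
  have hFT : ∀ k, ∫ x : ℝ, Complex.exp (-(2 * Real.pi * Complex.I * ((v k ν.1 / v k δ : ℝ) * x))) *
        (((x ^ 2 + (|v k (gen hF I)| * (z k).im) ^ 2) ^ (-s) : ℝ) : ℂ) =
      ((Real.sqrt Real.pi / Real.Gamma s : ℝ) : ℂ) *
      (((Real.pi / (|v k δ| * (z k).im)) ^ (s - 1 / 2) : ℝ) : ℂ) *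
      (((|v k ν.1| / |v k (gen hF I)|) ^ (s - 1 / 2) : ℝ) : ℂ) *
      besselK s (Real.pi * |v k (gen hF I * ν.1 : 𝓞 F) / v k δ| * (z k).im) := by
    intro k
    have h1 : 0 < |v k (gen hF I)| := abs_pos.2 (v_ne_zero hg k)
    have h2 : 0 < |v k δ| := abs_pos.2 (v_ne_zero hδ0 k)
    have h3 := hz k
    have h4 := Real.pi_pos
    rw [fourier_rpow_neg_sq_add_sq_ne_zero hs (mul_pos h1 h3)
      (div_ne_zero (v_ne_zero ν.2 k) (v_ne_zero hδ0 k))]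
    have e1 : (Real.pi * |v k ν.1 / v k δ| / (|v k (gen hF I)| * (z k).im)) ^ (s - 1 / 2) =
        (Real.pi / (|v k δ| * (z k).im)) ^ (s - 1 / 2) *
          (|v k ν.1| / |v k (gen hF I)|) ^ (s - 1 / 2) := by
      rw [← Real.mul_rpow (by positivity) (by positivity), abs_div]
      congr 1
      field_simp
    have e2 : Real.pi * |v k ν.1 / v k δ| * (|v k (gen hF I)| * (z k).im) =
        Real.pi * |v k (gen hF I * ν.1 : 𝓞 F) / v k δ| * (z k).im := by
      simp only [map_mul, abs_div, abs_mul]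
      ring
    rw [e1, e2, ← mul_assoc, Complex.ofReal_mul, Complex.ofReal_mul]
  rw [Finset.prod_congr rfl fun k _ => hFT k]
  simp only [Finset.prod_mul_distrib, Finset.prod_const, Finset.card_univ, Fintype.card_fin]
  have hr : ∏ k, (((|v k ν.1| / |v k (gen hF I)|) ^ (s - 1 / 2) : ℝ) : ℂ) =
      (((∏ k, |v k ν.1|) / Ideal.absNorm I.1 : ℝ) : ℂ) ^ ((s : ℂ) - 1 / 2) := by
    rw [← Complex.ofReal_prod, Real.finsetProd_rpow _ _ (fun k _ => by positivity),
      Finset.prod_div_distrib, ← absNorm_eq_prod_gen hF hv, Complex.ofReal_cpow (by positivity)]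
    push_cast
    rfl
  rw [hr, phiTerm, Complex.ofReal_mul, Complex.ofReal_pow, ← Complex.ofReal_prod]
  have he : Complex.exp (2 * Real.pi * Complex.I * ∑ k, ((v k ν.1 / v k δ : ℝ) : ℂ) *
        ((v k (gen hF I) * (z k).re : ℝ) : ℂ)) = Complex.exp (2 * Complex.I * Real.pi *
      ∑ k, ((v k (gen hF I * ν.1 : 𝓞 F) / v k δ * (z k).re : ℝ) : ℂ)) := by
    have h1 : ∑ k, ((v k ν.1 / v k δ : ℝ) : ℂ) * ((v k (gen hF I) * (z k).re : ℝ) : ℂ) =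
        ∑ k, ((v k (gen hF I * ν.1 : 𝓞 F) / v k δ * (z k).re : ℝ) : ℂ) := by
      refine Finset.sum_congr rfl fun k _ => ?_
      rw [← Complex.ofReal_mul]
      congr 1
      simp only [map_mul]
      ring
    rw [h1]
    congr 1
    ring
  rw [he]
  ring

theorem hasSum_add_of_hasSum_ne {ι : Type*} (i : ι) {G : ι → ℂ} {S : ℂ}
    (h : HasSum (fun x : {x : ι // x ≠ i} => G x.1) S) : HasSum G (G i + S) := by
  classical
  have h2 := (hasSum_ite_eq i (G i)).add
    ((hasSum_subtype_iff_indicator (s := {x : ι | x ≠ i})).1 h)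
  refine h2.congr_fun fun x => ?_
  by_cases hx : x = i
  · simp [hx]
  · simp [hx]

include hδ hv hz in
-- Poisson summation in `d` with `c = gen I` fixed. The frequency `ν = 0` gives the constant term in
-- `Y^{1-s}`, and the frequencies `ν ≠ 0` give the part of `phiSum` belonging to `I`.
theorem hasSum_row (hs : 1 / 2 < s) (I : NZIdeal F) :
    ((normConst F n ^ s * Real.Gamma s ^ n * ∑' d, eisTerm v s z (gen hF I, d) : ℝ) : ℂ) =
      ((normConst F n ^ (s - 1 / 2) * Real.Gamma (s - 1 / 2) ^ n * (∏ k, (z k).im) ^ (1 - s) *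
        (Ideal.absNorm I.1 : ℝ) ^ (1 - 2 * s) : ℝ) : ℂ) +
      (Real.sqrt (∏ k, (z k).im) : ℂ) * ∑' ν : {ν : 𝓞 F // ν ≠ 0}, phiTerm hF v δ s z (I, ν) := by
  have hδ0 := delta_ne_zero hδ
  have hg := gen_ne_zero hF I
  set Y : ℝ := ∏ k, (z k).im with hY
  have hYpos : 0 < Y := Finset.prod_pos fun k _ => hz k
  set N : ℝ := (Ideal.absNorm I.1 : ℝ) with hN
  have hNpos : 0 < N := by rw [hN]; exact_mod_cast absNorm_pos I
  have hD := discr_pos hv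
  have hpi := Real.pi_pos
  have hq := normConst_pos (F := F) hv
  have hG : Real.Gamma s ≠ 0 := (Real.Gamma_pos_of_pos (by linarith)).ne'
  set φ : Fin n → ℝ → ℝ := fun k x => (x ^ 2 + (|v k (gen hF I)| * (z k).im) ^ 2) ^ (-s) with hφ
  have hw : ∀ k, IsWeight (φ k) := fun k =>
    isWeight_rpow_neg_sq_add_sq hs (mul_pos (abs_pos.2 (v_ne_zero hg k)) (hz k))
  set B : ℝ := (Real.sqrt Real.pi / Real.Gamma s) ^ n *
      ∏ k, (Real.pi / (|v k δ| * (z k).im)) ^ (s - 1 / 2) with hB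
  have hBq : B = (Real.sqrt Real.pi / Real.Gamma s) ^ n * (normConst F n * Y) ^ (-(s - 1 / 2)) := by
    rw [hB, Real.finsetProd_rpow _ _ (fun k _ => by have := hz k; positivity),
      Finset.prod_div_distrib, Finset.prod_mul_distrib, prod_abs_delta hv hδ, ← hY,
      Finset.prod_const, Finset.card_univ, Fintype.card_fin, Real.rpow_neg (by positivity),
      ← Real.inv_rpow (by positivity), normConst]
    congr 2
    field_simp
  obtain ⟨G, hGdef⟩ : ∃ G : 𝓞 F → ℂ, G = fun ν : 𝓞 F =>
      Complex.exp (2 * Real.pi * Complex.I * ∑ k, ((v k ν / v k δ : ℝ) : ℂ) *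
        ((v k (gen hF I) * (z k).re : ℝ) : ℂ)) *
        ∏ k, ∫ x : ℝ, Complex.exp (-(2 * Real.pi * Complex.I * ((v k ν / v k δ : ℝ) * x))) *
          (φ k x : ℂ) := ⟨_, rfl⟩
  have hGne : ∀ ν : {ν : 𝓞 F // ν ≠ 0}, G ν.1 = (B : ℂ) * phiTerm hF v δ s z (I, ν) := fun ν => by
    rw [hGdef]
    exact dual_term_eq hF hs hδ0 I ν hv hz
  have hG0 : G 0 = (((Real.sqrt Real.pi / Real.Gamma s) ^ n * (Real.Gamma (s - 1 / 2) ^ n *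
      (N * Y) ^ (1 - 2 * s)) : ℝ) : ℂ) := by
    rw [hGdef]
    dsimp only
    have h1 : ∀ k, ∫ x : ℝ, Complex.exp (-(2 * Real.pi * Complex.I *
        ((v k ((0 : 𝓞 F) : F) / v k δ : ℝ) * x))) * (φ k x : ℂ) =
        ((Real.sqrt Real.pi / Real.Gamma s * (Real.Gamma (s - 1 / 2) *
          (|v k (gen hF I)| * (z k).im) ^ (1 - 2 * s)) : ℝ) : ℂ) := by
      intro k
      have := fourier_rpow_neg_sq_add_sq_zero hs
        (mul_pos (abs_pos.2 (v_ne_zero (v := v) hg k)) (hz k))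
      rw [← this]
      simp
      rfl
    rw [Finset.prod_congr rfl fun k _ => h1 k, ← Complex.ofReal_prod, Finset.prod_mul_distrib,
      Finset.prod_mul_distrib, Finset.prod_const, Finset.prod_const,
      Real.finsetProd_rpow _ _ (fun k _ => by have := hz k; positivity), Finset.prod_mul_distrib,
      ← absNorm_eq_prod_gen hF hv, Finset.card_univ, Fintype.card_fin]
    have h0 : Complex.exp (2 * Real.pi * Complex.I * ∑ k, ((v k ((0 : 𝓞 F) : F) / v k δ : ℝ) : ℂ) *
        ((v k (gen hF I) * (z k).re : ℝ) : ℂ)) = 1 := by simp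
    rw [h0, one_mul]
  have hsumφ : Summable fun ν : {ν : 𝓞 F // ν ≠ 0} => phiTerm hF v δ s z (I, ν) :=
    ((summable_norm_phiTerm hF hv hδ0 hz (s : ℂ)).comp_injective
      (Prod.mk_right_injective I)).of_norm
  have hsumG' : Summable fun ν : {ν : 𝓞 F // ν ≠ 0} => G ν.1 :=
    (hsumφ.mul_left (B : ℂ)).congr fun ν => (hGne ν).symm
  have hHG : HasSum G (G 0 + B * ∑' ν : {ν : 𝓞 F // ν ≠ 0}, phiTerm hF v δ s z (I, ν)) := by
    refine hasSum_add_of_hasSum_ne 0 ?_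
    exact (hsumφ.hasSum.mul_left (B : ℂ)).congr_fun hGne
  have hsumG : Summable G := hHG.summable
  have htsum := hHG.tsum_eq
  have hP : (∑' d : 𝓞 F, ((∏ k, φ k (v k (gen hF I) * (z k).re + v k d) : ℝ) : ℂ)) =
      ((Real.sqrt (discr F))⁻¹ : ℝ) * ∑' ν, G ν := by
    rw [hGdef]
    exact poisson_summation_integers hv hδ hw (fun k => v k (gen hF I) * (z k).re) (hGdef ▸ hsumG)
  have hrow : ((∑' d, eisTerm v s z (gen hF I, d) : ℝ) : ℂ) =
      (Y ^ s : ℝ) * (((Real.sqrt (discr F))⁻¹ : ℝ) * ∑' ν, G ν) := by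
    rw [← hP, ← tsum_mul_left, Complex.ofReal_tsum]
    refine tsum_congr fun d => ?_
    rw [eisTerm_eq hz s _ d, Complex.ofReal_mul]
  rw [Complex.ofReal_mul, hrow, htsum, hG0]
  set S := ∑' ν : {ν : 𝓞 F // ν ≠ 0}, phiTerm hF v δ s z (I, ν)
  -- The covolume and the powers of `√π` from the Fourier transforms combine to `q^{-1/2}`. With
  -- this, `e2` collects the factors at `ν = 0`, and in `e3` everything but `√Y` cancels at `ν ≠ 0`.
  have e1 : (Real.sqrt (discr F))⁻¹ * Real.sqrt Real.pi ^ n = normConst F n ^ (-(1 / 2) : ℝ) := by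
    have h1 : Real.sqrt Real.pi ^ n = Real.sqrt (Real.pi ^ n) := by
      rw [Real.sqrt_eq_rpow, Real.sqrt_eq_rpow, ← Real.rpow_natCast, ← Real.rpow_mul hpi.le,
        mul_comm, Real.rpow_mul hpi.le, Real.rpow_natCast]
    rw [h1, Real.rpow_neg hq.le, ← Real.sqrt_eq_rpow, normConst, Real.sqrt_div hD.le, inv_div,
      inv_mul_eq_div]
  have e2 : normConst F n ^ s * Real.Gamma s ^ n * (Y ^ s * ((Real.sqrt (discr F))⁻¹ *
      ((Real.sqrt Real.pi / Real.Gamma s) ^ n * (Real.Gamma (s - 1 / 2) ^ n *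
      (N * Y) ^ (1 - 2 * s))))) = normConst F n ^ (s - 1 / 2) * Real.Gamma (s - 1 / 2) ^ n *
      Y ^ (1 - s) * N ^ (1 - 2 * s) := by
    rw [show s - 1 / 2 = s + -(1 / 2) by ring, Real.rpow_add hq, ← e1, div_pow,
      Real.mul_rpow hNpos.le hYpos.le, show 1 - s = s + (1 - 2 * s) by ring, Real.rpow_add hYpos]
    field_simp
  have e3 : normConst F n ^ s * Real.Gamma s ^ n * (Y ^ s * ((Real.sqrt (discr F))⁻¹ * B)) =
      Real.sqrt Y := by
    have h2 : normConst F n ^ s * normConst F n ^ (-(1 / 2) : ℝ) *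
        normConst F n ^ (-(s - 1 / 2)) = 1 := by
      rw [← Real.rpow_add hq, ← Real.rpow_add hq,
        show s + -(1 / 2) + -(s - 1 / 2) = 0 by ring, Real.rpow_zero]
    have h3 : Y ^ s * Y ^ (-(s - 1 / 2)) = Real.sqrt Y := by
      rw [← Real.rpow_add hYpos, Real.sqrt_eq_rpow]
      congr 1
      ring
    rw [hBq, Real.mul_rpow hq.le hYpos.le, div_pow, ← h3]
    rw [← e1] at h2
    have hGn : Real.Gamma s ^ n ≠ 0 := pow_ne_zero _ hG
    calc _ = (normConst F n ^ s * ((Real.sqrt (discr F))⁻¹ * Real.sqrt Real.pi ^ n) *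
        normConst F n ^ (-(s - 1 / 2))) * (Y ^ s * Y ^ (-(s - 1 / 2))) *
        (Real.Gamma s ^ n / Real.Gamma s ^ n) := by ring
      _ = _ := by rw [h2, div_self hGn]; ring
  rw [← e2, ← e3]
  push_cast
  ring

theorem dedekindZeta_ofReal {w : ℝ} (hw : 1 < w) :
    dedekindZeta F (w : ℂ) = ((∑' I : NZIdeal F, (Ideal.absNorm I.1 : ℝ) ^ (-w) : ℝ) : ℂ) := by
  rw [Complex.ofReal_tsum, ← (hasSum_absNorm_cpow (F := F) (s := w) (by simpa using hw)).tsum_eq]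
  refine tsum_congr fun I => ?_
  rw [Complex.ofReal_cpow (Nat.cast_nonneg _)]
  push_cast
  rfl

include hv hz in
theorem eisTerm_zero_gen (s : ℝ) (I : NZIdeal F) :
    eisTerm v s z (0, gen hF I) = (∏ k, (z k).im) ^ s * (Ideal.absNorm I.1 : ℝ) ^ (-(2 * s)) := by
  rw [eisTerm_eq hz, absNorm_eq_prod_gen hF hv, ← Real.finsetProd_rpow _ _ (fun k _ => abs_nonneg _)]
  congr 1
  refine Finset.prod_congr rfl fun k _ => ?_
  rw [show ((0 : 𝓞 F) : F) = 0 from rfl, map_zero, zero_mul, zero_add, abs_zero, zero_mul, zero_pow two_ne_zero, add_zero,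
    ← sq_abs, ← Real.rpow_natCast, ← Real.rpow_mul (abs_nonneg _)]
  congr 1
  push_cast
  ring

theorem summable_prod_of_rows {α β : Type*} {f : α → β → ℝ} (h0 : ∀ a b, 0 ≤ f a b)
    (h1 : ∀ a, Summable (f a)) (h2 : Summable fun a => ∑' b, f a b) :
    Summable fun x : α × β => f x.1 x.2 :=
  (summable_prod_of_nonneg fun x => h0 x.1 x.2).2 ⟨h1, h2⟩

variable (F n) in
/-- The completed zeta function at `2s`, on the half plane of convergence. -/
noncomputable def complZeta (s : ℂ) : ℂ :=
  (normConst F n : ℂ) ^ s * Complex.Gamma s ^ n * dedekindZeta F (2 * s)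

include hδ hv hz in
/-- The Fourier expansion of the completed Eisenstein series. -/
theorem exists_hasSum_eisTerm (hs : 1 < s) :
    ∃ S : ℝ, HasSum (fun j => eisTerm v s z (eisRep hF j)) S ∧
      ((normConst F n ^ s * Real.Gamma s ^ n * S : ℝ) : ℂ) =
        (∏ k, (z k).im : ℝ) ^ (s : ℂ) * complZeta F n s +
        (∏ k, (z k).im : ℝ) ^ (1 - s : ℂ) * complZeta F n (s - 1 / 2) + phiSum hF v δ s z := by
  have hδ0 := delta_ne_zero hδ
  have hs2 : 1 / 2 < s := by linarith
  have hYpos : 0 < ∏ k, (z k).im := Finset.prod_pos fun k _ => hz k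
  have hq := normConst_pos (F := F) hv
  have hG : 0 < Real.Gamma s := Real.Gamma_pos_of_pos (by linarith)
  have hC : 0 < normConst F n ^ s * Real.Gamma s ^ n := by positivity
  have hinl : HasSum (fun I => eisTerm v s z (eisRep hF (Sum.inl I)))
      ((∏ k, (z k).im) ^ s * ∑' I : NZIdeal F, (Ideal.absNorm I.1 : ℝ) ^ (-(2 * s))) :=
    ((summable_absNorm_rpow (F := F) (s := 2 * s) (by linarith)).hasSum.mul_left _).congr_fun
      fun I => eisTerm_zero_gen hF hv hz s I
  have hphi := (summable_norm_phiTerm hF hv hδ0 hz (s : ℂ)).of_norm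
  have hN : HasSum (fun I : NZIdeal F => (Ideal.absNorm I.1 : ℝ) ^ (1 - 2 * s))
      (∑' I : NZIdeal F, (Ideal.absNorm I.1 : ℝ) ^ (-(2 * s - 1))) := by
    refine ((summable_absNorm_rpow (F := F) (s := 2 * s - 1) (by linarith)).hasSum).congr_fun
      fun I => ?_
    rw [neg_sub]
  set A : ℝ := normConst F n ^ (s - 1 / 2) * Real.Gamma (s - 1 / 2) ^ n * (∏ k, (z k).im) ^ (1 - s)
    with hA
  have hrow : HasSum (fun I : NZIdeal F =>
      ((normConst F n ^ s * Real.Gamma s ^ n * ∑' d, eisTerm v s z (gen hF I, d) : ℝ) : ℂ))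
      (((A * ∑' I : NZIdeal F, (Ideal.absNorm I.1 : ℝ) ^ (-(2 * s - 1)) : ℝ) : ℂ) +
        phiSum hF v δ s z) := by
    refine (((Complex.hasSum_ofReal.2 (hN.mul_left A))).add
      ((hphi.hasSum.prod_fiberwise fun I => (hphi.prod_factor I).hasSum).mul_left
        (Real.sqrt (∏ k, (z k).im) : ℂ))).congr_fun fun I => ?_
    rw [hasSum_row hF hv hδ hz (by linarith) I]
  -- The row sums are real although their expansion is complex. Taking real parts gives summability
  -- of the rows; since all terms are nonnegative, summability over all pairs follows. Comparison
  -- with the complex sum shows that the expansion is real.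
  have hre : HasSum (fun I : NZIdeal F => normConst F n ^ s * Real.Gamma s ^ n *
      ∑' d, eisTerm v s z (gen hF I, d))
      ((A * ∑' I : NZIdeal F, (Ideal.absNorm I.1 : ℝ) ^ (-(2 * s - 1)) : ℝ) +
        (phiSum hF v δ s z).re) := by
    have := Complex.hasSum_re hrow
    simpa only [Complex.ofReal_re, Complex.add_re] using this
  have him := Complex.hasSum_ofReal.2 hre
  have hval := hrow.unique him
  have hrow' : Summable fun I : NZIdeal F => ∑' d, eisTerm v s z (gen hF I, d) := by
    refine (hre.summable.mul_left (normConst F n ^ s * Real.Gamma s ^ n)⁻¹).congr fun I => ?_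
    rw [inv_mul_cancel_left₀ hC.ne']
  have h1 : ∀ I : NZIdeal F, Summable fun d => eisTerm v s z (gen hF I, d) :=
    fun I => summable_eisTerm_row hv hz hs2 (gen_ne_zero hF I)
  have h0 : ∀ (I : NZIdeal F) (d : 𝓞 F), 0 ≤ eisTerm v s z (gen hF I, d) :=
    fun I d => eisTerm_nonneg hz s _
  have hsum2 : Summable fun x : NZIdeal F × 𝓞 F => eisTerm v s z (gen hF x.1, x.2) :=
    summable_prod_of_rows (f := fun I d => eisTerm v s z (gen hF I, d)) h0 h1 hrow'
  have hinr : HasSum (fun x : NZIdeal F × 𝓞 F => eisTerm v s z (eisRep hF (Sum.inr x)))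
      (∑' I : NZIdeal F, ∑' d, eisTerm v s z (gen hF I, d)) := by
    simp only [eisRep]
    rw [← hsum2.tsum_prod' fun I => hsum2.prod_factor I]
    exact hsum2.hasSum
  refine ⟨_, HasSum.sum hinl hinr, ?_⟩
  have h3 : normConst F n ^ s * Real.Gamma s ^ n *
      ∑' I : NZIdeal F, ∑' d, eisTerm v s z (gen hF I, d) =
      (A * ∑' I : NZIdeal F, (Ideal.absNorm I.1 : ℝ) ^ (-(2 * s - 1)) : ℝ) +
        (phiSum hF v δ s z).re := by
    rw [← hre.tsum_eq, tsum_mul_left]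
  rw [mul_add, h3, Complex.ofReal_add, ← hval, complZeta, complZeta,
    show (2 * (s : ℂ)) = ((2 * s : ℝ) : ℂ) by push_cast; ring,
    show (2 * ((s : ℂ) - 1 / 2)) = ((2 * s - 1 : ℝ) : ℂ) by push_cast; ring,
    dedekindZeta_ofReal (by linarith), dedekindZeta_ofReal (by linarith),
    show ((s : ℂ) - 1 / 2) = ((s - 1 / 2 : ℝ) : ℂ) by push_cast; ring,
    show (1 - (s : ℂ)) = ((1 - s : ℝ) : ℂ) by push_cast; ring,
    Complex.Gamma_ofReal, Complex.Gamma_ofReal, ← Complex.ofReal_cpow hq.le,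
    ← Complex.ofReal_cpow hq.le, ← Complex.ofReal_cpow hYpos.le, ← Complex.ofReal_cpow hYpos.le, hA]
  push_cast
  ring

include hδ hv hz in
/-- The constant term and the nonconstant terms add up to an invariant function. -/
theorem eisenstein_invariant (hs : 1 < s) (M : Matrix.SpecialLinearGroup (Fin 2) (𝓞 F)) :
    (∏ k, (moebius v M z k).im : ℝ) ^ (s : ℂ) * complZeta F n s +
        (∏ k, (moebius v M z k).im : ℝ) ^ (1 - s : ℂ) * complZeta F n (s - 1 / 2) +
        phiSum hF v δ s (moebius v M z) =
      (∏ k, (z k).im : ℝ) ^ (s : ℂ) * complZeta F n s +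
        (∏ k, (z k).im : ℝ) ^ (1 - s : ℂ) * complZeta F n (s - 1 / 2) + phiSum hF v δ s z := by
  obtain ⟨S, hS, hSe⟩ := exists_hasSum_eisTerm hF hv hδ hz hs
  obtain ⟨S', hS', hSe'⟩ := exists_hasSum_eisTerm hF hv hδ (moebius_mem hz M) hs
  rw [← hSe, ← hSe', (hasSum_eisTerm_moebius hF hv hz M hS).unique hS']

end Expansion

/-! ### Analytic continuation from a family of linear equations -/

/-- The nonzero zeros of `sinh` are multiples of `iπ`, and `3 < π`. -/
theorem sinh_ne_zero_of_norm_lt {w : ℂ} (h0 : w ≠ 0) (hw : ‖w‖ < 3) : Complex.sinh w ≠ 0 := by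
  intro h
  have h1 : Complex.sin (w * Complex.I) = 0 := by rw [Complex.sin_mul_I, h, zero_mul]
  obtain ⟨k, hk⟩ := Complex.sin_eq_zero_iff.1 h1
  have h2 : ‖w‖ = |(k : ℝ)| * Real.pi := by
    have := congrArg norm hk
    rwa [norm_mul, Complex.norm_I, mul_one, norm_mul, Complex.norm_real, Real.norm_of_nonneg
      Real.pi_pos.le, Complex.norm_intCast] at this
  have hk0 : k ≠ 0 := by
    rintro rfl
    refine h0 (norm_eq_zero.1 ?_)
    rw [h2]
    simp
  have h3 : (1 : ℝ) ≤ |(k : ℝ)| := by exact_mod_cast Int.one_le_abs hk0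
  nlinarith [Real.pi_gt_three]

/-- The identity theorem in the form needed here: the Eisenstein equations are known only for real
`s`. -/
theorem eqOn_of_eventually_real_eq {U : Set ℂ} (hU : IsOpen U) (hc : IsPreconnected U) {f g : ℂ → ℂ}
    (hf : DifferentiableOn ℂ f U) (hg : DifferentiableOn ℂ g U) {x : ℝ} (hx : (x : ℂ) ∈ U)
    (h : ∀ᶠ y : ℝ in 𝓝[≠] x, f y = g y) : EqOn f g U := by
  refine (hf.analyticOnNhd hU).eqOn_of_preconnected_of_frequently_eq (hg.analyticOnNhd hU) hc hx ?_
  refine Tendsto.frequently (f := fun y : ℝ => (y : ℂ)) (l₁ := 𝓝[≠] x) ?_ h.frequently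
  refine tendsto_nhdsWithin_of_tendsto_nhds_of_eventually_within _
    (Complex.continuous_ofReal.continuousAt.tendsto.mono_left nhdsWithin_le_nhds) ?_
  filter_upwards [self_mem_nhdsWithin] with y hy
  simpa using hy

section Continuation

variable {a : ℂ → ℂ} {Ψ : ℝ → ℂ → ℂ}

/-- The determinant of the two equations at `x` and `2 x`. -/
noncomputable def contDet (x : ℝ) (s : ℂ) : ℂ :=
  Complex.sinh (x * s) * Complex.sinh ((2 * x : ℝ) * (1 - s)) -
    Complex.sinh ((2 * x : ℝ) * s) * Complex.sinh (x * (1 - s))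

variable (Ψ) in
/-- Cramer's numerator of the two equations at `x` and `2 x`. -/
noncomputable def contNum (x : ℝ) (s : ℂ) : ℂ :=
  -Ψ x s * Complex.sinh ((2 * x : ℝ) * (1 - s)) + Ψ (2 * x) s * Complex.sinh (x * (1 - s))

variable (Ψ) in
/-- The continuation. -/
noncomputable def contFun (s : ℂ) : ℂ :=
  -- The parameter shrinks as `s` grows, to keep the arguments of the `sinh` factors below their
  -- first nonzero zero. The determinant then vanishes at most for `s = 0, 1/2, 1`. Away from these
  -- points every small enough parameter gives the same value, by `contFun_eq`.
  contNum Ψ (1 / (‖s‖ + 1)) s / contDet (1 / (‖s‖ + 1)) s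

/-- Duplication of `sinh` and the difference formula for `cosh`. The factors exhibit the only zeros
for small `x`, namely `s = 0, 1, 1/2`, and show that the one at 0 is simple. -/
theorem contDet_eq (x : ℝ) (s : ℂ) : contDet x s = Complex.sinh (x * s) *
    (4 * Complex.sinh (x * (1 - s)) *
      (Complex.sinh (x / 2) * Complex.sinh (x * (1 - 2 * s) / 2))) := by
  have h1 : ((2 * x : ℝ) : ℂ) * (1 - s) = 2 * (x * (1 - s)) := by push_cast; ring
  have h2 : ((2 * x : ℝ) : ℂ) * s = 2 * (x * s) := by push_cast; ring
  have h3 : (x : ℂ) * (1 - s) = x / 2 + x * (1 - 2 * s) / 2 := by ring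
  have h4 : (x : ℂ) * s = x / 2 - x * (1 - 2 * s) / 2 := by ring
  rw [contDet, h1, h2, Complex.sinh_two_mul, Complex.sinh_two_mul]
  have h5 : Complex.cosh (x * (1 - s)) - Complex.cosh (x * s) =
      2 * (Complex.sinh (x / 2) * Complex.sinh (x * (1 - 2 * s) / 2)) := by
    rw [h3, h4, Complex.cosh_add, Complex.cosh_sub]
    ring
  linear_combination 2 * Complex.sinh (x * s) * Complex.sinh (x * (1 - s)) * h5

theorem norm_mul_lt {x : ℝ} (hx : 0 < x) {s t : ℂ} (hxs : x * (‖s‖ + 1) < 2)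
    (ht : ‖t‖ ≤ ‖s‖ + 1) : ‖(x : ℂ) * t‖ < 3 := by
  rw [norm_mul, Complex.norm_real, Real.norm_of_nonneg hx.le]
  nlinarith

theorem contDet_factor_ne_zero {x : ℝ} (hx : 0 < x) {s : ℂ} (hxs : x * (‖s‖ + 1) < 2)
    (h1 : s ≠ 1) (h2 : s ≠ 1 / 2) : 4 * Complex.sinh (x * (1 - s)) *
      (Complex.sinh (x / 2) * Complex.sinh (x * (1 - 2 * s) / 2)) ≠ 0 := by
  have hx0 : (x : ℂ) ≠ 0 := by exact_mod_cast hx.ne'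
  refine mul_ne_zero (mul_ne_zero (by norm_num) ?_) (mul_ne_zero ?_ ?_)
  · refine sinh_ne_zero_of_norm_lt (mul_ne_zero hx0 (sub_ne_zero.2 (Ne.symm h1)))
      (norm_mul_lt hx hxs ?_)
    refine (norm_sub_le _ _).trans ?_
    rw [norm_one, add_comm]
  · rw [div_eq_mul_inv]
    refine sinh_ne_zero_of_norm_lt (mul_ne_zero hx0 (by norm_num)) (norm_mul_lt hx hxs ?_)
    rw [norm_inv, Complex.norm_ofNat]
    linarith [norm_nonneg s]
  · rw [mul_div_assoc]
    refine sinh_ne_zero_of_norm_lt (mul_ne_zero hx0 ?_) (norm_mul_lt hx hxs ?_)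
    · intro h
      refine h2 ?_
      linear_combination -h
    · rw [norm_div, Complex.norm_ofNat]
      have := norm_sub_le 1 (2 * s)
      rw [norm_one, norm_mul, Complex.norm_ofNat] at this
      linarith [norm_nonneg s]

theorem contDet_ne_zero {x : ℝ} (hx : 0 < x) {s : ℂ} (hxs : x * (‖s‖ + 1) < 2) (h0 : s ≠ 0)
    (h1 : s ≠ 1) (h2 : s ≠ 1 / 2) : contDet x s ≠ 0 := by
  rw [contDet_eq]
  refine mul_ne_zero (sinh_ne_zero_of_norm_lt (mul_ne_zero (by exact_mod_cast hx.ne') h0)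
    (norm_mul_lt hx hxs (by linarith))) (contDet_factor_ne_zero hx hxs h1 h2)

theorem differentiable_contDet (x : ℝ) : Differentiable ℂ (contDet x) := by
  unfold contDet
  fun_prop

variable (hΨ : ∀ x : ℝ, 0 < x → Differentiable ℂ (Ψ x))
  (hsym : ∀ x : ℝ, 0 < x → ∀ s, Ψ x (1 - s) = Ψ x s)
  (heq : ∀ x : ℝ, 0 < x → ∀ s : ℝ, 1 < s → Complex.sinh (x * s) * a s +
    Complex.sinh (x * (1 - s)) * a (s - 1 / 2) + Ψ x s = 0)
  (ha : DifferentiableOn ℂ a {s | 1 / 2 < s.re})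

include hΨ in
theorem differentiable_contNum {x : ℝ} (hx : 0 < x) : Differentiable ℂ (contNum Ψ x) := by
  have h1 := hΨ x hx
  have h2 := hΨ (2 * x) (by linarith)
  unfold contNum
  fun_prop

include heq in
theorem contNum_real {x : ℝ} (hx : 0 < x) {s : ℝ} (hs : 1 < s) :
    contNum Ψ x s = a s * contDet x s := by
  rw [contNum, contDet]
  linear_combination -Complex.sinh ((2 * x : ℝ) * (1 - s)) * heq x hx s hs +
    Complex.sinh (x * (1 - s)) * heq (2 * x) (by linarith) s hs

include hΨ heq in
-- For real `s > 1` both Cramer quotients equal `a s`. The identity theorem is applied to the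
-- cross-multiplied form, in which both sides are entire.
theorem contNum_mul_contDet {x y : ℝ} (hx : 0 < x) (hy : 0 < y) (s : ℂ) :
    contNum Ψ x s * contDet y s = contNum Ψ y s * contDet x s := by
  refine eqOn_of_eventually_real_eq isOpen_univ isPreconnected_univ
    (f := fun s => contNum Ψ x s * contDet y s) (g := fun s => contNum Ψ y s * contDet x s)
    (((differentiable_contNum hΨ hx).mul (differentiable_contDet y)).differentiableOn)
    (((differentiable_contNum hΨ hy).mul (differentiable_contDet x)).differentiableOn)
    (x := 2) (mem_univ _) ?_ (mem_univ s)
  filter_upwards [mem_nhdsWithin_of_mem_nhds (lt_mem_nhds (show (1 : ℝ) < 2 by norm_num))] with r hr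
  rw [contNum_real heq hx hr, contNum_real heq hy hr]
  ring

include hΨ heq in
theorem contFun_eq {x : ℝ} (hx : 0 < x) {s : ℂ} (hxs : x * (‖s‖ + 1) < 2) (h0 : s ≠ 0)
    (h1 : s ≠ 1) (h2 : s ≠ 1 / 2) : contFun Ψ s = contNum Ψ x s / contDet x s := by
  have hp : 0 < ‖s‖ + 1 := by positivity
  have hy : 0 < 1 / (‖s‖ + 1) := by positivity
  rw [contFun, div_eq_div_iff (contDet_ne_zero hy ?_ h0 h1 h2) (contDet_ne_zero hx hxs h0 h1 h2)]
  · exact contNum_mul_contDet hΨ heq hy hx s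
  · rw [one_div_mul_cancel hp.ne']
    norm_num

theorem exists_pos_mul_lt_near (s : ℂ) :
    ∃ x : ℝ, 0 < x ∧ ∀ᶠ t in 𝓝 s, x * (‖t‖ + 1) < 2 := by
  have hp : 0 < ‖s‖ + 1 := by positivity
  refine ⟨1 / (‖s‖ + 1), by positivity, ?_⟩
  have hc : Continuous fun t : ℂ => 1 / (‖s‖ + 1) * (‖t‖ + 1) := by fun_prop
  exact hc.continuousAt.eventually_lt_const (by beta_reduce; rw [one_div_mul_cancel hp.ne']; norm_num)

include hΨ heq in
theorem differentiableAt_contFun {s : ℂ} (h0 : s ≠ 0) (h1 : s ≠ 1) (h2 : s ≠ 1 / 2) :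
    DifferentiableAt ℂ (contFun Ψ) s := by
  obtain ⟨x, hx, hxs⟩ := exists_pos_mul_lt_near s
  have hd : DifferentiableAt ℂ (fun t => contNum Ψ x t / contDet x t) s :=
    (differentiable_contNum hΨ hx s).div (differentiable_contDet x s)
      (contDet_ne_zero hx hxs.self_of_nhds h0 h1 h2)
  refine hd.congr_of_eventuallyEq ?_
  filter_upwards [hxs, eventually_ne_nhds h0, eventually_ne_nhds h1, eventually_ne_nhds h2]
    with t ht g0 g1 g2
  exact contFun_eq hΨ heq hx ht g0 g1 g2

include hΨ heq ha in
theorem contFun_eq_of_half_lt_re {s : ℂ} (hs : 1 / 2 < s.re) (h1 : s ≠ 1) :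
    contFun Ψ s = a s := by
  obtain ⟨x, hx, hxs⟩ := exists_pos_mul_lt_near s
  have h0 : s ≠ 0 := by
    rintro rfl
    norm_num at hs
  have h2 : s ≠ 1 / 2 := by
    rintro rfl
    norm_num at hs
  rw [contFun_eq hΨ heq hx hxs.self_of_nhds h0 h1 h2,
    div_eq_iff (contDet_ne_zero hx hxs.self_of_nhds h0 h1 h2)]
  refine eqOn_of_eventually_real_eq (U := {s | 1 / 2 < s.re})
    (isOpen_lt continuous_const Complex.continuous_re)
    (convex_halfSpace_re_gt _).isPreconnected (differentiable_contNum hΨ hx).differentiableOn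
    (ha.mul (differentiable_contDet x).differentiableOn) (x := 2) (by norm_num) ?_ hs
  filter_upwards [mem_nhdsWithin_of_mem_nhds (lt_mem_nhds (show (1 : ℝ) < 2 by norm_num))] with r hr
  exact contNum_real heq hx hr

include hΨ heq in
-- At 0 the determinant vanishes only through the factor `sinh(x s)`, to first order, so the
-- continuation has at most a simple pole there.
theorem exists_tendsto_mul_contFun : ∃ c, Tendsto (fun s => s * contFun Ψ s) (𝓝[≠] 0) (𝓝 c) := by
  obtain ⟨x, hx, hxs⟩ := exists_pos_mul_lt_near 0
  have hx0 : (x : ℂ) ≠ 0 := by exact_mod_cast hx.ne'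
  set D : ℂ → ℂ := fun s => 4 * Complex.sinh (x * (1 - s)) *
      (Complex.sinh (x / 2) * Complex.sinh (x * (1 - 2 * s) / 2)) with hD
  have hDc : Continuous D := by
    rw [hD]
    fun_prop
  have hD0 : D 0 ≠ 0 := contDet_factor_ne_zero hx hxs.self_of_nhds (by norm_num) (by norm_num)
  have hsl : Tendsto (fun s : ℂ => s⁻¹ * Complex.sinh (x * s)) (𝓝[≠] 0) (𝓝 x) := by
    have h := ((Complex.hasDerivAt_sinh (x * 0)).comp (0 : ℂ) ((hasDerivAt_id (0 : ℂ)).const_mul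
      (x : ℂ)))
    have := h.tendsto_slope_zero
    simpa using this
  refine ⟨_, (((hsl.inv₀ hx0).mul
    (((differentiable_contNum hΨ hx).continuous.tendsto 0).mono_left nhdsWithin_le_nhds)).mul
    ((hDc.tendsto 0).mono_left nhdsWithin_le_nhds |>.inv₀ hD0)).congr' ?_⟩
  filter_upwards [mem_nhdsWithin_of_mem_nhds hxs, self_mem_nhdsWithin,
    mem_nhdsWithin_of_mem_nhds (eventually_ne_nhds (show (0 : ℂ) ≠ 1 by norm_num)),
    mem_nhdsWithin_of_mem_nhds (eventually_ne_nhds (show (0 : ℂ) ≠ 1 / 2 by norm_num))]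
    with s hs h0 h1 h2
  rw [contFun_eq hΨ heq hx hs h0 h1 h2, contDet_eq, mul_inv, inv_inv, div_eq_mul_inv, mul_inv]
  ring

include hΨ heq hsym ha in
-- Under `s ↦ 1 - s` the two coefficients `sinh(x s)` and `sinh(x (1 - s))` change places while `Ψ`
-- stays. Cramer's rule for the first unknown at `1 - s` is thus Cramer's rule for the second
-- unknown `a (s - 1/2)` at `s`. The complement of the four excluded points is connected, so the
-- identity extends from real `s`.
theorem contFun_one_sub {s : ℂ} (h0 : s ≠ 0) (h1 : s ≠ 1) (h2 : s ≠ 1 / 2) (h3 : s ≠ 3 / 2) :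
    contFun Ψ (1 - s) = contFun Ψ (s - 1 / 2) := by
  set U : Set ℂ := ({0, 1, 1 / 2, 3 / 2} : Set ℂ)ᶜ with hUdef
  have hfin : ({0, 1, 1 / 2, 3 / 2} : Set ℂ).Finite := by simp
  have hU : IsOpen U := hfin.isClosed.isOpen_compl
  have hmem : ∀ t, t ∈ U ↔ t ≠ 0 ∧ t ≠ 1 ∧ t ≠ 1 / 2 ∧ t ≠ 3 / 2 := fun t => by
    simp [hUdef]
  have hc : IsPreconnected U :=
    (hfin.countable.isConnected_compl_of_one_lt_rank (by simp)).isPreconnected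
  have hne : ∀ t ∈ U, 1 - t ≠ 0 ∧ 1 - t ≠ 1 ∧ 1 - t ≠ 1 / 2 ∧ t - 1 / 2 ≠ 0 ∧ t - 1 / 2 ≠ 1 ∧
      t - 1 / 2 ≠ 1 / 2 := fun t ht => by
    obtain ⟨h0, h1, h2, h3⟩ := (hmem t).1 ht
    refine ⟨fun h => h1 ?_, fun h => h0 ?_, fun h => h2 ?_, fun h => h2 ?_, fun h => h3 ?_,
      fun h => h1 ?_⟩
    · linear_combination -h
    · linear_combination -h
    · linear_combination -h
    · linear_combination h
    · linear_combination h
    · linear_combination h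
  refine eqOn_of_eventually_real_eq hU hc (f := fun s => contFun Ψ (1 - s))
    (g := fun s => contFun Ψ (s - 1 / 2)) (fun t ht => ?_) (fun t ht => ?_) (x := 2) ?_ ?_
    ((hmem s).2 ⟨h0, h1, h2, h3⟩)
  · obtain ⟨g1, g2, g3, -⟩ := hne t ht
    exact ((differentiableAt_contFun hΨ heq g1 g2 g3).comp t
      (by fun_prop : DifferentiableAt ℂ (fun t : ℂ => 1 - t) t)).differentiableWithinAt
  · obtain ⟨-, -, -, g1, g2, g3⟩ := hne t ht
    exact ((differentiableAt_contFun hΨ heq g1 g2 g3).comp t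
      (by fun_prop : DifferentiableAt ℂ (fun t : ℂ => t - 1 / 2) t)).differentiableWithinAt
  · refine (hmem _).2 ?_
    norm_num
  -- Beyond `3/2` the point `r - 1/2` exceeds 1: it lies in the half plane where the continuation is
  -- `a` and avoids the excluded point 1.
  · filter_upwards [mem_nhdsWithin_of_mem_nhds (lt_mem_nhds (show (3 / 2 : ℝ) < 2 by norm_num))]
      with r hr
    have hr1 : 1 < r := by linarith
    have hrc : (r : ℂ) - 1 / 2 = ((r - 1 / 2 : ℝ) : ℂ) := by push_cast; ring
    rw [contFun_eq_of_half_lt_re hΨ heq ha (s := (r : ℂ) - 1 / 2)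
      (by rw [hrc, Complex.ofReal_re]; linarith)
      (by rw [hrc]; norm_cast; intro h; linarith)]
    obtain ⟨x, hx, hxs⟩ := exists_pos_mul_lt_near (1 - r : ℂ)
    have hrU : (r : ℂ) ∈ U := by
      refine (hmem _).2 ⟨?_, ?_, ?_, ?_⟩
      · exact_mod_cast (by linarith : (0 : ℝ) < r).ne'
      · exact_mod_cast (by linarith : (1 : ℝ) < r).ne'
      · rw [show (1 / 2 : ℂ) = ((1 / 2 : ℝ) : ℂ) by push_cast; ring]
        exact_mod_cast (by linarith : (1 / 2 : ℝ) < r).ne'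
      · rw [show (3 / 2 : ℂ) = ((3 / 2 : ℝ) : ℂ) by push_cast; ring]
        exact_mod_cast hr.ne'
    obtain ⟨g1, g2, g3, -⟩ := hne _ hrU
    rw [contFun_eq hΨ heq hx hxs.self_of_nhds g1 g2 g3,
      div_eq_iff (contDet_ne_zero hx hxs.self_of_nhds g1 g2 g3), contNum, contDet, hsym x hx,
      hsym (2 * x) (by linarith), sub_sub_cancel]
    linear_combination -Complex.sinh ((2 * x : ℝ) * r) * heq x hx r hr1 +
      Complex.sinh (x * r) * heq (2 * x) (by linarith) r hr1

include hΨ heq hsym ha in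
-- The functional equation at `s = 0`. That point is excluded from `contFun_one_sub`, so both sides
-- are compared in the limit; `a` is continuous at 1.
theorem contFun_neg_half : contFun Ψ (-1 / 2) = a 1 := by
  have h1 : Tendsto (fun s : ℂ => contFun Ψ (s - 1 / 2)) (𝓝[≠] 0) (𝓝 (contFun Ψ (-1 / 2))) := by
    have h : ContinuousAt (contFun Ψ) (0 - 1 / 2) :=
      (differentiableAt_contFun hΨ heq (by norm_num) (by norm_num) (by norm_num)).continuousAt
    have h' : Tendsto (fun s : ℂ => s - 1 / 2) (𝓝 0) (𝓝 (0 - 1 / 2)) :=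
      Continuous.tendsto (by fun_prop) 0
    have := h.tendsto.comp h'
    rw [show (0 - 1 / 2 : ℂ) = -1 / 2 by norm_num] at this
    exact this.mono_left nhdsWithin_le_nhds
  have h2 : Tendsto (fun s : ℂ => a (1 - s)) (𝓝[≠] 0) (𝓝 (a 1)) := by
    have h : ContinuousAt a (1 - 0) :=
      (ha.differentiableAt ((isOpen_lt continuous_const Complex.continuous_re).mem_nhds
        (by norm_num))).continuousAt
    have h' : Tendsto (fun s : ℂ => 1 - s) (𝓝 0) (𝓝 (1 - 0)) := Continuous.tendsto (by fun_prop) 0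
    have := h.tendsto.comp h'
    rw [sub_zero] at this
    exact this.mono_left nhdsWithin_le_nhds
  refine tendsto_nhds_unique h1 (h2.congr' ?_)
  have hball : ∀ᶠ s : ℂ in 𝓝[≠] 0, 1 / 2 < (1 - s).re := by
    have hcont : Continuous fun s : ℂ => (1 - s).re :=
      Complex.continuous_re.comp (by fun_prop)
    exact mem_nhdsWithin_of_mem_nhds ((isOpen_lt continuous_const hcont).mem_nhds (by norm_num))
  filter_upwards [hball, self_mem_nhdsWithin,
    mem_nhdsWithin_of_mem_nhds (eventually_ne_nhds (show (0 : ℂ) ≠ 1 by norm_num)),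
    mem_nhdsWithin_of_mem_nhds (eventually_ne_nhds (show (0 : ℂ) ≠ 1 / 2 by norm_num)),
    mem_nhdsWithin_of_mem_nhds (eventually_ne_nhds (show (0 : ℂ) ≠ 3 / 2 by norm_num))]
    with s hs h0 h1 h2 h3
  rw [← contFun_one_sub hΨ hsym heq ha h0 h1 h2 h3, contFun_eq_of_half_lt_re hΨ heq ha hs]
  intro h
  exact h0 (by simpa using h)

end Continuation

/-! ### Continuation of the Dedekind zeta function -/

section ZetaContinuation

variable {F : Type*} [Field F] [NumberField F] [IsTotallyReal F]
variable (hF : NarrowClassNumberOne F)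
variable {n : ℕ} (hn : 0 < n) {v : Fin n → (F →+* ℝ)} (hv : Function.Bijective v)
variable {δ : 𝓞 F} (hδ : Ideal.span {δ} = differentIdeal ℤ (𝓞 F))

variable (n) in
/-- The point with all coordinates `i exp(x / n)`. -/
noncomputable def diagPoint (x : ℝ) : Fin n → ℂ := fun _ => Complex.I * (Real.exp (x / n) : ℝ)

theorem diagPoint_im (x : ℝ) (k : Fin n) : (diagPoint n x k).im = Real.exp (x / n) := by
  rw [diagPoint, Complex.I_mul_im, Complex.ofReal_re]

theorem diagPoint_mem (x : ℝ) : diagPoint n x ∈ upperHalfProd n := fun k => by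
  rw [diagPoint_im]
  exact Real.exp_pos _

include hn in
theorem prod_diagPoint_im (x : ℝ) : ∏ k, (diagPoint n x k).im = Real.exp x := by
  have : (n : ℝ) ≠ 0 := by exact_mod_cast hn.ne'
  simp only [diagPoint_im, Finset.prod_const, Finset.card_univ, Fintype.card_fin]
  rw [← Real.exp_nat_mul, mul_div_cancel₀ _ this]

variable (F) in
/-- The inversion `z ↦ -1 / z`. -/
def inversion : Matrix.SpecialLinearGroup (Fin 2) (𝓞 F) :=
  ⟨!![0, -1; 1, 0], by simp [Matrix.det_fin_two]⟩

theorem moebius_inversion_diagPoint (x : ℝ) :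
    moebius v (inversion F) (diagPoint n x) = diagPoint n (-x) := by
  funext k
  have h0 : v k ((0 : 𝓞 F) : F) = 0 := map_zero _
  have h1 : v k ((1 : 𝓞 F) : F) = 1 := map_one _
  have h2 : v k ((-1 : 𝓞 F) : F) = -1 := by
    rw [show ((-1 : 𝓞 F) : F) = -1 from rfl, map_neg, map_one]
  have hI := Complex.I_ne_zero
  have he : ((Real.exp (x / n) : ℝ) : ℂ) ≠ 0 := by exact_mod_cast (Real.exp_pos _).ne'
  simp only [moebius, inversion, diagPoint, Matrix.of_apply, Matrix.cons_val', Matrix.cons_val_zero,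
    Matrix.cons_val_one, Matrix.cons_val_fin_one, h0, h1, h2, neg_div, Real.exp_neg]
  push_cast at he ⊢
  field_simp
  linear_combination -Complex.exp (x / n) * Complex.I_mul_I

variable (v δ) in
/-- The odd part of the nonconstant terms along the diagonal. -/
noncomputable def diagOdd (x : ℝ) (s : ℂ) : ℂ :=
  (phiSum hF v δ s (diagPoint n x) - phiSum hF v δ s (diagPoint n (-x))) / 2

include hv hδ in
theorem differentiable_diagOdd (x : ℝ) : Differentiable ℂ (diagOdd hF v δ x) :=
  ((differentiable_phiSum hF hv (delta_ne_zero hδ) (diagPoint_mem x)).sub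
    (differentiable_phiSum hF hv (delta_ne_zero hδ) (diagPoint_mem (-x)))).div_const 2

include hv in
theorem diagOdd_one_sub (x : ℝ) (s : ℂ) : diagOdd hF v δ x (1 - s) = diagOdd hF v δ x s := by
  rw [diagOdd, diagOdd, phiSum_one_sub hF hv, phiSum_one_sub hF hv]

theorem ofReal_exp_cpow (x : ℝ) (s : ℂ) : ((Real.exp x : ℝ) : ℂ) ^ s = Complex.exp (x * s) := by
  rw [Complex.cpow_def_of_ne_zero (by exact_mod_cast (Real.exp_pos x).ne'), ← Complex.ofReal_log
    (Real.exp_pos x).le, Real.log_exp]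

include hn hv hδ in
-- Invariance under the inversion compares the points with `Y = e^x` and `Y = e^{-x}`. The
-- difference of the two expansions turns powers of `Y` into `sinh`.
theorem diag_equation (x : ℝ) {s : ℝ} (hs : 1 < s) :
    Complex.sinh (x * s) * complZeta F n s +
      Complex.sinh (x * (1 - s)) * complZeta F n (s - 1 / 2) + diagOdd hF v δ x s = 0 := by
  have h := eisenstein_invariant hF hv hδ (diagPoint_mem x) hs (inversion F)
  rw [moebius_inversion_diagPoint, prod_diagPoint_im hn, prod_diagPoint_im hn] at h
  simp only [ofReal_exp_cpow] at h
  rw [diagOdd, Complex.sinh, Complex.sinh, ← neg_mul, ← neg_mul]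
  push_cast at h
  linear_combination -h / 2

include hv in
theorem differentiableOn_complZeta : DifferentiableOn ℂ (complZeta F n) {s | 1 / 2 < s.re} := by
  have hq : (normConst F n : ℂ) ≠ 0 := by exact_mod_cast (normConst_pos (F := F) hv).ne'
  refine DifferentiableOn.mul (DifferentiableOn.mul ?_ (DifferentiableOn.pow ?_ n)) ?_
  · exact fun s _ => (DifferentiableAt.const_cpow differentiableAt_id
      (Or.inl hq)).differentiableWithinAt
  · intro s hs
    refine (Complex.differentiableAt_Gamma s fun m hm => ?_).differentiableWithinAt
    have h1 : (1 / 2 : ℝ) < s.re := hs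
    rw [hm, Complex.neg_re, Complex.natCast_re] at h1
    linarith [Nat.cast_nonneg (α := ℝ) m]
  · refine differentiableOn_dedekindZeta.comp (f := fun s : ℂ => 2 * s)
      (by fun_prop) fun s hs => ?_
    have h1 : (1 / 2 : ℝ) < s.re := hs
    change 1 < (2 * s).re
    have h2 : (2 * s).re = 2 * s.re := by simp
    rw [h2]
    linarith

variable (v δ) in
/-- The continuation of the Dedekind zeta function away from `0`, `1` and `2`. -/
noncomputable def zetaAux (w : ℂ) : ℂ :=
  contFun (diagOdd hF v δ) (w / 2) * (normConst F n : ℂ) ^ (-(w / 2)) * (Complex.Gamma (w / 2))⁻¹ ^ n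

include hn hv hδ in
theorem differentiableAt_zetaAux {w : ℂ} (h0 : w ≠ 0) (h1 : w ≠ 1) (h2 : w ≠ 2) :
    DifferentiableAt ℂ (zetaAux hF v δ) w := by
  have hq : (normConst F n : ℂ) ≠ 0 := by exact_mod_cast (normConst_pos (F := F) hv).ne'
  have hw : DifferentiableAt ℂ (fun w : ℂ => w / 2) w := by fun_prop
  refine DifferentiableAt.mul (DifferentiableAt.mul ?_ ?_) (DifferentiableAt.pow ?_ n)
  · refine (differentiableAt_contFun (a := complZeta F n)
      (fun x _ => differentiable_diagOdd hF hv hδ x)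
      (fun x _ s hs => diag_equation hF hn hv hδ x hs) ?_ ?_ ?_).comp w hw
    · exact div_ne_zero h0 two_ne_zero
    · exact fun h => h2 (by linear_combination 2 * h)
    · exact fun h => h1 (by linear_combination 2 * h)
  · exact DifferentiableAt.const_cpow hw.neg (Or.inl hq)
  · exact DifferentiableAt.comp (g := fun s : ℂ => (Complex.Gamma s)⁻¹) w
      (Complex.differentiable_one_div_Gamma (w / 2)) hw

include hn hv hδ in
theorem zetaAux_eq {w : ℂ} (h1 : 1 < w.re) (h2 : w ≠ 2) : zetaAux hF v δ w = dedekindZeta F w := by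
  have hq : (normConst F n : ℂ) ≠ 0 := by exact_mod_cast (normConst_pos (F := F) hv).ne'
  have hre : (w / 2).re = w.re / 2 := by simp
  have hG : Complex.Gamma (w / 2) ≠ 0 := Complex.Gamma_ne_zero_of_re_pos (by rw [hre]; linarith)
  rw [zetaAux, contFun_eq_of_half_lt_re (a := complZeta F n)
      (fun x _ => differentiable_diagOdd hF hv hδ x)
      (fun x _ s hs => diag_equation hF hn hv hδ x hs) (differentiableOn_complZeta hv)
      (by rw [hre]; linarith) (fun h => h2 (by linear_combination 2 * h)), complZeta,
    mul_div_cancel₀ w two_ne_zero, Complex.cpow_neg, inv_pow]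
  have := Complex.cpow_ne_zero_iff_of_exponent_ne_zero (x := (normConst F n : ℂ)) (y := w / 2)
    (by rintro h; rw [h] at hre; simp at hre; linarith)
  have hq' := this.2 hq
  field_simp

include hn hv hδ in
-- The possible simple pole of the continuation at 0 is cancelled by one factor `1/Γ(w/2) = (w/2) /
-- Γ(w/2 + 1)`. There is such a factor because `n ≥ 1`.
theorem exists_tendsto_zetaAux : ∃ c, Tendsto (zetaAux hF v δ) (𝓝[≠] 0) (𝓝 c) := by
  have hq : (normConst F n : ℂ) ≠ 0 := by exact_mod_cast (normConst_pos (F := F) hv).ne'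
  obtain ⟨c, hc⟩ := exists_tendsto_mul_contFun (Ψ := diagOdd hF v δ) (a := complZeta F n)
      (fun x _ => differentiable_diagOdd hF hv hδ x)
      (fun x _ s hs => diag_equation hF hn hv hδ x hs)
  have hhalf : Tendsto (fun w : ℂ => w / 2) (𝓝[≠] 0) (𝓝[≠] 0) := by
    refine tendsto_nhdsWithin_of_tendsto_nhds_of_eventually_within _ ?_ ?_
    · have : Tendsto (fun w : ℂ => w / 2) (𝓝 0) (𝓝 (0 / 2)) := Continuous.tendsto (by fun_prop) 0
      rw [zero_div] at this
      exact this.mono_left nhdsWithin_le_nhds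
    · filter_upwards [self_mem_nhdsWithin] with w hw
      exact div_ne_zero hw two_ne_zero
  have hrest : Continuous fun s : ℂ => (normConst F n : ℂ) ^ (-s) * (Complex.Gamma (s + 1))⁻¹ *
      (Complex.Gamma s)⁻¹ ^ (n - 1) := by
    have h1 := Complex.differentiable_one_div_Gamma.continuous
    refine (Continuous.mul ?_ (h1.comp (by fun_prop : Continuous fun s : ℂ => s + 1))).mul
      (h1.pow _)
    exact continuous_iff_continuousAt.2 fun s => (DifferentiableAt.const_cpow
      (by fun_prop : DifferentiableAt ℂ (fun s : ℂ => -s) s) (Or.inl hq)).continuousAt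
  refine ⟨_, ((hc.mul ((hrest.tendsto 0).mono_left nhdsWithin_le_nhds)).comp hhalf).congr
    fun w => ?_⟩
  rw [Function.comp_apply, zetaAux]
  obtain ⟨m, rfl⟩ : ∃ m, n = m + 1 := ⟨n - 1, by omega⟩
  rw [Nat.add_sub_cancel, pow_succ,
    Complex.one_div_Gamma_eq_self_mul_one_div_Gamma_add_one (w / 2)]
  ring

open Classical in
variable (v δ) in
/-- The continuation of the Dedekind zeta function. -/
noncomputable def zetaCont (w : ℂ) : ℂ :=
  if 1 < w.re then dedekindZeta F w else if w = 0 then limUnder (𝓝[≠] 0) (zetaAux hF v δ)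
  else zetaAux hF v δ w

include hn hv hδ in
theorem zetaCont_eq_zetaAux {w : ℂ} (h0 : w ≠ 0) (h2 : w ≠ 2) :
    zetaCont hF v δ w = zetaAux hF v δ w := by
  rw [zetaCont, if_neg h0]
  split_ifs with h
  · exact (zetaAux_eq hF hn hv hδ h h2).symm
  · rfl

include hn hv hδ in
theorem isZetaContinuation_zetaCont : IsZetaContinuation F (zetaCont hF v δ) := by
  have hopen : IsOpen {s : ℂ | 1 < s.re} := isOpen_lt continuous_const Complex.continuous_re
  refine ⟨fun w hw1 => DifferentiableAt.differentiableWithinAt ?_, fun w hw => if_pos hw⟩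
  have hw1 : w ≠ 1 := hw1
  -- Of the points `0, 1, 2` left out by `zetaAux`, the point 2 lies in the half plane of
  -- convergence, 0 is a removable singularity, and 1 is the genuine exception.
  by_cases hre : 1 < w.re
  · refine ((differentiableOn_dedekindZeta (F := F)).differentiableAt (hopen.mem_nhds hre)).congr_of_eventuallyEq
      ?_
    filter_upwards [hopen.mem_nhds hre] with t ht
    exact if_pos ht
  have h2 : w ≠ 2 := by
    rintro rfl
    norm_num at hre
  by_cases h0 : w = 0
  · subst h0
    refine (Complex.analyticAt_of_differentiable_on_punctured_nhds_of_continuousAt ?_ ?_).differentiableAt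
    · filter_upwards [self_mem_nhdsWithin,
        mem_nhdsWithin_of_mem_nhds (eventually_ne_nhds (show (0 : ℂ) ≠ 1 by norm_num)),
        mem_nhdsWithin_of_mem_nhds (eventually_ne_nhds (show (0 : ℂ) ≠ 2 by norm_num))]
        with t g0 g1 g2
      refine (differentiableAt_zetaAux hF hn hv hδ g0 g1 g2).congr_of_eventuallyEq ?_
      filter_upwards [eventually_ne_nhds g0, eventually_ne_nhds g2] with u hu0 hu2
      exact zetaCont_eq_zetaAux hF hn hv hδ hu0 hu2
    · rw [continuousAt_iff_punctured_nhds]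
      have h := (exists_tendsto_zetaAux hF hn hv hδ)
      have h' := tendsto_nhds_limUnder h
      rw [zetaCont, if_neg hre, if_pos rfl]
      refine h'.congr' ?_
      filter_upwards [self_mem_nhdsWithin,
        mem_nhdsWithin_of_mem_nhds (eventually_ne_nhds (show (0 : ℂ) ≠ 2 by norm_num))] with u h0 h2
      exact (zetaCont_eq_zetaAux hF hn hv hδ h0 h2).symm
  · refine (differentiableAt_zetaAux hF hn hv hδ h0 hw1 h2).congr_of_eventuallyEq ?_
    filter_upwards [eventually_ne_nhds h0, eventually_ne_nhds h2] with u hu0 hu2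
    exact zetaCont_eq_zetaAux hF hn hv hδ hu0 hu2

include hF hn hv hδ in
/-- The functional equation, in the form of the value at `-1`. -/
theorem zetaF_neg_one : (-4 * Real.pi) ^ n * zetaF F (-1) / (Real.sqrt (discr F) : ℂ) =
    2 ^ n * complZeta F n 1 := by
  have hq := normConst_pos (F := F) hv
  have hD := discr_pos hv
  have hpi := Real.pi_pos
  -- The value at `w = -1` uses the continuation at `w/2 = -1/2`, which equals `Λ(1)`. There remain
  -- `Γ(-1/2) = -2√π` and `q^{1/2}`.
  rw [zetaF_eq F (isZetaContinuation_zetaCont hF hn hv hδ) (by norm_num),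
    zetaCont_eq_zetaAux hF hn hv hδ (by norm_num) (by norm_num), zetaAux,
    contFun_neg_half (a := complZeta F n)
      (fun x _ => differentiable_diagOdd hF hv hδ x) (fun x _ s => diagOdd_one_sub hF hv x s)
      (fun x _ s hs => diag_equation hF hn hv hδ x hs) (differentiableOn_complZeta hv)]
  have hG : Complex.Gamma (-1 / 2) = ((-2 * Real.sqrt Real.pi : ℝ) : ℂ) := by
    have h1 : Real.Gamma (-1 / 2) = -2 * Real.sqrt Real.pi := by
      have := Real.Gamma_add_one (s := -1 / 2) (by norm_num)
      rw [show (-1 / 2 + 1 : ℝ) = 1 / 2 by norm_num, Real.Gamma_one_half_eq] at this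
      linarith
    rw [← h1, ← Complex.Gamma_ofReal]
    push_cast
    rfl
  have hqc : (normConst F n : ℂ) ^ (-(-1 / 2) : ℂ) =
      ((Real.sqrt (discr F) / Real.sqrt Real.pi ^ n : ℝ) : ℂ) := by
    have h1 : Real.sqrt Real.pi ^ n = Real.sqrt (Real.pi ^ n) := by
      rw [Real.sqrt_eq_rpow, Real.sqrt_eq_rpow, ← Real.rpow_natCast, ← Real.rpow_mul hpi.le,
        mul_comm, Real.rpow_mul hpi.le, Real.rpow_natCast]
    rw [h1, ← Real.sqrt_div hD.le, Real.sqrt_eq_rpow, ← normConst, Complex.ofReal_cpow hq.le]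
    push_cast
    norm_num
  rw [hG, hqc]
  have hs1 : (Real.sqrt (discr F) : ℂ) ≠ 0 := by exact_mod_cast (Real.sqrt_pos.2 hD).ne'
  have hs2 : (Real.sqrt Real.pi : ℂ) ≠ 0 := by exact_mod_cast (Real.sqrt_pos.2 hpi).ne'
  have hs3 : (Real.sqrt Real.pi : ℂ) * Real.sqrt Real.pi = Real.pi := by
    exact_mod_cast Real.mul_self_sqrt hpi.le
  push_cast
  have h4 : (-4 * (Real.pi : ℂ)) ^ n =
      2 ^ n * (-2 * (Real.sqrt Real.pi : ℂ)) ^ n * (Real.sqrt Real.pi : ℂ) ^ n := by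
    rw [← mul_pow, ← mul_pow, ← hs3]
    ring
  have hs4 : (-2 * (Real.sqrt Real.pi : ℂ)) ^ n ≠ 0 :=
    pow_ne_zero _ (mul_ne_zero (by norm_num) hs2)
  rw [h4, inv_pow]
  field_simp

end ZetaContinuation

/-! ### The limit at `s = 1` -/

section LimitFormula

variable {F : Type*} [Field F] [NumberField F] [IsTotallyReal F]
variable (hF : NarrowClassNumberOne F)
variable {n : ℕ} (hn : 0 < n) {v : Fin n → (F →+* ℝ)} (hv : Function.Bijective v)
variable {δ : 𝓞 F} (hδ : Ideal.span {δ} = differentIdeal ℤ (𝓞 F))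
variable {z : Fin n → ℂ} (hz : z ∈ upperHalfProd n)

/-- A root of unity has absolute value 1 under a real embedding, hence is `±1`. -/
theorem torsionOrder_eq_two_of_real_embedding (φ : F →+* ℝ) : Units.torsionOrder F = 2 := by
  classical
  let := Fintype.ofFinite (Units.torsion F)
  have hneg : (-1 : (𝓞 F)ˣ) ∈ Units.torsion F := by
    rw [Units.torsion, CommGroup.mem_torsion, isOfFinOrder_iff_pow_eq_one]
    exact ⟨2, two_pos, by simp⟩
  have hne : (1 : (𝓞 F)ˣ) ≠ -1 := by
    intro h
    have h1 : ((1 : (𝓞 F)ˣ) : 𝓞 F) = ((-1 : (𝓞 F)ˣ) : 𝓞 F) := by rw [← h]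
    rw [Units.val_neg, Units.val_one] at h1
    have h2 : (2 : 𝓞 F) = 0 := by linear_combination h1
    exact two_ne_zero h2
  rw [Units.torsionOrder, Nat.card_eq_fintype_card]
  refine (Finset.card_eq_two.2 ⟨1, ⟨-1, hneg⟩, fun h => hne (congrArg Subtype.val h),
    Finset.ext fun x => ⟨fun _ => ?_, fun _ => Finset.mem_univ _⟩⟩)
  rw [Finset.mem_insert, Finset.mem_singleton, ← Subtype.val_inj, ← Subtype.val_inj]
  obtain ⟨m, hm, hx⟩ := isOfFinOrder_iff_pow_eq_one.1 ((CommGroup.mem_torsion x.1).1 x.2)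
  have hpow : (φ ((x.1 : 𝓞 F) : F)) ^ m = 1 := by
    rw [← map_pow, ← map_one φ]
    congr 1
    have := congrArg (fun u : (𝓞 F)ˣ => ((u : 𝓞 F) : F)) hx
    simpa using this
  have habs : |φ ((x.1 : 𝓞 F) : F)| = 1 := by
    have : |φ ((x.1 : 𝓞 F) : F)| ^ m = 1 := by rw [← abs_pow, hpow, abs_one]
    exact (pow_eq_one_iff_of_nonneg (abs_nonneg _) hm.ne').1 this
  rcases eq_or_eq_neg_of_abs_eq habs with h | h
  · left
    refine Units.ext (RingOfIntegers.coe_injective (φ.injective ?_))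
    rw [h]
    simp
  · right
    refine Units.ext (RingOfIntegers.coe_injective (φ.injective ?_))
    rw [h]
    simp

include hF in
theorem classNumber_eq_one_of_narrow : classNumber F = 1 := by
  rw [classNumber_eq_one_iff]
  refine ⟨fun I => ?_⟩
  by_cases hI : I = ⊥
  · rw [hI]
    infer_instance
  · obtain ⟨a, -, ha⟩ := hF I hI
    exact ⟨a, ha⟩

include hF hn hv in
-- The class number formula with no complex places, class number 1 and two roots of unity.
theorem dedekindZeta_residue_eq : dedekindZeta_residue F =
    2 ^ n * Units.regulator F / (2 * Real.sqrt (discr F)) := by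
  rw [dedekindZeta_residue_def, IsTotallyReal.nrComplexPlaces_eq_zero, ← IsTotallyReal.finrank,
    finrank_eq hv, classNumber_eq_one_of_narrow hF,
    torsionOrder_eq_two_of_real_embedding (v ⟨0, hn⟩), abs_of_pos (discr_pos hv)]
  push_cast
  ring

include hF hn hv in
-- `Λ(s - 1/2)` contains `ζ_F(2s - 1)`, whose argument approaches 1 twice as fast as `s`; this
-- halves the residue. The Gamma factors and `q^{1/2}` contribute exactly `√d_F`, which cancels the
-- one in the residue.
theorem tendsto_mul_complZeta :
    Tendsto (fun s : ℝ => ((s : ℂ) - 1) * complZeta F n (s - 1 / 2)) (𝓝[>] 1)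
      (𝓝 ((2 ^ n * Units.regulator F / 4 : ℝ) : ℂ)) := by
  have hq := normConst_pos (F := F) hv
  have hqc : (normConst F n : ℂ) ≠ 0 := by exact_mod_cast hq.ne'
  have hD := discr_pos hv
  have hpi := Real.pi_pos
  have h2 : Tendsto (fun s : ℝ => 2 * s - 1) (𝓝[>] 1) (𝓝[>] 1) := by
    refine tendsto_nhdsWithin_of_tendsto_nhds_of_eventually_within _ ?_ ?_
    · have : Tendsto (fun s : ℝ => 2 * s - 1) (𝓝 1) (𝓝 (2 * 1 - 1)) :=
        Continuous.tendsto (by fun_prop) 1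
      rw [show (2 * 1 - 1 : ℝ) = 1 by norm_num] at this
      exact this.mono_left nhdsWithin_le_nhds
    · filter_upwards [self_mem_nhdsWithin] with s hs
      have : (1 : ℝ) < s := hs
      change 1 < 2 * s - 1
      linarith
  have hres := (tendsto_sub_one_mul_dedekindZeta_nhdsGT F).comp h2
  have hc : Tendsto (fun s : ℝ => (normConst F n : ℂ) ^ ((s : ℂ) - 1 / 2) *
      Complex.Gamma ((s : ℂ) - 1 / 2) ^ n) (𝓝[>] 1) (𝓝 ((normConst F n : ℂ) ^ (((1 : ℝ) : ℂ) - 1 / 2) *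
      Complex.Gamma (((1 : ℝ) : ℂ) - 1 / 2) ^ n)) := by
    have hs : ContinuousAt (fun s : ℝ => (s : ℂ) - 1 / 2) 1 := by fun_prop
    refine ContinuousAt.tendsto (ContinuousAt.mul (f := fun s : ℝ => (normConst F n : ℂ) ^
      ((s : ℂ) - 1 / 2)) ?_ (ContinuousAt.pow ?_ n)) |>.mono_left nhdsWithin_le_nhds
    · exact hs.const_cpow (Or.inl hqc)
    · refine ContinuousAt.comp (g := Complex.Gamma) (f := fun s : ℝ => (s : ℂ) - 1 / 2) ?_ hs
      refine (Complex.differentiableAt_Gamma _ fun m hm => ?_).continuousAt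
      have := congrArg Complex.re hm
      norm_num at this
      linarith [Nat.cast_nonneg (α := ℝ) m]
  refine ((hc.mul hres).mul_const (1 / 2)).congr' ?_ |>.trans_eq ?_
  · filter_upwards with s
    rw [complZeta, Function.comp_apply]
    push_cast
    rw [show 2 * ((s : ℂ) - 1 / 2) = 2 * s - 1 by ring]
    ring
  · congr 1
    rw [show ((1 : ℝ) : ℂ) - 1 / 2 = ((1 / 2 : ℝ) : ℂ) by push_cast; ring, Complex.Gamma_ofReal,
      Real.Gamma_one_half_eq, ← Complex.ofReal_cpow hq.le, ← Real.sqrt_eq_rpow,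
      dedekindZeta_residue_eq hF hn hv]
    have h1 : Real.sqrt Real.pi ^ n = Real.sqrt (Real.pi ^ n) := by
      rw [Real.sqrt_eq_rpow, Real.sqrt_eq_rpow, ← Real.rpow_natCast, ← Real.rpow_mul hpi.le,
        mul_comm, Real.rpow_mul hpi.le, Real.rpow_natCast]
    rw [normConst, Real.sqrt_div hD.le, ← h1]
    have hs1 := Real.sqrt_pos.2 hD
    have hs2 := Real.sqrt_pos.2 hpi
    have h3 : Real.sqrt (discr F) / Real.sqrt Real.pi ^ n * Real.sqrt Real.pi ^ n *
        (2 ^ n * Units.regulator F / (2 * Real.sqrt (discr F))) * (1 / 2) =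
        2 ^ n * Units.regulator F / 4 := by
      field_simp
      norm_num
    rw [← h3]
    push_cast
    ring

/-- Both powers take the value 1 at `s = 1`, so the limit is a difference of derivatives. This is
the source of the logarithms in the limit formula. -/
theorem tendsto_cpow_sub_cpow_div {x y : ℝ} (hx : 0 < x) (hy : 0 < y) :
    Tendsto (fun s : ℝ => ((x : ℂ) ^ (1 - s : ℂ) - (y : ℂ) ^ (1 - s : ℂ)) / ((s : ℂ) - 1)) (𝓝[>] 1)
      (𝓝 (((Real.log y - Real.log x : ℝ)) : ℂ)) := by
  have hd : ∀ {x : ℝ}, 0 < x → HasDerivAt (fun s : ℝ => (x : ℂ) ^ (1 - s : ℂ)) (-Real.log x : ℂ) 1 := by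
    intro x hx
    have hxc : (x : ℂ) ≠ 0 := by exact_mod_cast hx.ne'
    have h1 : HasDerivAt (fun s : ℂ => (x : ℂ) ^ (1 - s)) (-Real.log x : ℂ) ((1 : ℝ) : ℂ) := by
      have := ((hasDerivAt_id (((1 : ℝ)) : ℂ)).const_sub 1).const_cpow (c := (x : ℂ)) (Or.inl hxc)
      simpa [Complex.ofReal_log hx.le] using this
    exact h1.comp_ofReal
  have h := (hd hx).sub (hd hy)
  rw [hasDerivAt_iff_tendsto_slope] at h
  have h2 := h.mono_left (nhdsWithin_mono (1 : ℝ) (fun s (hs : 1 < s) => hs.ne'))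
  refine (h2.congr fun s => ?_).trans_eq ?_
  · rw [slope_def_module]
    simp only [Pi.sub_apply, Complex.ofReal_one, sub_self, Complex.cpow_zero, sub_zero,
      Complex.real_smul]
    push_cast
    rw [div_eq_inv_mul]
  · congr 1
    push_cast
    ring

include hF hn hv hδ hz in
/-- The limit formula: invariance of the completed series at `s = 1`, after removing its pole. -/
theorem limit_invariant (M : Matrix.SpecialLinearGroup (Fin 2) (𝓞 F)) :
    (∏ k, (moebius v M z k).im : ℝ) * complZeta F n 1 + phiSum hF v δ 1 (moebius v M z) -
        ((2 ^ n * Units.regulator F / 4 * Real.log (∏ k, (moebius v M z k).im) : ℝ) : ℂ) =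
      (∏ k, (z k).im : ℝ) * complZeta F n 1 + phiSum hF v δ 1 z -
        ((2 ^ n * Units.regulator F / 4 * Real.log (∏ k, (z k).im) : ℝ) : ℂ) := by
  have hz' := moebius_mem (v := v) hz M
  set z' := moebius v M z with hz'def
  set Y := ∏ k, (z k).im
  set Y' := ∏ k, (z' k).im
  have hY : 0 < Y := Finset.prod_pos fun k _ => hz k
  have hY' : 0 < Y' := Finset.prod_pos fun k _ => hz' k
  have hle : 𝓝[>] (1 : ℝ) ≤ 𝓝 1 := nhdsWithin_le_nhds
  have hcast : Tendsto (fun s : ℝ => (s : ℂ)) (𝓝[>] 1) (𝓝 1) := by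
    have := (Complex.continuous_ofReal.tendsto 1).mono_left hle
    rwa [Complex.ofReal_one] at this
  have ha : Tendsto (fun s : ℝ => complZeta F n s) (𝓝[>] 1) (𝓝 (complZeta F n 1)) :=
    ((differentiableOn_complZeta (n := n) hv).differentiableAt
      ((isOpen_lt continuous_const Complex.continuous_re).mem_nhds
        (by norm_num : (1 : ℂ) ∈ {s : ℂ | 1 / 2 < s.re}))).continuousAt.tendsto.comp hcast
  have hpow : ∀ {y : ℝ}, 0 < y → Tendsto (fun s : ℝ => (y : ℂ) ^ (s : ℂ)) (𝓝[>] 1) (𝓝 y) := by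
    intro y hy
    have hyc : (y : ℂ) ≠ 0 := by exact_mod_cast hy.ne'
    have h := ((continuousAt_id (x := (1 : ℂ))).const_cpow (b := (y : ℂ)) (Or.inl hyc)).tendsto.comp
      hcast
    simpa [Function.comp_def] using h
  have hphi : ∀ {w : Fin n → ℂ}, w ∈ upperHalfProd n →
      Tendsto (fun s : ℝ => phiSum hF v δ s w) (𝓝[>] 1) (𝓝 (phiSum hF v δ 1 w)) := fun hw =>
    ((differentiable_phiSum hF hv (delta_ne_zero hδ) hw).continuous.tendsto 1).comp hcast
  -- The poles at the two points cancel: `(Y'^{1-s} - Y^{1-s}) Λ(s - 1/2)` is a difference quotient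
  -- times `(s - 1) Λ(s - 1/2)`, and both have limits.
  have hlim := ((((hpow hY').sub (hpow hY)).mul ha).add
    ((tendsto_cpow_sub_cpow_div hY' hY).mul (tendsto_mul_complZeta hF hn hv))).add
    ((hphi hz').sub (hphi hz))
  have h0 := tendsto_nhds_unique (hlim.congr' (f₂ := fun _ => (0 : ℂ)) ?_) tendsto_const_nhds
  · push_cast at h0 ⊢
    linear_combination h0
  · filter_upwards [self_mem_nhdsWithin] with s hs
    have hs1 : (1 : ℝ) < s := hs
    have hinv := eisenstein_invariant hF hv hδ hz hs1 M
    have hne : (s : ℂ) - 1 ≠ 0 := by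
      rw [sub_ne_zero]
      exact_mod_cast hs1.ne'
    rw [← mul_assoc, div_mul_cancel₀ _ hne]
    linear_combination hinv

end LimitFormula

/-! ### Divisor sums -/

section Divisors

variable {F : Type*} [Field F] [NumberField F]

theorem finite_divisors {μ : 𝓞 F} (hμ : μ ≠ 0) : Finite {I : Ideal (𝓞 F) // I ∣ Ideal.span {μ}} := by
  have := UniqueFactorizationMonoid.fintypeSubtypeDvd (Ideal.span {μ}) (by simpa using hμ)
  infer_instance

theorem hasSum_sigma {μ : 𝓞 F} (hμ : μ ≠ 0) (k : ℤ) :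
    HasSum (fun I : {I : Ideal (𝓞 F) // I ∣ Ideal.span {μ}} => (Ideal.absNorm I.1 : ℂ) ^ k)
      (sigma k μ) := by
  have := finite_divisors hμ
  have hfin : (Function.support fun I : {I : Ideal (𝓞 F) // I ∣ Ideal.span {μ}} =>
      (Ideal.absNorm I.1 : ℂ) ^ k).Finite := Set.toFinite _
  rw [sigma, ← tsum_eq_finsum (L := SummationFilter.unconditional _) hfin]
  exact (summable_of_hasFiniteSupport hfin).hasSum

theorem divisor_ne_bot {μ : 𝓞 F} (hμ : μ ≠ 0) {I : Ideal (𝓞 F)} (hI : I ∣ Ideal.span {μ}) :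
    I ≠ ⊥ := by
  rintro rfl
  exact hμ (by simpa using zero_dvd_iff.1 hI)

/-- Replacing a divisor by its complementary divisor is an involution, and the two norms multiply to
the norm of `(μ)`. -/
theorem sigma_one_eq {μ : 𝓞 F} (hμ : μ ≠ 0) :
    sigma 1 μ = sigma (-1) μ * (Ideal.absNorm (Ideal.span {μ}) : ℂ) := by
  let f : {I : Ideal (𝓞 F) // I ∣ Ideal.span {μ}} → {I : Ideal (𝓞 F) // I ∣ Ideal.span {μ}} :=
    fun I => ⟨I.2.choose, Dvd.intro_left _ I.2.choose_spec.symm⟩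
  have hf : ∀ I, Ideal.span {μ} = I.1 * (f I).1 := fun I => I.2.choose_spec
  have hinv : Function.Involutive f := fun I => by
    refine Subtype.ext (mul_right_cancel₀ (divisor_ne_bot hμ (f I).2) ?_)
    rw [← hf I, mul_comm, ← hf (f I)]
  rw [sigma, sigma, ← finsum_comp_equiv hinv.toPerm, finsum_mul' _ _
    (by have := finite_divisors hμ; exact Set.toFinite _)]
  refine finsum_congr fun I => ?_
  have h0 : (Ideal.absNorm I.1 : ℂ) ≠ 0 := by
    rw [Nat.cast_ne_zero, Ne, Ideal.absNorm_eq_zero_iff]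
    exact divisor_ne_bot hμ I.2
  have h1 : (Ideal.absNorm (Ideal.span {μ}) : ℂ) =
      Ideal.absNorm I.1 * Ideal.absNorm (f I).1 := by
    rw [congrArg Ideal.absNorm (hf I), map_mul, Nat.cast_mul]
  rw [zpow_one, Function.Involutive.coe_toPerm, h1, zpow_neg_one, inv_mul_cancel_left₀ h0]

theorem sigma_eq_of_span_eq {μ ν : 𝓞 F} (h : Ideal.span {μ} = Ideal.span {ν}) (k : ℤ) :
    sigma k μ = sigma k ν := by
  rw [sigma, sigma, h]

theorem sigma_unit_mul (u : (𝓞 F)ˣ) (μ : 𝓞 F) (k : ℤ) : sigma k ((u : 𝓞 F) * μ : 𝓞 F) = sigma k μ := by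
  refine sigma_eq_of_span_eq ?_ k
  rw [Ideal.span_singleton_eq_span_singleton]
  exact associated_unit_mul_left _ _ u.isUnit

end Divisors

/-! ### Regrouping pairs by their product: `h̃` as the value at `s = 1` -/

section Regroup

variable {F : Type*} [Field F] [NumberField F] [IsTotallyReal F]
variable (hF : NarrowClassNumberOne F)
variable {n : ℕ} (hn : 0 < n) {v : Fin n → (F →+* ℝ)} (hv : Function.Bijective v)
variable {δ : 𝓞 F} (hδ : Ideal.span {δ} = differentIdeal ℤ (𝓞 F))
variable {z : Fin n → ℂ} (hz : z ∈ upperHalfProd n)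

/-- The product of the two entries of a pair. -/
noncomputable def pairProd (x : PairIdx F) : {μ : 𝓞 F // μ ≠ 0} :=
  ⟨gen hF x.1 * x.2.1, mul_ne_zero (gen_ne_zero hF _) x.2.2⟩

/-- Pairs with product `μ` correspond to the divisors of `μ`. -/
noncomputable def fiberEquiv (μ : {μ : 𝓞 F // μ ≠ 0}) :
    (pairProd hF ⁻¹' {μ}) ≃ {I : Ideal (𝓞 F) // I ∣ Ideal.span {μ.1}} := by
  refine Equiv.ofBijective (fun x => ⟨x.1.1.1, ?_⟩) ⟨?_, ?_⟩
  · have hx : gen hF x.1.1 * x.1.2.1 = μ.1 := congrArg Subtype.val x.2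
    rw [← hx, ← Ideal.span_singleton_mul_span_singleton, span_gen]
    exact dvd_mul_right _ _
  · rintro ⟨⟨I, ν⟩, hx⟩ ⟨⟨J, ρ⟩, hy⟩ h
    have hIJ : I = J := Subtype.ext (congrArg Subtype.val h :)
    subst hIJ
    have hx' : gen hF I * ν.1 = μ.1 := congrArg Subtype.val hx
    have hy' : gen hF I * ρ.1 = μ.1 := congrArg Subtype.val hy
    have : ν = ρ := Subtype.ext (mul_left_cancel₀ (gen_ne_zero hF I) (hx'.trans hy'.symm))
    subst this
    rfl
  · rintro ⟨I, hI⟩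
    have hI0 := divisor_ne_bot μ.2 hI
    obtain ⟨ν, hν⟩ : gen hF ⟨I, hI0⟩ ∣ μ.1 := by
      rwa [← Ideal.mem_span_singleton, span_gen, ← Ideal.dvd_span_singleton]
    have hν0 : ν ≠ 0 := by
      rintro rfl
      exact μ.2 (by rw [hν, mul_zero])
    exact ⟨⟨(⟨I, hI0⟩, ⟨ν, hν0⟩), Subtype.ext hν.symm⟩, rfl⟩

theorem fiberEquiv_apply (μ : {μ : 𝓞 F // μ ≠ 0}) (x : pairProd hF ⁻¹' {μ}) :
    (fiberEquiv hF μ x).1 = x.1.1.1 := rfl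

/-- The pairs `(I, ν)` with `gen I · ν = μ` correspond to the ideals `I` dividing `(μ)`, so summing
over a fibre produces the divisor sum. -/
theorem hasSum_sigma_mul {f : 𝓞 F → ℂ} {S : ℂ}
    (h : HasSum (fun x : PairIdx F => (Ideal.absNorm x.1.1 : ℂ) ^ (-1 : ℤ) * f (gen hF x.1 * x.2.1)) S) :
    HasSum (fun μ : {μ : 𝓞 F // μ ≠ 0} => sigma (-1) μ.1 * f μ.1) S := by
  refine (h.tsum_fiberwise (pairProd hF)).congr_fun fun μ => ?_
  rw [← ((fiberEquiv hF μ).hasSum_iff.2 (hasSum_sigma μ.2 (-1))).tsum_eq, ← tsum_mul_right]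
  refine tsum_congr fun x => ?_
  rw [Function.comp_apply, fiberEquiv_apply]
  congr 2
  exact (congrArg Subtype.val x.2).symm

include hF hv in
theorem summable_sigma_exp {κ : Fin n → ℝ} (hκ : ∀ k, 0 < κ k) :
    Summable fun μ : {μ : 𝓞 F // μ ≠ 0} =>
      ‖sigma (-1) μ.1‖ * Real.exp (-∑ k, κ k * |v k μ.1|) := by
  have h1 : Summable fun x : PairIdx F => (Ideal.absNorm x.1.1 : ℂ) ^ (-1 : ℤ) *
      ((Real.exp (-∑ k, κ k * |v k (gen hF x.1 * x.2.1 : 𝓞 F)|) : ℝ) : ℂ) := by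
    refine Summable.of_norm_bounded (summable_pair_exp hF hv hκ) fun x => ?_
    rw [norm_mul, Complex.norm_real, Real.norm_of_nonneg (Real.exp_pos _).le, zpow_neg_one, norm_inv,
      Complex.norm_natCast]
    have : (1 : ℝ) ≤ Ideal.absNorm x.1.1 := by exact_mod_cast one_le_absNorm x.1
    exact mul_le_of_le_one_left (Real.exp_pos _).le (inv_le_one_of_one_le₀ this)
  refine (hasSum_sigma_mul hF (f := fun a : 𝓞 F =>
    ((Real.exp (-∑ k, κ k * |v k a|) : ℝ) : ℂ)) h1.hasSum).summable.norm.congr fun μ => ?_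
  rw [norm_mul, Complex.norm_real, Real.norm_of_nonneg (Real.exp_pos _).le]

variable (v δ) in
/-- The exponential attached to `μ` in `h̃`. -/
noncomputable def expTerm (μ : 𝓞 F) (z : Fin n → ℂ) : ℂ :=
  Complex.exp (2 * Complex.I * Real.pi *
        ∑ k, (((v k μ / v k δ * (z k).re : ℝ) : ℂ) +
          ((|v k μ / v k δ| : ℝ) : ℂ) * Complex.I * ((z k).im : ℂ)))

include hv hδ hz in
-- At `s = 1` the square roots from the elementary Bessel kernels, from `N(ν) / N(I)` and from `Y`
-- collapse to `√d_F / N(I)`. The remaining real exponentials combine with the phase to the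
-- exponential of `h̃`.
theorem phiTerm_one (x : PairIdx F) : (Real.sqrt (∏ k, (z k).im) : ℂ) * phiTerm hF v δ 1 z x =
    (Real.sqrt (discr F) : ℂ) * ((Ideal.absNorm x.1.1 : ℂ) ^ (-1 : ℤ) *
      expTerm v δ (gen hF x.1 * x.2.1) z) := by
  have hδ0 := delta_ne_zero hδ
  have hY : 0 < ∏ k, (z k).im := Finset.prod_pos fun k _ => hz k
  have hN : (0 : ℝ) < Ideal.absNorm x.1.1 := by exact_mod_cast absNorm_pos x.1
  have hD := discr_pos hv
  have hpi := Real.pi_pos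
  have hν : 0 < ∏ k, |v k x.2.1| := Finset.prod_pos fun k _ => abs_pos.2 (v_ne_zero x.2.2 k)
  rw [phiTerm, expTerm, Finset.prod_congr rfl fun k _ => besselK_one (phiArg_pos hF hδ0 hz x k),
    ← Complex.ofReal_prod, Finset.prod_mul_distrib, ← Real.exp_sum]
  have h1 : ∏ k, Real.sqrt (Real.pi / (Real.pi * |v k (gen hF x.1 * x.2.1 : 𝓞 F) / v k δ| * (z k).im)) =
      Real.sqrt (discr F / ((Ideal.absNorm x.1.1 * ∏ k, |v k x.2.1|) * ∏ k, (z k).im)) := by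
    simp only [Real.sqrt_eq_rpow]
    rw [Real.finsetProd_rpow _ _ (fun k _ => by have := phiArg_pos (v := v) hF hδ0 hz x k; positivity)]
    congr 1
    rw [← prod_abs_delta hv hδ, absNorm_eq_prod_gen hF hv, ← Finset.prod_mul_distrib,
      ← Finset.prod_mul_distrib, ← Finset.prod_div_distrib]
    refine Finset.prod_congr rfl fun k _ => ?_
    have e1 := hz k
    have e2 := abs_pos.2 (v_ne_zero (v := v) hδ0 k)
    have e3 := abs_pos.2 (v_ne_zero (v := v) x.2.2 k)
    have e4 := abs_pos.2 (v_ne_zero (v := v) (gen_ne_zero hF x.1) k)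
    simp only [abs_div, map_mul, abs_mul]
    field_simp
  have h2 : (((∏ k, |v k x.2.1|) / Ideal.absNorm x.1.1 : ℝ) : ℂ) ^ ((1 : ℂ) - 1 / 2) =
      ((Real.sqrt ((∏ k, |v k x.2.1|) / Ideal.absNorm x.1.1) : ℝ) : ℂ) := by
    rw [Real.sqrt_eq_rpow, Complex.ofReal_cpow (by positivity)]
    norm_num
  have h3 : Real.sqrt (∏ k, (z k).im) * (Real.sqrt ((∏ k, |v k x.2.1|) / Ideal.absNorm x.1.1) *
      Real.sqrt (discr F / ((Ideal.absNorm x.1.1 * ∏ k, |v k x.2.1|) * ∏ k, (z k).im))) =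
      Real.sqrt (discr F) * (Ideal.absNorm x.1.1 : ℝ)⁻¹ := by
    rw [← Real.sqrt_mul (by positivity), ← Real.sqrt_mul (by positivity)]
    have : (∏ k, (z k).im) * ((∏ k, |v k x.2.1|) / Ideal.absNorm x.1.1 *
        (discr F / ((Ideal.absNorm x.1.1 * ∏ k, |v k x.2.1|) * ∏ k, (z k).im))) =
        discr F * ((Ideal.absNorm x.1.1 : ℝ)⁻¹) ^ 2 := by
      field_simp
    rw [this, Real.sqrt_mul hD.le, Real.sqrt_sq (by positivity)]
  rw [h1, h2]
  generalize (gen hF x.1 * x.2.1 : 𝓞 F) = μ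
  have h4 : ((Real.exp (∑ k, -(2 * (Real.pi * |v k μ / v k δ| * (z k).im))) : ℝ) : ℂ) *
      Complex.exp (2 * Complex.I * Real.pi * ∑ k, ((v k μ / v k δ * (z k).re : ℝ) : ℂ)) =
      Complex.exp (2 * Complex.I * Real.pi * ∑ k, (((v k μ / v k δ * (z k).re : ℝ) : ℂ) +
          ((|v k μ / v k δ| : ℝ) : ℂ) * Complex.I * ((z k).im : ℂ))) := by
    rw [Complex.ofReal_exp, ← Complex.exp_add, Complex.ofReal_sum, Finset.mul_sum, Finset.mul_sum,
      ← Finset.sum_add_distrib]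
    congr 1
    refine Finset.sum_congr rfl fun k _ => ?_
    push_cast
    linear_combination (-2 * Real.pi * (|v k μ / v k δ| : ℝ) * (z k).im : ℂ) * Complex.I_mul_I
  rw [← h4, zpow_neg_one]
  have h3c := congrArg (fun t : ℝ => (t : ℂ)) h3
  simp only [Complex.ofReal_mul, Complex.ofReal_inv, Complex.ofReal_natCast] at h3c ⊢
  linear_combination (((Real.exp (∑ k, -(2 * (Real.pi * |v k μ / v k δ| * (z k).im))) : ℝ) : ℂ) *
      Complex.exp (2 * Complex.I * Real.pi * ∑ k, ((v k μ / v k δ : ℝ) * ((z k).re : ℝ) : ℂ))) * h3c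

include hF hn hv hδ hz in
-- The series is regrouped into divisor sums, and the coefficient of `Y`, stated with `ζ_F(-1)`, is
-- converted to `Λ(1)` by the functional equation.
theorem hTilde_eq : hTilde v δ z =
    2 ^ n * ((∏ k, (z k).im : ℝ) * complZeta F n 1 + phiSum hF v δ 1 z) := by
  have hδ0 := delta_ne_zero hδ
  have hsum : HasSum (fun x : PairIdx F => (Ideal.absNorm x.1.1 : ℂ) ^ (-1 : ℤ) *
      expTerm v δ (gen hF x.1 * x.2.1) z)
      ((Real.sqrt (discr F) : ℂ)⁻¹ * phiSum hF v δ 1 z) := by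
    have h := (((summable_norm_phiTerm hF hv hδ0 hz 1).of_norm.hasSum).mul_left
      (Real.sqrt (∏ k, (z k).im) : ℂ)).mul_left (Real.sqrt (discr F) : ℂ)⁻¹
    refine h.congr_fun fun x => ?_
    rw [phiTerm_one hF hv hδ hz, inv_mul_cancel_left₀]
    exact_mod_cast (Real.sqrt_pos.2 (discr_pos hv)).ne'
  have h := (hasSum_sigma_mul hF (f := fun a => expTerm v δ a z) hsum).tsum_eq
  simp only [expTerm] at h
  rw [hTilde, zetaF_neg_one hF hn hv hδ, h, mul_assoc (2 ^ n : ℂ) (Real.sqrt (discr F) : ℂ),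
    mul_inv_cancel_left₀ (by exact_mod_cast (Real.sqrt_pos.2 (discr_pos hv)).ne')]
  push_cast
  ring

include hF hn hv hδ hz in
/-- The Kronecker limit formula for `h̃`. -/
theorem hTilde_moebius (M : Matrix.SpecialLinearGroup (Fin 2) (𝓞 F)) :
    hTilde v δ (moebius v M z) -
        ((4 ^ n * Units.regulator F / 4 * ∑ k, Real.log (moebius v M z k).im : ℝ) : ℂ) =
      hTilde v δ z - ((4 ^ n * Units.regulator F / 4 * ∑ k, Real.log (z k).im : ℝ) : ℂ) := by
  have hz' := moebius_mem (v := v) hz M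
  have h := limit_invariant hF hn hv hδ hz M
  rw [Real.log_prod fun k _ => (hz k).ne', Real.log_prod fun k _ => (hz' k).ne'] at h
  rw [hTilde_eq hF hn hv hδ hz, hTilde_eq hF hn hv hδ hz']
  have h4 : (4 : ℂ) ^ n = 2 ^ n * 2 ^ n := by
    rw [← mul_pow]
    norm_num
  push_cast at h ⊢
  rw [h4]
  linear_combination 2 ^ n * h

end Regroup

/-! ### Series of exponentials of linear forms -/

section ExpSeries

variable {ι : Type*} {E : Type} [NormedAddCommGroup E] [NormedSpace ℝ E]
variable {ℓ : ι → E →L[ℝ] ℂ} {N : ι → ℝ} {C : ℝ} {U : Set E}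

/-- Coefficients that are summable against every negative exponential of the weight `N`. -/
def IsRapid (N : ι → ℝ) {G : Type} [NormedAddCommGroup G] (c : ι → G) : Prop :=
  ∀ κ : ℝ, 0 < κ → Summable fun i => ‖c i‖ * Real.exp (-(κ * N i))

/-- A factor `N` is absorbed by half of the exponential. This stability lets the series be
differentiated arbitrarily often. -/
theorem IsRapid.of_le {G H : Type} [NormedAddCommGroup G] [NormedAddCommGroup H] {c : ι → G}
    {d : ι → H} (hc : IsRapid N c) (hN : ∀ i, 0 ≤ N i) (h : ∀ i, ‖d i‖ ≤ C * N i * ‖c i‖) :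
    IsRapid N d := by
  intro κ hκ
  refine Summable.of_nonneg_of_le (fun i => by positivity) (fun i => ?_)
    ((hc (κ / 2) (half_pos hκ)).mul_left (|C| * (2 / κ)))
  have h1 : N i * Real.exp (-(κ * N i)) ≤ 2 / κ * Real.exp (-(κ / 2 * N i)) := by
    have h2 : κ / 2 * N i ≤ Real.exp (κ / 2 * N i) :=
      (le_add_of_nonneg_right zero_le_one).trans (Real.add_one_le_exp _)
    have h3 : N i ≤ 2 / κ * Real.exp (κ / 2 * N i) := by
      rw [div_mul_eq_mul_div, le_div_iff₀ hκ]
      linarith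
    calc N i * Real.exp (-(κ * N i)) ≤
        2 / κ * Real.exp (κ / 2 * N i) * Real.exp (-(κ * N i)) := by gcongr
      _ = _ := by
        rw [mul_assoc, ← Real.exp_add]
        congr 2
        ring
  calc ‖d i‖ * Real.exp (-(κ * N i)) ≤ |C| * N i * ‖c i‖ * Real.exp (-(κ * N i)) := by
        have := h i
        have h4 : C * N i * ‖c i‖ ≤ |C| * N i * ‖c i‖ := by
          have := hN i
          gcongr
          exact le_abs_self C
        gcongr
        exact this.trans h4
    _ = |C| * ‖c i‖ * (N i * Real.exp (-(κ * N i))) := by ring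
    _ ≤ |C| * ‖c i‖ * (2 / κ * Real.exp (-(κ / 2 * N i))) := by gcongr
    _ = _ := by ring

/-- The sum of the series with exponents `ℓ` and coefficients `c`. -/
noncomputable def expSeries (ℓ : ι → E →L[ℝ] ℂ) {G : Type} [NormedAddCommGroup G] [NormedSpace ℂ G]
    (c : ι → G) (z : E) : G := ∑' i, Complex.exp (ℓ i z) • c i

variable (hN : ∀ i, 0 ≤ N i) (hℓ : ∀ i, ‖ℓ i‖ ≤ C * N i) (hU : IsOpen U)
  (hre : ∀ z ∈ U, ∃ κ : ℝ, 0 < κ ∧ ∀ᶠ w in 𝓝 z, ∀ i, (ℓ i w).re ≤ -(κ * N i))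

variable {G : Type} [NormedAddCommGroup G] [NormedSpace ℝ G] [NormedSpace ℂ G] [IsScalarTower ℝ ℂ G]
  {c : ι → G}

include hN hℓ in
theorem IsRapid.smulRight (hc : IsRapid N c) : IsRapid N fun i => (ℓ i).smulRight (c i) := by
  refine hc.of_le (C := C) hN fun i => ?_
  refine ContinuousLinearMap.opNorm_le_bound _
    (mul_nonneg ((norm_nonneg _).trans (hℓ i)) (norm_nonneg _)) fun v => ?_
  rw [ContinuousLinearMap.smulRight_apply, norm_smul]
  calc ‖ℓ i v‖ * ‖c i‖ ≤ C * N i * ‖v‖ * ‖c i‖ := by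
        gcongr
        exact (ℓ i).le_of_opNorm_le (hℓ i) v
    _ = _ := by ring

include hre in
theorem summable_expSeries [CompleteSpace G] (hc : IsRapid N c) {z : E} (hz : z ∈ U) :
    Summable fun i => Complex.exp (ℓ i z) • c i := by
  obtain ⟨κ, hκ, h⟩ := hre z hz
  refine Summable.of_norm_bounded (hc κ hκ) fun i => ?_
  rw [norm_smul, Complex.norm_exp, mul_comm]
  have := h.self_of_nhds i
  gcongr

include hN hℓ hre in
theorem hasFDerivAt_expSeries [CompleteSpace G] (hc : IsRapid N c) {z : E} (hz : z ∈ U) :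
    HasFDerivAt (expSeries ℓ c) (expSeries ℓ (fun i => (ℓ i).smulRight (c i)) z) z := by
  obtain ⟨κ, hκ, h⟩ := hre z hz
  obtain ⟨r, hr, hball⟩ := Metric.eventually_nhds_iff_ball.1 h
  have hbound := (hc.smulRight hN hℓ) κ hκ
  refine hasFDerivAt_tsum_of_isPreconnected (f := fun i w => Complex.exp (ℓ i w) • c i)
    (f' := fun i w => Complex.exp (ℓ i w) • (ℓ i).smulRight (c i)) hbound Metric.isOpen_ball
    (convex_ball z r).isPreconnected (fun i w _ => ?_) (fun i w hw => ?_)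
    (Metric.mem_ball_self hr) (summable_expSeries hre hc hz) (Metric.mem_ball_self hr)
  · have h1 : HasFDerivAt (fun w => Complex.exp (ℓ i w)) (Complex.exp (ℓ i w) • ℓ i) w :=
      ((ℓ i).hasFDerivAt).cexp
    refine (h1.smul_const (c i)).congr_fderiv ?_
    ext v
    simp [smul_smul]
  · rw [norm_smul, Complex.norm_exp, mul_comm]
    have := hball w hw i
    gcongr

include hN hℓ hU hre in
-- The derivative is a series of the same kind with coefficients in a space of linear maps; this is
-- why the induction on the order quantifies over the target space.
theorem contDiffOn_expSeries (p : ℕ) : ∀ {G : Type} [NormedAddCommGroup G] [NormedSpace ℝ G]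
    [NormedSpace ℂ G] [IsScalarTower ℝ ℂ G] [CompleteSpace G] {c : ι → G}, IsRapid N c →
    ContDiffOn ℝ p (expSeries ℓ c) U := by
  induction p with
  | zero =>
    intro G _ _ _ _ _ c hc
    refine contDiffOn_zero.2 fun z hz => ?_
    exact (hasFDerivAt_expSeries hN hℓ hre hc hz).continuousAt.continuousWithinAt
  | succ p ih =>
    intro G _ _ _ _ _ c hc
    push_cast
    rw [contDiffOn_succ_iff_fderiv_of_isOpen hU]
    refine ⟨fun z hz => (hasFDerivAt_expSeries hN hℓ hre hc
      hz).differentiableAt.differentiableWithinAt, by simp, ?_⟩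
    exact (ih (hc.smulRight hN hℓ)).congr fun z hz => (hasFDerivAt_expSeries hN hℓ hre hc hz).fderiv

end ExpSeries

/-! ### Wirtinger derivatives -/

section Wirtinger

variable {n : ℕ}

theorem isOpen_upperHalfProd : IsOpen (upperHalfProd n) := by
  rw [upperHalfProd, Set.ofPred_forall]
  exact isOpen_iInter_of_finite fun k =>
    isOpen_lt continuous_const (Complex.continuous_im.comp (continuous_apply k))

/-- The `dz_j`-component of a real linear form. -/
noncomputable def wirt (j : Fin n) : ((Fin n → ℂ) →L[ℝ] ℂ) →L[ℝ] ℂ :=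
  (1 / 2 : ℂ) • (ContinuousLinearMap.apply ℝ ℂ (Pi.single j (1 : ℂ)) -
    Complex.I • ContinuousLinearMap.apply ℝ ℂ (Pi.single j Complex.I))

/-- The `dz̄_j`-component of a real linear form. -/
noncomputable def wirtBar (j : Fin n) : ((Fin n → ℂ) →L[ℝ] ℂ) →L[ℝ] ℂ :=
  (1 / 2 : ℂ) • (ContinuousLinearMap.apply ℝ ℂ (Pi.single j (1 : ℂ)) +
    Complex.I • ContinuousLinearMap.apply ℝ ℂ (Pi.single j Complex.I))

theorem wirt_apply (j : Fin n) (L : (Fin n → ℂ) →L[ℝ] ℂ) :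
    wirt j L = 1 / 2 * (L (Pi.single j 1) - Complex.I * L (Pi.single j Complex.I)) := rfl

theorem wirtBar_apply (j : Fin n) (L : (Fin n → ℂ) →L[ℝ] ℂ) :
    wirtBar j L = 1 / 2 * (L (Pi.single j 1) + Complex.I * L (Pi.single j Complex.I)) := rfl

theorem dWirt_eq_wirt (j : Fin n) (f : (Fin n → ℂ) → ℂ) (z : Fin n → ℂ) :
    dWirt j f z = wirt j (fderiv ℝ f z) := rfl

theorem wirt_smul (j : Fin n) (a : ℂ) (L : (Fin n → ℂ) →L[ℝ] ℂ) : wirt j (a • L) = a * wirt j L := by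
  simp only [wirt_apply, _root_.smul_apply, smul_eq_mul]
  ring

theorem wirtBar_smul (j : Fin n) (a : ℂ) (L : (Fin n → ℂ) →L[ℝ] ℂ) :
    wirtBar j (a • L) = a * wirtBar j L := by
  simp only [wirtBar_apply, _root_.smul_apply, smul_eq_mul]
  ring

theorem apply_single (L : (Fin n → ℂ) →L[ℝ] ℂ) (k : Fin n) (a : ℂ) :
    L (Pi.single k a) = a.re * L (Pi.single k 1) + a.im * L (Pi.single k Complex.I) := by
  have h : (Pi.single k a : Fin n → ℂ) =
      a.re • (Pi.single k (1 : ℂ) : Fin n → ℂ) + a.im • (Pi.single k Complex.I : Fin n → ℂ) := by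
    rw [← Pi.single_smul, ← Pi.single_smul, ← Pi.single_add]
    congr 1
    rw [Complex.real_smul, Complex.real_smul, mul_one, Complex.re_add_im]
  rw [h, map_add, map_smul, map_smul, Complex.real_smul, Complex.real_smul]

theorem eq_sum_wirt (L : (Fin n → ℂ) →L[ℝ] ℂ) :
    L = ∑ k, (wirt k L • dz k + wirtBar k L • dzbar k) := by
  ext v
  have h : L v = ∑ k, L (Pi.single k (v k)) := by
    rw [← map_sum, Finset.univ_sum_single]
  rw [h, _root_.sum_apply]
  refine Finset.sum_congr rfl fun k _ => ?_
  have h1 : dz k v = v k := rfl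
  have h2 : dzbar k v = (starRingEnd ℂ) (v k) := rfl
  rw [apply_single, _root_.add_apply, _root_.smul_apply,
    _root_.smul_apply, h1, h2, wirt_apply, wirtBar_apply, smul_eq_mul, smul_eq_mul]
  conv_rhs => rw [← Complex.re_add_im (v k)]
  simp only [map_add, map_mul, Complex.conj_ofReal, Complex.conj_I]
  linear_combination ((v k).im * L (Pi.single k Complex.I)) * Complex.I_mul_I

/-- The chain rule for a holomorphic map acting coordinate by coordinate, on the level of
differentials: the multiplication by `a j` is complex linear, so no `dz̄_j` component enters. -/
theorem wirt_comp_diag (j : Fin n) (L : (Fin n → ℂ) →L[ℝ] ℂ) (a : Fin n → ℂ) :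
    wirt j (L.comp (ContinuousLinearMap.pi fun k => a k • dz k)) = a j * wirt j L := by
  have h : ∀ t : ℂ, (ContinuousLinearMap.pi fun k => a k • dz k : (Fin n → ℂ) →L[ℝ] (Fin n → ℂ))
      (Pi.single j t) = Pi.single j (a j * t) := by
    intro t
    funext k
    change a k * (Pi.single j t : Fin n → ℂ) k = _
    by_cases hk : k = j
    · subst hk
      simp
    · simp [hk]
  rw [wirt_apply, wirt_apply, ContinuousLinearMap.comp_apply, ContinuousLinearMap.comp_apply, h, h,
    mul_one, apply_single L j (a j), apply_single L j (a j * Complex.I), Complex.mul_I_re,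
    Complex.mul_I_im]
  conv_rhs => rw [← Complex.re_add_im (a j)]
  push_cast
  linear_combination (1 / 2 * (a j).im * L (Pi.single j Complex.I)) * Complex.I_mul_I

variable {f g : (Fin n → ℂ) → ℂ} {U : Set (Fin n → ℂ)} {z : Fin n → ℂ}

/-- Differentiability is not required: otherwise `fderiv` is 0 by default. -/
theorem fderiv_apply_eq_zero {w : Fin n → ℂ} (h : ∀ t : ℝ, f (z + t • w) = f z) :
    fderiv ℝ f z w = 0 := by
  by_cases hf : DifferentiableAt ℝ f z
  · rw [← hf.lineDeriv_eq_fderiv, lineDeriv]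
    simp only [h]
    exact deriv_const _ _
  · rw [fderiv_zero_of_not_differentiableAt hf, _root_.zero_apply]

theorem wirt_fderiv_eq_zero {j : Fin n} (h : ∀ a : ℂ, f (z + Pi.single j a) = f z) :
    wirt j (fderiv ℝ f z) = 0 ∧ wirtBar j (fderiv ℝ f z) = 0 := by
  have h1 : ∀ a : ℂ, fderiv ℝ f z (Pi.single j a) = 0 := fun a =>
    fderiv_apply_eq_zero fun t => by rw [← Pi.single_smul, h]
  rw [wirt_apply, wirtBar_apply, h1, h1]
  simp

theorem contDiffOn_dWirt (hU : IsOpen U) (hf : ContDiffOn ℝ ∞ f U) (j : Fin n) :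
    ContDiffOn ℝ ∞ (dWirt j f) U :=
  (wirt j).contDiff.comp_contDiffOn (hf.fderiv_of_isOpen hU (by simp))

theorem contDiffOn_dWirtIter (hU : IsOpen U) (hf : ContDiffOn ℝ ∞ f U) (l : List (Fin n)) :
    ContDiffOn ℝ ∞ (dWirtIter l f) U := by
  induction l with
  | nil => exact hf
  | cons j l ih => exact contDiffOn_dWirt hU ih j

theorem ContDiffOn.differentiableAt_of_isOpen (hU : IsOpen U) (hf : ContDiffOn ℝ ∞ f U) (hz : z ∈ U) :
    DifferentiableAt ℝ f z :=
  (hf.contDiffAt (hU.mem_nhds hz)).differentiableAt (by simp)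

theorem eqOn_dWirt (hU : IsOpen U) (h : EqOn f g U) (j : Fin n) :
    EqOn (dWirt j f) (dWirt j g) U := fun z hz => by
  rw [dWirt_eq_wirt, dWirt_eq_wirt, (h.eventuallyEq_of_mem (hU.mem_nhds hz)).fderiv_eq]

theorem dWirtIter_sub (hU : IsOpen U) (hf : ContDiffOn ℝ ∞ f U) (hg : ContDiffOn ℝ ∞ g U)
    (l : List (Fin n)) :
    EqOn (dWirtIter l (fun w => f w - g w)) (fun w => dWirtIter l f w - dWirtIter l g w) U := by
  induction l with
  | nil => exact fun _ _ => rfl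
  | cons j l ih =>
    refine (eqOn_dWirt hU ih j).trans fun z hz => ?_
    rw [dWirt_eq_wirt, fderiv_fun_sub
      (ContDiffOn.differentiableAt_of_isOpen hU (contDiffOn_dWirtIter hU hf l) hz)
      (ContDiffOn.differentiableAt_of_isOpen hU (contDiffOn_dWirtIter hU hg l) hz), map_sub]
    rfl

theorem dWirtIter_add (hU : IsOpen U) (hf : ContDiffOn ℝ ∞ f U) (hg : ContDiffOn ℝ ∞ g U)
    (l : List (Fin n)) :
    EqOn (dWirtIter l (fun w => f w + g w)) (fun w => dWirtIter l f w + dWirtIter l g w) U := by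
  induction l with
  | nil => exact fun _ _ => rfl
  | cons j l ih =>
    refine (eqOn_dWirt hU ih j).trans fun z hz => ?_
    rw [dWirt_eq_wirt, fderiv_fun_add
      (ContDiffOn.differentiableAt_of_isOpen hU (contDiffOn_dWirtIter hU hf l) hz)
      (ContDiffOn.differentiableAt_of_isOpen hU (contDiffOn_dWirtIter hU hg l) hz), map_add]
    rfl

end Wirtinger

/-! ### Mixed derivatives of an invariant function under Möbius transformations -/

section Transformation

variable {F : Type*} [Field F] {n : ℕ} {v : Fin n → (F →+* ℝ)}
variable {z : Fin n → ℂ} (hz : z ∈ upperHalfProd n)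
variable [NumberField F] [IsTotallyReal F] (A : Matrix.SpecialLinearGroup (Fin 2) (𝓞 F))

variable (v) in
/-- The factor of automorphy. -/
noncomputable def autFactor (z : Fin n → ℂ) (k : Fin n) : ℂ :=
  ((v k (A 1 0) : ℝ) : ℂ) * z k + ((v k (A 1 1) : ℝ) : ℂ)

include hz in
theorem autFactor_ne_zero (k : Fin n) : autFactor v A z k ≠ 0 :=
  moebius_denom_ne_zero A k (hz k)

include hz in
theorem hasFDerivAt_moebius : HasFDerivAt (moebius v A)
    (ContinuousLinearMap.pi fun k => ((autFactor v A z k) ^ 2)⁻¹ • dz k) z := by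
  rw [hasFDerivAt_pi]
  intro k
  have h0 := autFactor_ne_zero (v := v) hz A k
  have hdet := v_det (v := v) A k
  have h1 : HasDerivAt (fun w : ℂ => (((v k (A 0 0) : ℝ) : ℂ) * w + ((v k (A 0 1) : ℝ) : ℂ)) /
      (((v k (A 1 0) : ℝ) : ℂ) * w + ((v k (A 1 1) : ℝ) : ℂ))) ((autFactor v A z k ^ 2)⁻¹) (z k) := by
    have h := (((hasDerivAt_id (z k)).const_mul ((v k (A 0 0) : ℝ) : ℂ)).add_const
      ((v k (A 0 1) : ℝ) : ℂ)).div (((hasDerivAt_id (z k)).const_mul ((v k (A 1 0) : ℝ) : ℂ)).add_const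
      ((v k (A 1 1) : ℝ) : ℂ)) h0
    refine h.congr_deriv ?_
    have hdet' : ((v k (A 0 0) : ℝ) : ℂ) * ((v k (A 1 1) : ℝ) : ℂ) -
        ((v k (A 0 1) : ℝ) : ℂ) * ((v k (A 1 0) : ℝ) : ℂ) = 1 := by exact_mod_cast hdet
    rw [← one_div]
    change _ / autFactor v A z k ^ 2 = _
    congr 1
    simp only [id]
    linear_combination hdet'
  have h2 := (h1.hasFDerivAt.restrictScalars ℝ).comp z
    (ContinuousLinearMap.proj (R := ℝ) (φ := fun _ : Fin n => ℂ) k).hasFDerivAt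
  refine h2.congr_fderiv ?_
  ext w
  change w k • ((autFactor v A z k) ^ 2)⁻¹ = ((autFactor v A z k) ^ 2)⁻¹ • w k
  rw [smul_eq_mul, smul_eq_mul, mul_comm]

variable {H : (Fin n → ℂ) → ℂ} (hH : ContDiffOn ℝ ∞ H (upperHalfProd n))
  (hinv : ∀ z ∈ upperHalfProd n, H (moebius v A z) = H z)

theorem contDiffOn_autFactor_prod (l : List (Fin n)) :
    ContDiffOn ℝ ∞ (fun z => (l.map fun k => ((autFactor v A z k) ^ 2)⁻¹).prod) (upperHalfProd n) := by
  induction l with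
  | nil => simpa using contDiffOn_const
  | cons j l ih =>
    simp only [List.map_cons, List.prod_cons]
    refine ContDiffOn.mul (ContDiffOn.inv ?_ fun z hz => pow_ne_zero 2 (autFactor_ne_zero hz A j)) ih
    refine ContDiff.contDiffOn (ContDiff.pow ?_ 2)
    unfold autFactor
    fun_prop

include hH hinv in
-- The automorphy factors already produced do not involve `z_j`, so `∂/∂z_j` only meets the
-- composite with the Möbius map, whose `j`-th derivative is `(c_j z_j + d_j)⁻²`. Distinctness of
-- the variables is essential: a repeated derivative would hit an automorphy factor.
theorem dWirtIter_moebius (l : List (Fin n)) (hl : l.Nodup) : ∀ z ∈ upperHalfProd n,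
    dWirtIter l H z = (l.map fun k => ((autFactor v A z k) ^ 2)⁻¹).prod *
      dWirtIter l H (moebius v A z) := by
  have hU := isOpen_upperHalfProd (n := n)
  induction l with
  | nil =>
    intro z hz
    simpa [dWirtIter] using (hinv z hz).symm
  | cons j l ih =>
    rw [List.nodup_cons] at hl
    intro z hz
    have hz' := moebius_mem (v := v) hz A
    have hD := contDiffOn_dWirtIter hU hH l
    have hGd := (ContDiffOn.differentiableAt_of_isOpen hU hD hz').hasFDerivAt.comp z
      (hasFDerivAt_moebius hz A)
    have hP := ContDiffOn.differentiableAt_of_isOpen hU (contDiffOn_autFactor_prod (v := v) A l) hz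
    have hPw : wirt j (fderiv ℝ (fun z => (l.map fun k => ((autFactor v A z k) ^ 2)⁻¹).prod) z) = 0 := by
      refine (wirt_fderiv_eq_zero fun a => ?_).1
      refine congrArg List.prod (List.map_congr_left fun k hk => ?_)
      have hkj : k ≠ j := fun h => hl.1 (h ▸ hk)
      simp [autFactor, hkj]
    have h1 : dWirtIter (j :: l) H z = dWirt j (fun w =>
        (l.map fun k => ((autFactor v A w k) ^ 2)⁻¹).prod * dWirtIter l H (moebius v A w)) z :=
      eqOn_dWirt hU (ih hl.2) j hz
    have h2 := (hP.hasFDerivAt.mul hGd).fderiv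
    rw [h1, dWirt_eq_wirt]
    change wirt j (fderiv ℝ ((fun z => (l.map fun k => ((autFactor v A z k) ^ 2)⁻¹).prod) *
      (dWirtIter l H ∘ moebius v A)) z) = _
    rw [h2, map_add]
    rw [wirt_smul, wirt_smul, hPw, mul_zero, add_zero, wirt_comp_diag, List.map_cons, List.prod_cons,
      ← dWirt_eq_wirt]
    change _ = _ * dWirt j (dWirtIter l H) (moebius v A z)
    ring

end Transformation

/-! ### Derivatives of the logarithms of the imaginary parts -/

section Explicit

variable {n : ℕ} {z : Fin n → ℂ}

/-- The complex-valued imaginary part of the `k`-th coordinate. -/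
noncomputable def imForm (k : Fin n) : (Fin n → ℂ) →L[ℝ] ℂ :=
  Complex.ofRealCLM.comp (Complex.imCLM.comp (ContinuousLinearMap.proj k))

theorem imForm_apply (k : Fin n) (z : Fin n → ℂ) : imForm k z = ((z k).im : ℂ) := rfl

theorem wirt_imForm (j k : Fin n) : wirt j (imForm k) = if k = j then 1 / (2 * Complex.I) else 0 := by
  rw [wirt_apply, imForm_apply, imForm_apply]
  split_ifs with h
  · subst h
    simp [mul_comm]
  · simp [h]

theorem wirtBar_imForm (j k : Fin n) :
    wirtBar j (imForm k) = if k = j then -(1 / (2 * Complex.I)) else 0 := by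
  rw [wirtBar_apply, imForm_apply, imForm_apply]
  split_ifs with h
  · subst h
    simp [mul_comm]
  · simp [h]

theorem hasFDerivAt_log_im (hz : z ∈ upperHalfProd n) (k : Fin n) :
    HasFDerivAt (fun w : Fin n → ℂ => ((Real.log (w k).im : ℝ) : ℂ))
      (((z k).im : ℂ)⁻¹ • imForm k) z := by
  have h1 : HasFDerivAt (fun w : Fin n → ℂ => (w k).im)
      (Complex.imCLM.comp (ContinuousLinearMap.proj k)) z :=
    (Complex.imCLM.comp (ContinuousLinearMap.proj (R := ℝ) (φ := fun _ : Fin n => ℂ) k)).hasFDerivAt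
  have h2 := Complex.ofRealCLM.hasFDerivAt.comp z (h1.log (hz k).ne')
  refine h2.congr_fderiv ?_
  ext w
  simp [imForm]

theorem hasFDerivAt_inv_im (hz : z ∈ upperHalfProd n) (k : Fin n) :
    HasFDerivAt (fun w : Fin n → ℂ => ((w k).im : ℂ)⁻¹) (-(((z k).im : ℂ) ^ 2)⁻¹ • imForm k) z := by
  have h0 : ((z k).im : ℂ) ≠ 0 := by exact_mod_cast (hz k).ne'
  have h := (hasDerivAt_inv h0).hasFDerivAt.restrictScalars ℝ |>.comp z (imForm k).hasFDerivAt
  refine h.congr_fderiv ?_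
  ext w
  simp [imForm, mul_comm]

theorem contDiffOn_log_im (c : ℝ) : ContDiffOn ℝ ∞
    (fun w : Fin n → ℂ => ((c * ∑ k, Real.log (w k).im : ℝ) : ℂ)) (upperHalfProd n) := by
  refine Complex.ofRealCLM.contDiff.comp_contDiffOn (contDiffOn_const.mul
    (ContDiffOn.sum fun k _ => ContDiffOn.log ?_ fun z hz => (hz k).ne'))
  exact (Complex.imCLM.comp
    (ContinuousLinearMap.proj (R := ℝ) (φ := fun _ : Fin n => ℂ) k)).contDiff.contDiffOn

theorem dWirt_log_im (c : ℝ) (j : Fin n) :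
    EqOn (dWirt j (fun w : Fin n → ℂ => ((c * ∑ k, Real.log (w k).im : ℝ) : ℂ)))
      (fun z => c / (2 * Complex.I) * ((z j).im : ℂ)⁻¹) (upperHalfProd n) := fun z hz => by
  have h1 : HasFDerivAt (fun w : Fin n → ℂ => ((c * ∑ k, Real.log (w k).im : ℝ) : ℂ))
      ((c : ℂ) • ∑ k, ((z k).im : ℂ)⁻¹ • imForm k) z := by
    have := (HasFDerivAt.fun_sum fun k (_ : k ∈ Finset.univ) =>
      hasFDerivAt_log_im hz k).const_mul (c : ℂ)
    refine this.congr_of_eventuallyEq (Eventually.of_forall fun w => ?_)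
    push_cast
    rfl
  rw [dWirt_eq_wirt, h1.fderiv, wirt_smul, map_sum]
  simp only [wirt_smul, wirt_imForm, mul_ite, mul_zero, Finset.sum_ite_eq', Finset.mem_univ, if_true]
  ring

/-- After one derivative only a function of a single coordinate is left, and a derivative in another
coordinate kills it. This is why no correction appears when `n ≥ 3`. -/
theorem dWirtIter_log_im (c : ℝ) (i j : Fin n) (l : List (Fin n)) (hl : (i :: j :: l).Nodup) :
    EqOn (dWirtIter (i :: j :: l) (fun w : Fin n → ℂ => ((c * ∑ k, Real.log (w k).im : ℝ) : ℂ)))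
      (fun _ => 0) (upperHalfProd n) := by
  have hU := isOpen_upperHalfProd (n := n)
  induction l generalizing i j with
  | nil =>
    have hij : i ≠ j := by
      rintro rfl
      simp at hl
    refine (eqOn_dWirt hU (dWirt_log_im c j) i).trans fun z hz => ?_
    refine (wirt_fderiv_eq_zero fun a => ?_).1
    simp [hij.symm]
  | cons k l ih =>
    refine (eqOn_dWirt hU (ih j k (List.nodup_cons.1 hl).2) i).trans fun z _ => ?_
    exact (wirt_fderiv_eq_zero fun a => rfl).1

end Explicit

/-! ### Derivatives of `h̃` -/

section Coordinates

variable {n : ℕ}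

theorem wirt_dz (j k : Fin n) : wirt j (dz k) = if k = j then 1 else 0 := by
  have h : ∀ a : ℂ, dz k (Pi.single j a : Fin n → ℂ) = (Pi.single j a : Fin n → ℂ) k := fun _ => rfl
  rw [wirt_apply, h, h]
  split_ifs with hk
  · subst hk
    rw [Pi.single_eq_same, Pi.single_eq_same, Complex.I_mul_I]
    norm_num
  · simp [hk]

theorem wirt_dzbar (j k : Fin n) : wirt j (dzbar k) = 0 := by
  have h : ∀ a : ℂ, dzbar k (Pi.single j a : Fin n → ℂ) =
      (starRingEnd ℂ) ((Pi.single j a : Fin n → ℂ) k) := fun _ => rfl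
  rw [wirt_apply, h, h]
  by_cases hk : k = j
  · subst hk
    simp
  · simp [hk]

theorem wirtBar_dz (j k : Fin n) : wirtBar j (dz k) = 0 := by
  have h : ∀ a : ℂ, dz k (Pi.single j a : Fin n → ℂ) = (Pi.single j a : Fin n → ℂ) k := fun _ => rfl
  rw [wirtBar_apply, h, h]
  by_cases hk : k = j
  · subst hk
    simp
  · simp [hk]

theorem wirtBar_dzbar (j k : Fin n) : wirtBar j (dzbar k) = if k = j then 1 else 0 := by
  have h : ∀ a : ℂ, dzbar k (Pi.single j a : Fin n → ℂ) =
      (starRingEnd ℂ) ((Pi.single j a : Fin n → ℂ) k) := fun _ => rfl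
  rw [wirtBar_apply, h, h]
  split_ifs with hk
  · subst hk
    rw [Pi.single_eq_same, Pi.single_eq_same, Complex.conj_I, mul_neg, Complex.I_mul_I, map_one]
    norm_num
  · simp [hk]

/-- The product of some of the imaginary parts. -/
noncomputable def yProd (S : Finset (Fin n)) (z : Fin n → ℂ) : ℂ := ∏ k ∈ S, ((z k).im : ℂ)

theorem hasFDerivAt_yProd (S : Finset (Fin n)) (z : Fin n → ℂ) :
    HasFDerivAt (yProd S) (∑ i ∈ S, yProd (S.erase i) z • imForm i) z := by
  classical
  exact HasFDerivAt.finsetProd fun i _ => (imForm i).hasFDerivAt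

theorem contDiff_yProd (S : Finset (Fin n)) : ContDiff ℝ ∞ (yProd S) :=
  contDiff_prod fun i _ => (imForm i).contDiff

theorem dWirt_const_mul_yProd (a : ℂ) {S : Finset (Fin n)} {j : Fin n} (hj : j ∈ S) (z : Fin n → ℂ) :
    dWirt j (fun w => a * yProd S w) z = a * (1 / (2 * Complex.I)) * yProd (S.erase j) z := by
  rw [dWirt_eq_wirt, ((hasFDerivAt_yProd S z).const_mul a).fderiv, wirt_smul, map_sum]
  simp only [wirt_smul, wirt_imForm, mul_ite, mul_zero, Finset.sum_ite_eq', hj, if_true]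
  ring

theorem dWirtIter_const_mul_yProd (a : ℂ) (l : List (Fin n)) (hl : l.Nodup) :
    dWirtIter l (fun w => a * yProd Finset.univ w) =
      fun w => a * (1 / (2 * Complex.I)) ^ l.length * yProd (Finset.univ \ l.toFinset) w := by
  induction l with
  | nil =>
    funext w
    simp [dWirtIter]
  | cons j l ih =>
    rw [List.nodup_cons] at hl
    funext w
    change dWirt j (dWirtIter l _) w = _
    rw [ih hl.2, dWirt_const_mul_yProd _ (by simpa using hl.1), List.length_cons, pow_succ,
      List.toFinset_cons, Finset.sdiff_insert]
    ring

end Coordinates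

/-! ### The exponential series in `h̃` and its derivatives -/

section HTilde

variable {F : Type*} [Field F] [NumberField F] [IsTotallyReal F]
variable (hF : NarrowClassNumberOne F)
variable {n : ℕ} {v : Fin n → (F →+* ℝ)} (hv : Function.Bijective v)
variable {δ : 𝓞 F} (hδ : Ideal.span {δ} = differentIdeal ℤ (𝓞 F))
variable {z : Fin n → ℂ} (hz : z ∈ upperHalfProd n)

variable (v δ) in
/-- The coefficient of `dz_k` (for `s = 1`) or `dz̄_k` (for `s = -1`) in the exponents. -/
noncomputable def expCoeff (s : ℝ) (μ : 𝓞 F) (k : Fin n) : ℂ :=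
  Real.pi * Complex.I * ((v k μ / v k δ + s * |v k μ / v k δ| : ℝ) : ℂ)

variable (v δ) in
/-- The exponent of the term `μ` of `h̃`. -/
noncomputable def expForm (μ : 𝓞 F) : (Fin n → ℂ) →L[ℝ] ℂ :=
  ∑ k, (expCoeff v δ 1 μ k • dz k + expCoeff v δ (-1) μ k • dzbar k)

theorem expForm_apply (μ : 𝓞 F) (z : Fin n → ℂ) : expForm v δ μ z = 2 * Complex.I * Real.pi *
        ∑ k, (((v k μ / v k δ * (z k).re : ℝ) : ℂ) +
          ((|v k μ / v k δ| : ℝ) : ℂ) * Complex.I * ((z k).im : ℂ)) := by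
  rw [expForm, _root_.sum_apply, Finset.mul_sum]
  refine Finset.sum_congr rfl fun k _ => ?_
  have h1 : dz k z = (z k).re + (z k).im * Complex.I := (Complex.re_add_im (z k)).symm
  have h2 : dzbar k z = (z k).re - (z k).im * Complex.I := by
    change (starRingEnd ℂ) (z k) = _
    conv_lhs => rw [← Complex.re_add_im (z k)]
    simp only [map_add, map_mul, Complex.conj_ofReal, Complex.conj_I]
    ring
  rw [_root_.add_apply, _root_.smul_apply, _root_.smul_apply, h1, h2, expCoeff, expCoeff]
  simp only [smul_eq_mul]
  push_cast
  ring

theorem wirt_expForm (j : Fin n) (μ : 𝓞 F) : wirt j (expForm v δ μ) = expCoeff v δ 1 μ j := by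
  rw [expForm, map_sum]
  simp [wirt_smul, wirt_dz, wirt_dzbar]

theorem wirtBar_expForm (j : Fin n) (μ : 𝓞 F) :
    wirtBar j (expForm v δ μ) = expCoeff v δ (-1) μ j := by
  rw [expForm, map_sum]
  simp [wirtBar_smul, wirtBar_dz, wirtBar_dzbar]

variable (v) in
/-- The weight of an integer. -/
noncomputable def absSum (μ : {μ : 𝓞 F // μ ≠ 0}) : ℝ := ∑ k, |v k μ.1|

theorem absSum_nonneg (μ : {μ : 𝓞 F // μ ≠ 0}) : 0 ≤ absSum v μ :=
  Finset.sum_nonneg fun _ _ => abs_nonneg _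

variable (v δ) in
/-- A bound for the exponents. -/
noncomputable def expBound : ℝ := 4 * Real.pi * ∑ k, |v k δ|⁻¹

theorem norm_expCoeff_le {s : ℝ} (hs : |s| ≤ 1) (μ : {μ : 𝓞 F // μ ≠ 0}) (k : Fin n) :
    ‖expCoeff v δ s μ.1 k‖ ≤ 2 * Real.pi * |v k δ|⁻¹ * absSum v μ := by
  have hpi := Real.pi_pos
  rw [expCoeff, norm_mul, norm_mul, Complex.norm_I, mul_one, Complex.norm_real, Complex.norm_real,
    Real.norm_of_nonneg hpi.le, Real.norm_eq_abs]
  have h1 : |v k μ.1 / v k δ + s * (|v k μ.1 / v k δ|)| ≤ 2 * |v k μ.1 / v k δ| := by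
    refine (abs_add_le _ _).trans ?_
    rw [abs_mul, abs_abs]
    nlinarith [abs_nonneg (v k μ.1 / v k δ)]
  have h2 : |v k μ.1| ≤ absSum v μ :=
    Finset.single_le_sum (f := fun k => |v k μ.1|) (fun _ _ => abs_nonneg _) (Finset.mem_univ k)
  calc _ ≤ Real.pi * (2 * |v k μ.1 / v k δ|) := by gcongr
    _ = 2 * Real.pi * |v k δ|⁻¹ * |v k μ.1| := by
      rw [abs_div, div_eq_mul_inv]
      ring
    _ ≤ _ := by gcongr

theorem norm_expCoeff_le' {s : ℝ} (hs : |s| ≤ 1) (μ : {μ : 𝓞 F // μ ≠ 0}) (k : Fin n) :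
    ‖expCoeff v δ s μ.1 k‖ ≤ expBound v δ * absSum v μ := by
  have hpi := Real.pi_pos
  have h1 : |v k δ|⁻¹ ≤ ∑ k, |v k δ|⁻¹ :=
    Finset.single_le_sum (f := fun k => |v k δ|⁻¹) (fun _ _ => by positivity) (Finset.mem_univ k)
  have h2 := absSum_nonneg (v := v) μ
  have h3 : 0 ≤ |v k δ|⁻¹ := by positivity
  refine (norm_expCoeff_le hs μ k).trans ?_
  rw [expBound]
  gcongr ?_ * _
  nlinarith

theorem norm_expForm_le (μ : {μ : 𝓞 F // μ ≠ 0}) :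
    ‖expForm v δ μ.1‖ ≤ expBound v δ * absSum v μ := by
  have hpi := Real.pi_pos
  have h0 := absSum_nonneg (v := v) μ
  refine ContinuousLinearMap.opNorm_le_bound _ (mul_nonneg (by
    unfold expBound
    positivity) h0) fun w => ?_
  rw [expForm, _root_.sum_apply, expBound, Finset.mul_sum, Finset.sum_mul, Finset.sum_mul]
  refine (norm_sum_le _ _).trans (Finset.sum_le_sum fun k _ => ?_)
  rw [_root_.add_apply, _root_.smul_apply, _root_.smul_apply, smul_eq_mul, smul_eq_mul]
  have h1 : ‖dz k w‖ ≤ ‖w‖ := norm_le_pi_norm w k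
  have h2 : ‖dzbar k w‖ ≤ ‖w‖ := by
    change ‖(starRingEnd ℂ) (w k)‖ ≤ ‖w‖
    rw [RCLike.norm_conj]
    exact norm_le_pi_norm w k
  refine (norm_add_le _ _).trans ?_
  rw [norm_mul, norm_mul]
  calc _ ≤ 2 * Real.pi * |v k δ|⁻¹ * absSum v μ * ‖w‖ + 2 * Real.pi * |v k δ|⁻¹ * absSum v μ * ‖w‖ := by
        gcongr
        · exact norm_expCoeff_le (by norm_num) μ k
        · exact norm_expCoeff_le (by norm_num) μ k
    _ = _ := by ring

theorem re_expForm (μ : 𝓞 F) (w : Fin n → ℂ) :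
    (expForm v δ μ w).re = -∑ k, 2 * Real.pi * |v k μ / v k δ| * (w k).im := by
  rw [expForm_apply, Finset.mul_sum, Complex.re_sum, ← Finset.sum_neg_distrib]
  refine Finset.sum_congr rfl fun k _ => ?_
  have : 2 * Complex.I * (Real.pi : ℂ) * (((v k μ / v k δ * (w k).re : ℝ) : ℂ) +
      ((|v k μ / v k δ| : ℝ) : ℂ) * Complex.I * ((w k).im : ℂ)) =
      ((-(2 * Real.pi * |v k μ / v k δ| * (w k).im) : ℝ) : ℂ) +
      ((2 * Real.pi * (v k μ / v k δ * (w k).re) : ℝ) : ℂ) * Complex.I := by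
    push_cast
    linear_combination (2 * Real.pi * (|v k μ / v k δ| : ℝ) * (w k).im : ℂ) * Complex.I_mul_I
  rw [this]
  simp

include hδ in
-- A `κ` below all `2π y_k / |δ_k|` at `z` stays below them nearby by continuity. This is the local
-- decay required for differentiating the series.
theorem re_expForm_le : ∀ z ∈ upperHalfProd n, ∃ κ : ℝ, 0 < κ ∧ ∀ᶠ w in 𝓝 z,
    ∀ μ : {μ : 𝓞 F // μ ≠ 0}, (expForm v δ μ.1 w).re ≤ -(κ * absSum v μ) := by
  intro z hz
  have hδ0 := delta_ne_zero hδ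
  have hpi := Real.pi_pos
  have hpos : ∀ k, 0 < 2 * Real.pi / |v k δ| * (z k).im := fun k => by
    have h1 := abs_pos.2 (v_ne_zero (v := v) hδ0 k)
    have h2 := hz k
    positivity
  have hev : ∀ᶠ κ : ℝ in 𝓝[>] 0, ∀ k, κ < 2 * Real.pi / |v k δ| * (z k).im :=
    eventually_all.2 fun k => mem_nhdsWithin_of_mem_nhds (gt_mem_nhds (hpos k))
  obtain ⟨κ, hκ, hκ0⟩ := (hev.and self_mem_nhdsWithin).exists
  refine ⟨κ, hκ0, ?_⟩
  have hw : ∀ᶠ w in 𝓝 z, ∀ k, κ < 2 * Real.pi / |v k δ| * (w k).im := by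
    refine eventually_all.2 fun k => ?_
    have hc : Continuous fun w : Fin n → ℂ => 2 * Real.pi / |v k δ| * (w k).im :=
      continuous_const.mul (Complex.continuous_im.comp (continuous_apply k))
    exact (hc.tendsto z).eventually (lt_mem_nhds (hκ k))
  filter_upwards [hw] with w hw μ
  rw [re_expForm, neg_le_neg_iff, absSum, Finset.mul_sum]
  refine Finset.sum_le_sum fun k _ => ?_
  calc κ * |v k μ.1| ≤ 2 * Real.pi / |v k δ| * (w k).im * |v k μ.1| := by
        have := (hw k).le
        gcongr
    _ = _ := by
      rw [abs_div]
      ring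

variable (v δ) in
/-- The series with the exponents of `h̃`. -/
noncomputable def hSeries (c : {μ : 𝓞 F // μ ≠ 0} → ℂ) : (Fin n → ℂ) → ℂ :=
  expSeries (fun μ : {μ : 𝓞 F // μ ≠ 0} => expForm v δ μ.1) c

variable {c : {μ : 𝓞 F // μ ≠ 0} → ℂ}

include hδ in
theorem contDiffOn_hSeries (hc : IsRapid (absSum v) c) :
    ContDiffOn ℝ ∞ (hSeries v δ c) (upperHalfProd n) :=
  contDiffOn_infty.2 fun p => contDiffOn_expSeries absSum_nonneg norm_expForm_le
    isOpen_upperHalfProd (re_expForm_le hδ) p hc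

theorem wirt_smulRight (j : Fin n) (L : (Fin n → ℂ) →L[ℝ] ℂ) (a : ℂ) :
    wirt j (L.smulRight a) = a * wirt j L := by
  simp only [wirt_apply, ContinuousLinearMap.smulRight_apply, smul_eq_mul]
  ring

theorem wirtBar_smulRight (j : Fin n) (L : (Fin n → ℂ) →L[ℝ] ℂ) (a : ℂ) :
    wirtBar j (L.smulRight a) = a * wirtBar j L := by
  simp only [wirtBar_apply, ContinuousLinearMap.smulRight_apply, smul_eq_mul]
  ring

include hδ in
theorem wirt_fderiv_hSeries (hc : IsRapid (absSum v) c) (j : Fin n) {z : Fin n → ℂ}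
    (hz : z ∈ upperHalfProd n) : wirt j (fderiv ℝ (hSeries v δ c) z) =
      hSeries v δ (fun μ => c μ * expCoeff v δ 1 μ.1 j) z := by
  have hs := summable_expSeries (re_expForm_le hδ) (hc.smulRight absSum_nonneg (norm_expForm_le (δ := δ))) hz
  rw [hSeries, (hasFDerivAt_expSeries absSum_nonneg norm_expForm_le (re_expForm_le hδ) hc hz).fderiv,
    expSeries, (wirt j).map_tsum hs, hSeries, expSeries]
  refine tsum_congr fun μ => ?_
  rw [wirt_smul, wirt_smulRight, wirt_expForm, smul_eq_mul]

include hδ in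
theorem wirtBar_fderiv_hSeries (hc : IsRapid (absSum v) c) (j : Fin n) {z : Fin n → ℂ}
    (hz : z ∈ upperHalfProd n) : wirtBar j (fderiv ℝ (hSeries v δ c) z) =
      hSeries v δ (fun μ => c μ * expCoeff v δ (-1) μ.1 j) z := by
  have hs := summable_expSeries (re_expForm_le hδ) (hc.smulRight absSum_nonneg (norm_expForm_le (δ := δ))) hz
  rw [hSeries, (hasFDerivAt_expSeries absSum_nonneg norm_expForm_le (re_expForm_le hδ) hc hz).fderiv,
    expSeries, (wirtBar j).map_tsum hs, hSeries, expSeries]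
  refine tsum_congr fun μ => ?_
  rw [wirtBar_smul, wirtBar_smulRight, wirtBar_expForm, smul_eq_mul]

theorem isRapid_mul_expCoeff (hc : IsRapid (absSum v) c) (j : Fin n) :
    IsRapid (absSum v) fun μ => c μ * expCoeff v δ 1 μ.1 j := by
  refine hc.of_le (C := expBound v δ) absSum_nonneg fun μ => ?_
  rw [norm_mul, mul_comm]
  exact mul_le_mul_of_nonneg_right (norm_expCoeff_le' (by norm_num) μ j) (norm_nonneg _)

theorem isRapid_mul_prod (hc : IsRapid (absSum v) c) (l : List (Fin n)) :
    IsRapid (absSum v) fun μ => c μ * (l.map (expCoeff v δ 1 μ.1)).prod := by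
  induction l with
  | nil => simpa using hc
  | cons j l ih =>
    have := isRapid_mul_expCoeff (δ := δ) ih j
    refine fun κ hκ => (this κ hκ).congr fun μ => ?_
    dsimp only
    rw [List.map_cons, List.prod_cons, mul_comm (expCoeff v δ 1 μ.1 j), mul_assoc]

include hδ in
theorem dWirtIter_hSeries (hc : IsRapid (absSum v) c) (l : List (Fin n)) :
    EqOn (dWirtIter l (hSeries v δ c))
      (hSeries v δ fun μ => c μ * (l.map (expCoeff v δ 1 μ.1)).prod) (upperHalfProd n) := by
  induction l with
  | nil =>
    intro z _
    simp [dWirtIter]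
  | cons j l ih =>
    refine (eqOn_dWirt isOpen_upperHalfProd ih j).trans fun z hz => ?_
    rw [dWirt_eq_wirt, wirt_fderiv_hSeries hδ (isRapid_mul_prod hc l) j hz]
    congr 1
    funext μ
    rw [List.map_cons, List.prod_cons, mul_comm (expCoeff v δ 1 μ.1 j), mul_assoc]

variable (F n) in
/-- The coefficient of the polynomial part of `h̃`. -/
noncomputable def hConst : ℂ := (-4 * Real.pi) ^ n * zetaF F (-1) / (Real.sqrt (discr F) : ℂ)

variable (n) in
/-- The coefficients of the exponential part of `h̃`. -/
noncomputable def hCoeff (μ : {μ : 𝓞 F // μ ≠ 0}) : ℂ :=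
  2 ^ n * (Real.sqrt (discr F) : ℂ) * sigma (-1) μ.1

theorem hTilde_eq_add :
    hTilde v δ = fun z => hConst F n * yProd Finset.univ z + hSeries v δ (hCoeff n) z := by
  funext z
  rw [hTilde, hConst, yProd, hSeries, expSeries, ← tsum_mul_left, Complex.ofReal_prod]
  congr 1
  refine tsum_congr fun μ => ?_
  rw [expForm_apply, hCoeff, smul_eq_mul]
  ring

include hF hv in
theorem isRapid_hCoeff : IsRapid (absSum v) (hCoeff (F := F) n) := by
  intro κ hκ
  refine ((summable_sigma_exp hF hv (κ := fun _ => κ) fun _ => hκ).mul_left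
    ‖2 ^ n * (Real.sqrt (discr F) : ℂ)‖).congr fun μ => ?_
  rw [hCoeff, norm_mul _ (sigma (-1) μ.1), absSum, Finset.mul_sum, mul_assoc]

include hF hv hδ in
theorem contDiffOn_hTilde : ContDiffOn ℝ ∞ (hTilde v δ) (upperHalfProd n) := by
  rw [hTilde_eq_add]
  exact (contDiffOn_const.mul (contDiff_yProd _).contDiffOn).add
    (contDiffOn_hSeries hδ (isRapid_hCoeff hF hv))

include hF hv hδ in
theorem dWirtIter_hTilde (l : List (Fin n)) (hl : l.Nodup) :
    EqOn (dWirtIter l (hTilde v δ)) (fun z =>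
      hConst F n * (1 / (2 * Complex.I)) ^ l.length * yProd (Finset.univ \ l.toFinset) z +
      hSeries v δ (fun μ => hCoeff n μ * (l.map (expCoeff v δ 1 μ.1)).prod) z)
      (upperHalfProd n) := by
  intro z hz
  rw [hTilde_eq_add, dWirtIter_add isOpen_upperHalfProd
    (contDiffOn_const.mul (contDiff_yProd _).contDiffOn)
    (contDiffOn_hSeries hδ (isRapid_hCoeff hF hv)) l hz, dWirtIter_const_mul_yProd _ l hl]
  dsimp only
  rw [dWirtIter_hSeries hδ (isRapid_hCoeff hF hv) l hz]

end HTilde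

/-! ### Partial sums over sign patterns and the Eisenstein series -/

section SignPatterns

variable {F : Type*} [Field F] [NumberField F] [IsTotallyReal F]
variable {n : ℕ} (hn : 0 < n) {v : Fin n → (F →+* ℝ)} (hv : Function.Bijective v)
variable {δ : 𝓞 F} (hδ : Ideal.span {δ} = differentIdeal ℤ (𝓞 F)) (hδpos : ∀ k, 0 < v k δ)
variable {s : Fin n → ℝ} (hs : ∀ k, s k = 1 ∨ s k = -1)

include hδpos hs in
theorem expCoeff_of_pos {μ : 𝓞 F} {k : Fin n} (h : 0 < s k * v k μ) :
    expCoeff v δ (s k) μ k = 2 * Complex.I * Real.pi * ((v k μ / v k δ : ℝ) : ℂ) := by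
  have hδk := hδpos k
  have h1 : s k * |v k μ / v k δ| = v k μ / v k δ := by
    rw [abs_div, abs_of_pos hδk, ← mul_div_assoc]
    congr 1
    rcases hs k with h2 | h2 <;> rw [h2] at h ⊢
    · rw [abs_of_pos (by linarith), one_mul]
    · rw [abs_of_neg (by linarith)]
      ring
  rw [expCoeff, h1]
  push_cast
  ring

include hδpos hs in
-- Here `t + s|t| = 0` when `t` does not have the sign `s`. Wirtinger derivatives thus act as sign
-- projectors on the exponentials: only the `μ` of the chosen sign at each place survive.
theorem expCoeff_of_not_pos {μ : 𝓞 F} {k : Fin n} (h : ¬ 0 < s k * v k μ) :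
    expCoeff v δ (s k) μ k = 0 := by
  have hδk := hδpos k
  have h1 : s k * |v k μ / v k δ| = -(v k μ / v k δ) := by
    rw [abs_div, abs_of_pos hδk, ← mul_div_assoc, ← neg_div]
    congr 1
    rcases hs k with h2 | h2 <;> rw [h2] at h ⊢
    · rw [abs_of_nonpos (by linarith), one_mul]
    · rw [abs_of_nonneg (by linarith)]
      ring
  rw [expCoeff, h1, add_neg_cancel, Complex.ofReal_zero, mul_zero]

include hv hs in
theorem prod_eq_sign_mul_absNorm {μ : 𝓞 F} (h : ∀ k, 0 < s k * v k μ) :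
    ∏ k, v k μ = (∏ k, s k) * Ideal.absNorm (Ideal.span {μ}) := by
  rw [absNorm_span_eq_prod hv, ← Finset.prod_mul_distrib]
  refine Finset.prod_congr rfl fun k _ => ?_
  have hk := h k
  rcases hs k with h2 | h2 <;> rw [h2] at hk ⊢
  · rw [abs_of_pos (by linarith), one_mul]
  · rw [abs_of_neg (by linarith)]
    ring

include hn in
theorem ne_zero_of_sign {μ : 𝓞 F} (h : ∀ k, 0 < s k * v k μ) : μ ≠ 0 := by
  rintro rfl
  have h0 : v ⟨0, hn⟩ ((0 : 𝓞 F) : F) = 0 := map_zero _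
  have := h ⟨0, hn⟩
  rw [h0, mul_zero] at this
  exact lt_irrefl _ this

include hn hv hδ hδpos hs in
-- The coefficients vanish off the sign pattern. On it their product is `(2iπ)^n ∏ s_k N(μ) / d_F`,
-- using `∏ |δ_k| = d_F`; the norm converts `σ_{-1}` into `σ_1`, and `d_F` against `√d_F` leaves
-- `1/√d_F`.
theorem hSeries_sign (z : Fin n → ℂ) :
    hSeries v δ (fun μ => hCoeff n μ * ∏ k, expCoeff v δ (s k) μ.1 k) z =
      (2 * Complex.I * Real.pi) ^ n / (Real.sqrt (discr F) : ℂ) * ((∏ k, s k : ℝ) : ℂ) *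
        (2 ^ n * ∑' μ : {μ : 𝓞 F // ∀ k, 0 < s k * v k μ}, sigma 1 μ.1 *
          Complex.exp (expForm v δ μ.1 z)) := by
  have hD := discr_pos hv
  set g : 𝓞 F → ℂ := fun μ => Complex.exp (expForm v δ μ z) * (2 ^ n * (Real.sqrt (discr F) : ℂ) *
    sigma (-1) μ * ∏ k, expCoeff v δ (s k) μ k) with hg
  have hsupp : ∀ μ, g μ ≠ 0 → ∀ k, 0 < s k * v k μ := by
    intro μ hμ k
    by_contra hk
    refine hμ ?_
    rw [hg]
    dsimp only
    rw [Finset.prod_eq_zero (f := fun k => expCoeff v δ (s k) μ k) (Finset.mem_univ k)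
      (expCoeff_of_not_pos hδpos hs hk), mul_zero, mul_zero]
  have h1 : hSeries v δ (fun μ => hCoeff n μ * ∏ k, expCoeff v δ (s k) μ.1 k) z =
      ∑' μ : ({μ | μ ≠ 0} : Set (𝓞 F)), g μ := rfl
  rw [h1, tsum_subtype_eq_of_support_subset (s := {μ : 𝓞 F | μ ≠ 0}) fun μ hμ => ne_zero_of_sign hn (hsupp μ hμ),
    ← tsum_subtype_eq_of_support_subset (s := {μ : 𝓞 F | ∀ k, 0 < s k * v k μ}) fun μ hμ => hsupp μ hμ,
    ← tsum_mul_left, ← tsum_mul_left]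
  refine tsum_congr fun μ => ?_
  have hμ : ∀ k, 0 < s k * v k μ.1 := μ.2
  have hs1 : (Real.sqrt (discr F) : ℂ) ≠ 0 := by exact_mod_cast (Real.sqrt_pos.2 hD).ne'
  have hs2 : ((discr F : ℝ) : ℂ) = Real.sqrt (discr F) * Real.sqrt (discr F) := by
    exact_mod_cast (Real.mul_self_sqrt hD.le).symm
  have hprod : ∏ k, expCoeff v δ (s k) μ.1 k = (2 * Complex.I * Real.pi) ^ n *
      (((∏ k, s k) * Ideal.absNorm (Ideal.span {μ.1}) / discr F : ℝ) : ℂ) := by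
    rw [Finset.prod_congr rfl fun k _ => expCoeff_of_pos hδpos hs (hμ k), Finset.prod_mul_distrib,
      Finset.prod_const, Finset.card_univ, Fintype.card_fin, ← Complex.ofReal_prod,
      Finset.prod_div_distrib, prod_eq_sign_mul_absNorm hv hs hμ, ← prod_abs_delta hv hδ,
      Finset.prod_congr rfl fun k _ => (abs_of_pos (hδpos k)).symm]
  rw [hg]
  dsimp only
  rw [hprod, sigma_one_eq (ne_zero_of_sign hn hμ), Complex.ofReal_div, hs2]
  push_cast
  field_simp

include hδpos in
theorem expForm_eq_sum {μ : 𝓞 F} {z w : Fin n → ℂ} {β : Fin n → ℝ}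
    (h : ∀ k, (β k : ℂ) * w k = ((v k μ / v k δ * (z k).re : ℝ) : ℂ) +
          ((|v k μ / v k δ| : ℝ) : ℂ) * Complex.I * ((z k).im : ℂ)) :
    expForm v δ μ z = 2 * Complex.I * Real.pi * ∑ k, (β k : ℂ) * w k := by
  rw [expForm_apply]
  congr 1
  exact Finset.sum_congr rfl fun k _ => (h k).symm

include hv in
-- Each derivative of an imaginary part gives `1/(2i)`, and `-4π / (2i) = 2iπ`.
theorem hConst_mul : hConst F n * (1 / (2 * Complex.I)) ^ n =
    (2 * Complex.I * Real.pi) ^ n / (Real.sqrt (discr F) : ℂ) * zetaF F (-1) := by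
  have h : (-4 * (Real.pi : ℂ)) * (1 / (2 * Complex.I)) = 2 * Complex.I * Real.pi := by
    have := Complex.I_ne_zero
    field_simp
    linear_combination (-4 : ℂ) * Complex.I_sq
  rw [hConst, ← h, mul_pow (-4 * (Real.pi : ℂ)) (1 / (2 * Complex.I))]
  ring

include hn hv hδ hδpos in
/-- The holomorphic component is the Eisenstein series. -/
theorem hSeries_eq_E2 (z : Fin n → ℂ) :
    hConst F n * (1 / (2 * Complex.I)) ^ n +
      hSeries v δ (fun μ => hCoeff n μ * ∏ k, expCoeff v δ 1 μ.1 k) z =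
    (2 * Complex.I * Real.pi) ^ n / (Real.sqrt (discr F) : ℂ) * E2 v δ z := by
  rw [hConst_mul hv, hSeries_sign (s := fun _ => 1) hn hv hδ hδpos (fun _ => Or.inl rfl), E2,
    Finset.prod_const_one, Complex.ofReal_one, mul_one, ← mul_add]
  congr 3
  rw [← (Equiv.subtypeEquivRight (p := fun μ : 𝓞 F => ∀ k, 0 < (1 : ℝ) * v k μ)
    (q := fun μ : 𝓞 F => ∀ k, 0 < v k μ) fun μ => by simp only [one_mul]).tsum_eq]
  refine tsum_congr fun μ => ?_
  have hμ : ∀ k, 0 < v k μ.1 := fun k => by simpa using μ.2 k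
  rw [expForm_eq_sum hδpos (β := fun k => v k μ.1 / v k δ) (w := z)]
  · rfl
  · intro k
    rw [abs_of_pos (div_pos (hμ k) (hδpos k))]
    conv_lhs => rw [← Complex.re_add_im (z k)]
    push_cast
    ring

variable {j : Fin n} {ε : (𝓞 F)ˣ} (hεj : v j ((ε : 𝓞 F) : F) < 0)
  (hε : ∀ k, k ≠ j → 0 < v k ((ε : 𝓞 F) : F))

/-- The sign pattern that is negative exactly at `j`. -/
def signAt (j k : Fin n) : ℝ := if k = j then -1 else 1

theorem prod_signAt (j : Fin n) : ∏ k, signAt j k = -1 := by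
  simp [signAt]

include hεj hε in
theorem sign_unit (k : Fin n) : 0 < signAt j k * v k ((ε : 𝓞 F) : F) := by
  rw [signAt]
  split_ifs with h
  · rw [h]
    linarith
  · rw [one_mul]
    exact hε k h

theorem v_unit_inv (k : Fin n) :
    v k ((ε : 𝓞 F) : F) * v k (((ε⁻¹ : (𝓞 F)ˣ) : 𝓞 F) : F) = 1 := by
  rw [← map_mul, ← map_mul, Units.mul_inv, map_one, map_one]

theorem signAt_sq (j k : Fin n) : signAt j k * signAt j k = 1 := by
  rw [signAt]
  split_ifs <;> norm_num

include hεj hε in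
-- `ε⁻¹` has the same signs as `ε`, so multiplying by it is the bijection from the pattern negative
-- exactly at `j` to the totally positive integers.
theorem sign_iff (μ : 𝓞 F) : (∀ k, 0 < signAt j k * v k μ) ↔
    ∀ k, 0 < v k (((ε⁻¹ : (𝓞 F)ˣ) : 𝓞 F) * μ : 𝓞 F) := by
  refine forall_congr' fun k => ?_
  have h1 := sign_unit hεj hε k
  have h2 := v_unit_inv (v := v) (ε := ε) k
  have h3 := signAt_sq j k
  have h4 : 0 < signAt j k * v k (((ε⁻¹ : (𝓞 F)ˣ) : 𝓞 F) : F) := by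
    have h5 : signAt j k * v k ((ε : 𝓞 F) : F) *
        (signAt j k * v k (((ε⁻¹ : (𝓞 F)ˣ) : 𝓞 F) : F)) = 1 := by
      linear_combination signAt j k * signAt j k * h2 + h3
    by_contra h6
    nlinarith
  have h7 : v k (((ε⁻¹ : (𝓞 F)ˣ) : 𝓞 F) : F) * v k μ =
      (signAt j k * v k (((ε⁻¹ : (𝓞 F)ˣ) : 𝓞 F) : F)) * (signAt j k * v k μ) := by
    linear_combination -(v k (((ε⁻¹ : (𝓞 F)ˣ) : 𝓞 F) : F) * v k μ) * h3
  have h8 : v k (((ε⁻¹ : (𝓞 F)ˣ) : 𝓞 F) * μ : 𝓞 F) =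
      v k (((ε⁻¹ : (𝓞 F)ˣ) : 𝓞 F) : F) * v k μ := by simp only [map_mul]
  rw [h8, h7, mul_pos_iff_of_pos_left h4]

include hn hv hδ hδpos hεj hε in
/-- The component antiholomorphic at `j` is a twist of the Eisenstein series. -/
theorem hSeries_eq_E2_heckeInfty (z : Fin n → ℂ) :
    -(hConst F n * (1 / (2 * Complex.I)) ^ n) +
      hSeries v δ (fun μ => hCoeff n μ * ∏ k, expCoeff v δ (signAt j k) μ.1 k) z =
    -((2 * Complex.I * Real.pi) ^ n / (Real.sqrt (discr F) : ℂ) * E2 v δ (heckeInfty v j ε z)) := by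
  have hsgn : ∀ k, signAt j k = 1 ∨ signAt j k = -1 := fun k => by
    rw [signAt]
    split_ifs
    · exact Or.inr rfl
    · exact Or.inl rfl
  rw [hConst_mul hv, hSeries_sign hn hv hδ hδpos hsgn, E2, prod_signAt, mul_add, neg_add,
    Complex.ofReal_neg, Complex.ofReal_one, mul_neg_one, neg_mul]
  congr 4
  rw [← (Equiv.subtypeEquiv (p := fun μ : 𝓞 F => ∀ k, 0 < signAt j k * v k μ)
    (q := fun μ : 𝓞 F => ∀ k, 0 < v k μ) (Units.mulLeft ε⁻¹) (sign_iff hεj hε)).tsum_eq]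
  refine tsum_congr fun μ => ?_
  change _ = sigma 1 (((ε⁻¹ : (𝓞 F)ˣ) : 𝓞 F) * μ.1) * Complex.exp (2 * Complex.I * Real.pi *
      ∑ k, ((v k (((ε⁻¹ : (𝓞 F)ˣ) : 𝓞 F) * μ.1 : 𝓞 F) / v k δ : ℝ) : ℂ) * heckeInfty v j ε z k)
  rw [sigma_unit_mul, expForm_eq_sum hδpos
    (β := fun k => v k (((ε⁻¹ : (𝓞 F)ˣ) : 𝓞 F) * μ.1 : 𝓞 F) / v k δ) (w := heckeInfty v j ε z)]
  intro k
  have h2 := v_unit_inv (v := v) (ε := ε) k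
  have hμ := μ.2 k
  have hδk := hδpos k
  have hδc : ((v k δ : ℝ) : ℂ) ≠ 0 := by exact_mod_cast hδk.ne'
  have h3 : v k (((ε⁻¹ : (𝓞 F)ˣ) : 𝓞 F) * μ.1 : 𝓞 F) =
      v k (((ε⁻¹ : (𝓞 F)ˣ) : 𝓞 F) : F) * v k μ.1 := by
    simp only [map_mul]
  have h4 : ((v k (((ε⁻¹ : (𝓞 F)ˣ) : 𝓞 F) * μ.1 : 𝓞 F) / v k δ : ℝ) : ℂ) *
      ((v k ((ε : 𝓞 F) : F) : ℝ) : ℂ) = ((v k μ.1 / v k δ : ℝ) : ℂ) := by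
    rw [← Complex.ofReal_mul]
    congr 1
    rw [h3, div_mul_eq_mul_div]
    congr 1
    linear_combination v k μ.1 * h2
  rw [heckeInfty, ← mul_assoc, h4]
  by_cases hk : k = j
  · subst hk
    rw [if_pos rfl]
    simp only [signAt, if_true] at hμ
    rw [abs_of_neg (div_neg_of_neg_of_pos (by linarith) hδk)]
    conv_lhs => rw [← Complex.re_add_im (z k)]
    simp only [map_add, map_mul, Complex.conj_ofReal, Complex.conj_I]
    push_cast
    ring
  · rw [if_neg hk]
    simp only [signAt, if_neg hk, one_mul] at hμ
    rw [abs_of_pos (div_pos hμ hδk)]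
    conv_lhs => rw [← Complex.re_add_im (z k)]
    push_cast
    ring

include hv hεj hε in
theorem prod_unit : ∏ k, v k ((ε : 𝓞 F) : F) = -1 := by
  have h1 := prod_abs_unit hv ε
  have h2 : ∏ k, signAt j k * v k ((ε : 𝓞 F) : F) = 1 := by
    rw [← h1]
    refine Finset.prod_congr rfl fun k _ => ?_
    rw [signAt]
    split_ifs with h
    · rw [h, abs_of_neg hεj]
      ring
    · rw [abs_of_pos (hε k h), one_mul]
  rw [Finset.prod_mul_distrib, prod_signAt] at h2
  linarith

end SignPatterns

/-! ### Exterior products and exterior derivatives -/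

section Forms

variable {n m : ℕ}

theorem wedge_smul_forms (a : Fin m → ℂ) (l : Fin m → ((Fin n → ℂ) →L[ℝ] ℂ)) :
    wedge (fun k => a k • l k) = (∏ k, a k) • wedge l := by
  ext w
  rw [ContinuousAlternatingMap.smul_apply, wedge_apply, wedge_apply, smul_eq_mul,
    ← Matrix.det_mul_row]
  rfl

theorem wedge_comp (l : Fin m → ((Fin n → ℂ) →L[ℝ] ℂ)) (M : (Fin n → ℂ) →L[ℝ] (Fin n → ℂ)) :
    (wedge l).compContinuousLinearMap M = wedge fun k => (l k).comp M := rfl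

theorem wedge_eq_zero {l : Fin m → ((Fin n → ℂ) →L[ℝ] ℂ)} {i j : Fin m} (hij : i ≠ j)
    (h : l i = l j) : wedge l = 0 := by
  ext w
  rw [wedge_apply, Matrix.det_zero_of_column_eq hij fun k => ?_]
  · rfl
  · rw [Matrix.of_apply, Matrix.of_apply, h]

theorem wedge_cons_apply (L : (Fin n → ℂ) →L[ℝ] ℂ) (l : Fin m → ((Fin n → ℂ) →L[ℝ] ℂ))
    (w : Fin (m + 1) → (Fin n → ℂ)) :
    wedge (Fin.cons L l : Fin (m + 1) → ((Fin n → ℂ) →L[ℝ] ℂ)) w =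
      ∑ i : Fin (m + 1), (-1) ^ (i : ℕ) * L (w i) * wedge l (i.removeNth w) := by
  rw [wedge_apply, Matrix.det_succ_column_zero]
  rfl

/-- Exterior multiplication on the left by a `1`-form, as a linear map in this form. -/
noncomputable def wedgeCons (l : Fin m → ((Fin n → ℂ) →L[ℝ] ℂ)) :
    ((Fin n → ℂ) →L[ℝ] ℂ) →ₗ[ℂ] (Fin n → ℂ) [⋀^Fin (m + 1)]→L[ℝ] ℂ where
  toFun L := wedge (Fin.cons L l : Fin (m + 1) → ((Fin n → ℂ) →L[ℝ] ℂ))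
  map_add' L M := by
    ext w
    rw [ContinuousAlternatingMap.add_apply, wedge_cons_apply, wedge_cons_apply, wedge_cons_apply,
      ← Finset.sum_add_distrib]
    refine Finset.sum_congr rfl fun i _ => ?_
    rw [_root_.add_apply]
    ring
  map_smul' a L := by
    ext w
    rw [RingHom.id_apply, ContinuousAlternatingMap.smul_apply, wedge_cons_apply, wedge_cons_apply,
      smul_eq_mul, Finset.mul_sum]
    refine Finset.sum_congr rfl fun i _ => ?_
    rw [_root_.smul_apply, smul_eq_mul]
    ring

theorem wedgeCons_eq_zero (l : Fin m → ((Fin n → ℂ) →L[ℝ] ℂ)) (i : Fin m) : wedgeCons l (l i) = 0 :=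
  wedge_eq_zero (i := 0) (j := i.succ) (Fin.succ_ne_zero i).symm rfl

/-- Compares the Laplace expansions of a determinant along its first and its `j`-th column; they
differ by `(-1)^j`, the sign built into `η_j`. -/
theorem wedge_insertNth (j : Fin (m + 1)) (L : (Fin n → ℂ) →L[ℝ] ℂ)
    (l : Fin m → ((Fin n → ℂ) →L[ℝ] ℂ)) :
    wedgeCons l L = (-1 : ℂ) ^ (j : ℕ) • wedge (j.insertNth L l : Fin (m + 1) → _) := by
  ext w
  have h1 := wedge_cons_apply L l w
  change wedgeCons l L w = _ at h1
  rw [h1, ContinuousAlternatingMap.smul_apply, wedge_apply, Matrix.det_succ_column _ j, smul_eq_mul,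
    Finset.mul_sum]
  refine Finset.sum_congr rfl fun i _ => ?_
  have h2 : ((Matrix.of fun i k => (j.insertNth L l : Fin (m + 1) → ((Fin n → ℂ) →L[ℝ] ℂ)) k
      (w i)).submatrix i.succAbove j.succAbove) = Matrix.of fun i' k => l k (i.removeNth w i') := by
    ext i' k
    simp [Matrix.submatrix_apply, Fin.removeNth]
  rw [h2, Matrix.of_apply, Fin.insertNth_apply_same, wedge_apply, pow_add]
  have h3 : ((-1 : ℂ) ^ (j : ℕ)) * (-1) ^ (j : ℕ) = 1 := by
    rw [← mul_pow]
    norm_num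
  linear_combination (-(-1 : ℂ) ^ (i : ℕ) * L (w i) *
    (Matrix.of fun i' k => l k (i.removeNth w i')).det) * h3

theorem wedgeCons_succAbove (j : Fin (m + 1)) (L : (Fin n → ℂ) →L[ℝ] ℂ)
    (l : Fin (m + 1) → ((Fin n → ℂ) →L[ℝ] ℂ)) :
    wedgeCons (fun k => l (j.succAbove k)) L =
      (-1 : ℂ) ^ (j : ℕ) • wedge (Function.update l j L) := by
  rw [wedge_insertNth j]
  congr 2
  funext k
  rcases Fin.eq_self_or_eq_succAbove j k with h | ⟨i, h⟩
  · subst h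
    simp
  · subst h
    simp

/-- The exterior derivative of a function times a constant exterior product. -/
theorem extDeriv_smul_wedge {f : (Fin n → ℂ) → ℂ} {z : Fin n → ℂ} (hf : DifferentiableAt ℝ f z)
    (l : Fin m → ((Fin n → ℂ) →L[ℝ] ℂ)) :
    extDeriv (fun w => f w • wedge l) z = wedgeCons l (fderiv ℝ f z) := by
  ext w
  have h1 := wedge_cons_apply (fderiv ℝ f z) l w
  change wedgeCons l (fderiv ℝ f z) w = _ at h1
  have h2 : HasFDerivAt (fun w => f w • wedge l) ((fderiv ℝ f z).smulRight (wedge l)) z :=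
    hf.hasFDerivAt.smul_const (wedge l)
  rw [h1, extDeriv, h2.fderiv, ContinuousAlternatingMap.alternatizeUncurryFin_apply]
  refine Finset.sum_congr rfl fun i _ => ?_
  rw [ContinuousLinearMap.smulRight_apply, ContinuousAlternatingMap.smul_apply, smul_eq_mul,
    mul_assoc, zsmul_eq_mul]
  push_cast
  rfl

/-- Decomposition of the exterior derivative along `dz_j` and the `dz̄_k`. -/
theorem wedgeCons_dz (j : Fin (m + 1)) (L : (Fin (m + 1) → ℂ) →L[ℝ] ℂ) :
    (-1 : ℂ) ^ (j : ℕ) • wedgeCons (fun k => dz (j.succAbove k)) L =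
      wirt j L • wedge (fun k => dz k) + ∑ k, wirtBar k L • ((-1 : ℂ) ^ (j : ℕ) •
        wedgeCons (fun k => dz (j.succAbove k)) (dzbar k)) := by
  have hz : ∀ k, k ≠ j →
      wedgeCons (fun i => dz (j.succAbove i)) (dz k : (Fin (m + 1) → ℂ) →L[ℝ] ℂ) = 0 := by
    intro k hk
    obtain ⟨i, rfl⟩ := Fin.exists_succAbove_eq hk
    exact wedgeCons_eq_zero (fun i => (dz (j.succAbove i) : (Fin (m + 1) → ℂ) →L[ℝ] ℂ)) i
  have hj : (-1 : ℂ) ^ (j : ℕ) • wedgeCons (fun i => dz (j.succAbove i))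
      (dz j : (Fin (m + 1) → ℂ) →L[ℝ] ℂ) = wedge fun k => dz k := by
    rw [wedgeCons_succAbove j (dz j) (fun k => dz k), smul_smul, ← mul_pow, Function.update_eq_self]
    norm_num
  conv_lhs => rw [eq_sum_wirt L]
  rw [map_sum, Finset.smul_sum]
  simp only [map_add, map_smul, smul_add, Finset.sum_add_distrib]
  congr 1
  · rw [Finset.sum_eq_single j (fun k _ hk => by
      rw [hz k hk]
      ext w
      change (-1 : ℂ) ^ (j : ℕ) * (wirt k L * 0) = 0
      rw [mul_zero, mul_zero])
      (fun h => absurd (Finset.mem_univ j) h), smul_comm, hj]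
  · exact Finset.sum_congr rfl fun k _ => smul_comm _ _ _

end Forms

/-! ### The primitive of the symmetrised Eisenstein class -/

section Primitive

variable {F : Type*} [Field F] [NumberField F] [IsTotallyReal F]
variable (hF : NarrowClassNumberOne F)
variable {m : ℕ} (hm : 1 ≤ m) {v : Fin (m + 1) → (F →+* ℝ)} (hv : Function.Bijective v)
variable {δ : 𝓞 F} (hδ : Ideal.span {δ} = differentIdeal ℤ (𝓞 F)) (hδpos : ∀ k, 0 < v k δ)
variable {j : Fin (m + 1)} {ε : (𝓞 F)ˣ} (hεj : v j ((ε : 𝓞 F) : F) < 0)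
  (hε : ∀ k, k ≠ j → 0 < v k ((ε : 𝓞 F) : F))
variable {z : Fin (m + 1) → ℂ} (hz : z ∈ upperHalfProd (m + 1))

theorem nodup_ofFn_succAbove (j : Fin (m + 1)) : (List.ofFn j.succAbove).Nodup :=
  List.nodup_ofFn.2 Fin.succAbove_right_injective

theorem univ_sdiff_ofFn_succAbove (j : Fin (m + 1)) :
    Finset.univ \ (List.ofFn j.succAbove).toFinset = {j} := by
  ext k
  simp only [Finset.mem_sdiff, Finset.mem_univ, true_and, List.mem_toFinset, List.mem_ofFn,
    Finset.mem_singleton]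
  constructor
  · intro h
    by_contra hk
    exact h (Fin.exists_succAbove_eq hk)
  · rintro rfl ⟨i, hi⟩
    exact Fin.succAbove_ne _ _ hi

include hm in
-- For `n = 2` the single derivative of `(4² R_F / 4) log y_k` is `4 R_F / (2i y_k)`, which is the
-- correction term. For `n ≥ 3` at least two different derivatives are taken and the result is 0.
theorem dWirtIter_log_im_eq (j : Fin (m + 1)) : EqOn
    (dWirtIter (List.ofFn j.succAbove) (fun w : Fin (m + 1) → ℂ =>
      ((4 ^ (m + 1) * Units.regulator F / 4 * ∑ k, Real.log (w k).im : ℝ) : ℂ)))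
    (etaCorrection F m j) (upperHalfProd (m + 1)) := by
  match m, hm, j with
  | 1, _, j =>
    intro z hz
    have h1 : List.ofFn j.succAbove = [j.succAbove 0] := by simp
    rw [h1]
    refine (dWirt_log_im _ _ hz).trans ?_
    rw [etaCorrection]
    have := Complex.I_ne_zero
    have h2 : (((z (j.succAbove 0)).im : ℝ) : ℂ) ≠ 0 := by exact_mod_cast (hz _).ne'
    push_cast
    field_simp
    norm_num [mul_comm]
  | p + 2, _, j =>
    intro z hz
    have h := nodup_ofFn_succAbove j
    rw [List.ofFn_succ, List.ofFn_succ] at h ⊢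
    exact dWirtIter_log_im _ _ _ _ h hz

variable (F m) in
/-- The invariant function `h̃ - c Σ log y_k`. -/
noncomputable def invFun (v : Fin (m + 1) → (F →+* ℝ)) (δ : 𝓞 F) (z : Fin (m + 1) → ℂ) : ℂ :=
  hTilde v δ z - ((4 ^ (m + 1) * Units.regulator F / 4 * ∑ k, Real.log (z k).im : ℝ) : ℂ)

include hF hv hδ in
theorem contDiffOn_invFun : ContDiffOn ℝ ∞ (invFun F m v δ) (upperHalfProd (m + 1)) :=
  (contDiffOn_hTilde hF hv hδ).sub (contDiffOn_log_im _)

include hF hm hv hδ in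
theorem dWirtIter_invFun (j : Fin (m + 1)) : EqOn
    (dWirtIter (List.ofFn j.succAbove) (invFun F m v δ))
    (fun z => dWirtIter (List.ofFn j.succAbove) (hTilde v δ) z - etaCorrection F m j z)
    (upperHalfProd (m + 1)) := by
  intro z hz
  have h := dWirtIter_sub isOpen_upperHalfProd (contDiffOn_hTilde hF hv hδ)
    (contDiffOn_log_im (4 ^ (m + 1) * Units.regulator F / 4)) (List.ofFn j.succAbove) hz
  dsimp only at h
  rw [dWirtIter_log_im_eq hm j hz] at h
  exact h

include hF hm hv hδ in
-- The coefficient of `η_j` is a mixed derivative of the invariant function `invFun`. Pulling back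
-- each `dz_k` with `k ≠ j` produces `(c_k z_k + d_k)⁻²`, precisely the factor in the transformation
-- law of that derivative.
theorem isFormOnX_etaForm (j : Fin (m + 1)) : IsFormOnX v (etaForm v δ j) := by
  have hU := isOpen_upperHalfProd (n := m + 1)
  set D := dWirtIter (List.ofFn j.succAbove) (invFun F m v δ) with hD
  have hη : EqOn (etaForm v δ j) (fun z => ((-1) ^ (j : ℕ) * D z) •
      wedge (fun k => dz (j.succAbove k))) (upperHalfProd (m + 1)) := fun z hz => by
    rw [etaForm]
    dsimp only
    rw [hD, dWirtIter_invFun hF hm hv hδ j hz]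
  have hDs : ContDiffOn ℝ ∞ D (upperHalfProd (m + 1)) :=
    contDiffOn_dWirtIter hU (contDiffOn_invFun hF hv hδ) _
  refine ⟨?_, fun A z hz => ?_⟩
  · refine ContDiffOn.congr ?_ hη
    exact ((ContinuousLinearMap.id ℝ ℂ).smulRight (wedge fun k => dz (j.succAbove k) :
      (Fin (m + 1) → ℂ) [⋀^Fin m]→L[ℝ] ℂ)).contDiff.comp_contDiffOn (contDiffOn_const.mul hDs)
  · have hz' := moebius_mem (v := v) hz A
    rw [pullback, hη hz, hη hz', (hasFDerivAt_moebius hz A).fderiv]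
    have h1 := dWirtIter_moebius (v := v) A (contDiffOn_invFun hF hv hδ)
      (fun w hw => hTilde_moebius hF (Nat.succ_pos m) hv hδ hw A) (List.ofFn j.succAbove)
      (nodup_ofFn_succAbove j) z hz
    rw [List.map_ofFn, List.prod_ofFn] at h1
    have h2 : (wedge (fun k => dz (j.succAbove k)) :
        (Fin (m + 1) → ℂ) [⋀^Fin m]→L[ℝ] ℂ).compContinuousLinearMap
        (ContinuousLinearMap.pi fun k => ((autFactor v A z k) ^ 2)⁻¹ • dz k) =
        (∏ k, ((autFactor v A z (j.succAbove k)) ^ 2)⁻¹) • wedge (fun k => dz (j.succAbove k)) := by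
      rw [wedge_comp, ← wedge_smul_forms]
      rfl
    have h3 : ∀ a : ℂ, (a • (wedge (fun k => dz (j.succAbove k)) :
        (Fin (m + 1) → ℂ) [⋀^Fin m]→L[ℝ] ℂ)).compContinuousLinearMap
        (ContinuousLinearMap.pi fun k => ((autFactor v A z k) ^ 2)⁻¹ • dz k) =
        a • (wedge (fun k => dz (j.succAbove k)) :
        (Fin (m + 1) → ℂ) [⋀^Fin m]→L[ℝ] ℂ).compContinuousLinearMap
        (ContinuousLinearMap.pi fun k => ((autFactor v A z k) ^ 2)⁻¹ • dz k) := fun _ => rfl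
    dsimp only
    rw [h3, h2, smul_smul, hD, h1]
    congr 1
    simp only [Function.comp_apply]
    ring

include hF hv hδ hz in
theorem hasFDerivAt_dWirtIter_hTilde :
    HasFDerivAt (dWirtIter (List.ofFn j.succAbove) (hTilde v δ))
      ((hConst F (m + 1) * (1 / (2 * Complex.I)) ^ m) • imForm j + fderiv ℝ (hSeries v δ fun μ =>
        hCoeff (m + 1) μ * ((List.ofFn j.succAbove).map (expCoeff v δ 1 μ.1)).prod) z) z := by
  have h := dWirtIter_hTilde hF hv hδ (List.ofFn j.succAbove) (nodup_ofFn_succAbove j)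
  rw [univ_sdiff_ofFn_succAbove, List.length_ofFn] at h
  have h1 : (yProd {j} : (Fin (m + 1) → ℂ) → ℂ) = imForm j := by
    funext w
    simp [yProd, imForm_apply]
  rw [h1] at h
  have h2 := ContDiffOn.differentiableAt_of_isOpen isOpen_upperHalfProd
    (contDiffOn_hSeries hδ (isRapid_mul_prod (δ := δ) (isRapid_hCoeff hF hv (n := m + 1))
      (List.ofFn j.succAbove))) hz
  exact (((imForm j).hasFDerivAt.const_mul _).add h2.hasFDerivAt).congr_of_eventuallyEq
    (h.eventuallyEq_of_mem (isOpen_upperHalfProd.mem_nhds hz))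

include hF hv hδ hδpos hz in
theorem wirt_fderiv_dWirtIter_hTilde :
    wirt j (fderiv ℝ (dWirtIter (List.ofFn j.succAbove) (hTilde v δ)) z) =
      (2 * Complex.I * Real.pi) ^ (m + 1) / (Real.sqrt (discr F) : ℂ) * E2 v δ z := by
  rw [(hasFDerivAt_dWirtIter_hTilde hF hv hδ hz).fderiv, map_add, wirt_smul, wirt_imForm, if_pos rfl,
    wirt_fderiv_hSeries hδ (isRapid_mul_prod (isRapid_hCoeff hF hv) _) j hz,
    ← hSeries_eq_E2 (Nat.succ_pos m) hv hδ hδpos, mul_assoc (hConst F (m + 1)), ← pow_succ]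
  congr 2
  funext μ
  rw [List.map_ofFn, List.prod_ofFn, Fin.prod_univ_succAbove _ j, mul_assoc,
    mul_comm (expCoeff v δ 1 μ.1 j)]
  rfl

include hF hv hδ hδpos hz hεj hε in
theorem wirtBar_fderiv_dWirtIter_hTilde :
    wirtBar j (fderiv ℝ (dWirtIter (List.ofFn j.succAbove) (hTilde v δ)) z) =
      -((2 * Complex.I * Real.pi) ^ (m + 1) / (Real.sqrt (discr F) : ℂ) *
        E2 v δ (heckeInfty v j ε z)) := by
  rw [(hasFDerivAt_dWirtIter_hTilde hF hv hδ hz).fderiv, map_add, wirtBar_smul, wirtBar_imForm,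
    if_pos rfl, wirtBar_fderiv_hSeries hδ (isRapid_mul_prod (isRapid_hCoeff hF hv) _) j hz,
    ← hSeries_eq_E2_heckeInfty (Nat.succ_pos m) hv hδ hδpos hεj hε, mul_neg,
    mul_assoc (hConst F (m + 1)), ← pow_succ]
  congr 2
  funext μ
  rw [List.map_ofFn, List.prod_ofFn, Fin.prod_univ_succAbove _ j, mul_assoc,
    mul_comm (expCoeff v δ (signAt j j) μ.1 j)]
  simp [signAt, Fin.succAbove_ne]

include hF hv hδ hz in
-- Each exponential is holomorphic or antiholomorphic in `z_k`, since `(t + |t|)(t - |t|) = 0`. The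
-- derivative `∂/∂z_k` already taken has removed the antiholomorphic ones. The polynomial part now
-- depends only on `y_j`.
theorem wirtBar_fderiv_dWirtIter_hTilde_of_ne {k : Fin (m + 1)} (hk : k ≠ j) :
    wirtBar k (fderiv ℝ (dWirtIter (List.ofFn j.succAbove) (hTilde v δ)) z) = 0 := by
  rw [(hasFDerivAt_dWirtIter_hTilde hF hv hδ hz).fderiv, map_add, wirtBar_smul, wirtBar_imForm,
    if_neg hk.symm, wirtBar_fderiv_hSeries hδ (isRapid_mul_prod (isRapid_hCoeff hF hv) _) k hz,
    mul_zero, zero_add, hSeries, expSeries]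
  refine (tsum_congr fun μ => ?_).trans tsum_zero
  obtain ⟨i, rfl⟩ := Fin.exists_succAbove_eq hk
  have h0 : expCoeff v δ 1 μ.1 (j.succAbove i) * expCoeff v δ (-1) μ.1 (j.succAbove i) = 0 := by
    rw [expCoeff, expCoeff]
    have h : ((v (j.succAbove i) μ.1 / v (j.succAbove i) δ +
        1 * |v (j.succAbove i) μ.1 / v (j.succAbove i) δ| : ℝ) : ℂ) *
        ((v (j.succAbove i) μ.1 / v (j.succAbove i) δ +
        -1 * |v (j.succAbove i) μ.1 / v (j.succAbove i) δ| : ℝ) : ℂ) = 0 := by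
      rw [← Complex.ofReal_mul]
      have : (v (j.succAbove i) μ.1 / v (j.succAbove i) δ +
        1 * |v (j.succAbove i) μ.1 / v (j.succAbove i) δ|) *
        (v (j.succAbove i) μ.1 / v (j.succAbove i) δ +
        -1 * |v (j.succAbove i) μ.1 / v (j.succAbove i) δ|) = 0 := by
        linear_combination -sq_abs (v (j.succAbove i) μ.1 / v (j.succAbove i) δ)
      rw [this, Complex.ofReal_zero]
    linear_combination (Real.pi * Complex.I) ^ 2 * h
  have h1 : ((List.ofFn j.succAbove).map (expCoeff v δ 1 μ.1)).prod *
      expCoeff v δ (-1) μ.1 (j.succAbove i) = 0 := by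
    rw [List.map_ofFn, List.prod_ofFn, ← Finset.mul_prod_erase _ _ (Finset.mem_univ i),
      Function.comp_apply, mul_right_comm, h0, zero_mul]
  rw [mul_assoc, h1, mul_zero, smul_zero]

variable (v j ε) in
/-- The map `T_{v_j}` as a continuous linear map. -/
noncomputable def heckeCLM : (Fin (m + 1) → ℂ) →L[ℝ] (Fin (m + 1) → ℂ) :=
  ContinuousLinearMap.pi fun k =>
    ((v k ((ε : 𝓞 F) : F) : ℝ) : ℂ) • Function.update (fun k => dz k) j (dzbar j) k

theorem heckeCLM_apply (w : Fin (m + 1) → ℂ) (k : Fin (m + 1)) : heckeCLM v j ε w k =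
    ((v k ((ε : 𝓞 F) : F) : ℝ) : ℂ) * (if k = j then (starRingEnd ℂ) (w k) else w k) := by
  change ((v k ((ε : 𝓞 F) : F) : ℝ) : ℂ) * Function.update (fun k => dz k) j (dzbar j) k w = _
  congr 1
  split_ifs with h
  · subst h
    rw [Function.update_self]
    rfl
  · rw [Function.update_of_ne h]
    rfl

theorem heckeInfty_eq : heckeInfty v j ε = heckeCLM v j ε := by
  funext w k
  rw [heckeCLM_apply]
  rfl

include hv hεj hε in
-- The scalars `ε_k` contribute their product, the norm of `ε`, which is `-1` by the sign pattern;
-- conjugation replaces `dz_j` by `dz̄_j`.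
theorem wedge_dz_comp_heckeCLM :
    (wedge (fun k => dz k) : (Fin (m + 1) → ℂ) [⋀^Fin (m + 1)]→L[ℝ] ℂ).compContinuousLinearMap
      (heckeCLM v j ε) = (-1 : ℂ) • wedge (Function.update (fun k => dz k) j (dzbar j)) := by
  have h : (((∏ k, v k ((ε : 𝓞 F) : F) : ℝ)) : ℂ) = -1 := by
    rw [prod_unit hv hεj hε]
    norm_num
  rw [← h, Complex.ofReal_prod, ← wedge_smul_forms, wedge_comp]
  rfl

end Primitive

/-! ### The correction terms for `n = 2` and the identity for `dη_j` -/

section Exactness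

variable {F : Type*} [Field F] [NumberField F] [IsTotallyReal F]
variable (hF : NarrowClassNumberOne F)
variable {m : ℕ} (hm : 1 ≤ m) {v : Fin (m + 1) → (F →+* ℝ)} (hv : Function.Bijective v)
variable {δ : 𝓞 F} (hδ : Ideal.span {δ} = differentIdeal ℤ (𝓞 F)) (hδpos : ∀ k, 0 < v k δ)
variable {j : Fin (m + 1)} {ε : (𝓞 F)ˣ} (hεj : v j ((ε : 𝓞 F) : F) < 0)
  (hε : ∀ k, k ≠ j → 0 < v k ((ε : 𝓞 F) : F))
variable {z : Fin (m + 1) → ℂ} (hz : z ∈ upperHalfProd (m + 1))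

theorem wedge_dz_dzbar_comp_heckeCLM (v : Fin (m + 1) → (F →+* ℝ)) (j k : Fin (m + 1))
    (ε : (𝓞 F)ˣ) :
    (wedge ![dz k, dzbar k]).compContinuousLinearMap (heckeCLM v j ε) =
      ((if k = j then -1 else 1) * ((v k ((ε : 𝓞 F) : F) : ℝ) : ℂ) ^ 2) •
        wedge ![dz k, dzbar k] := by
  ext w
  have h (u : Fin 2 → (Fin (m + 1) → ℂ)) : wedge ![dz k, dzbar k] u =
      u 0 k * (starRingEnd ℂ) (u 1 k) - (starRingEnd ℂ) (u 0 k) * u 1 k := by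
    rw [wedge_apply, Matrix.det_fin_two]
    rfl
  change wedge ![dz k, dzbar k] (fun i => heckeCLM v j ε (w i)) = _ * wedge ![dz k, dzbar k] w
  rw [h, h, heckeCLM_apply, heckeCLM_apply]
  split_ifs <;> simp only [map_mul, Complex.conj_ofReal, Complex.conj_conj] <;> ring

theorem heckeCLM_im_sq (v : Fin (m + 1) → (F →+* ℝ)) (j k : Fin (m + 1)) (ε : (𝓞 F)ˣ)
    (z : Fin (m + 1) → ℂ) :
    (((heckeCLM v j ε z k).im : ℝ) : ℂ) ^ 2 =
      ((v k ((ε : 𝓞 F) : F) : ℝ) : ℂ) ^ 2 * ((z k).im : ℂ) ^ 2 := by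
  rw [heckeCLM_apply]
  split_ifs <;> simp [mul_pow]

theorem unit_embedding_ne_zero (σ : F →+* ℝ) (ε : (𝓞 F)ˣ) : σ ((ε : 𝓞 F) : F) ≠ 0 := by
  simp

theorem hasFDerivAt_etaCorrection_one {j : Fin 2} {z : Fin 2 → ℂ} (hz : z ∈ upperHalfProd 2) :
    HasFDerivAt (etaCorrection F 1 j)
      ((Units.regulator F / ((z (j.succAbove 0)).im : ℂ) ^ 2) •
        (dz (j.succAbove 0) - dzbar (j.succAbove 0))) z := by
  have h := (hasFDerivAt_inv_im hz (j.succAbove 0)).const_mul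
    (2 * (Units.regulator F : ℂ) / Complex.I)
  refine (h.congr_fderiv ?_).congr_of_eventuallyEq (Eventually.of_forall fun w => ?_)
  · ext w
    have := Complex.I_ne_zero
    have h2 : (((z (j.succAbove 0)).im : ℝ) : ℂ) ≠ 0 := by exact_mod_cast (hz _).ne'
    change 2 * (Units.regulator F : ℂ) / Complex.I * (-(((z (j.succAbove 0)).im : ℂ) ^ 2)⁻¹ *
      imForm (j.succAbove 0) w) = Units.regulator F / ((z (j.succAbove 0)).im : ℂ) ^ 2 *
      (w (j.succAbove 0) - (starRingEnd ℂ) (w (j.succAbove 0)))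
    rw [imForm_apply, Complex.sub_conj]
    field_simp
    rw [Complex.I_sq]
    push_cast
    ring
  · change 2 * (Units.regulator F : ℂ) / (Complex.I * ((w (j.succAbove 0)).im : ℂ)) =
      2 * (Units.regulator F : ℂ) / Complex.I * ((w (j.succAbove 0)).im : ℂ)⁻¹
    rw [div_mul_eq_div_div, div_eq_mul_inv _ ((w (j.succAbove 0)).im : ℂ)]

include hm hz in
theorem differentiableAt_etaCorrection (j : Fin (m + 1)) :
    DifferentiableAt ℝ (etaCorrection F m j) z := by
  match m, hm, j, z, hz with
  | 1, _, j, z, hz => exact (hasFDerivAt_etaCorrection_one hz).differentiableAt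
  | p + 2, _, j, z, _ => exact differentiableAt_const (0 : ℂ)

/-- The differential of `2 R_F / (i y_k)` is `(R_F / y_k²)(dz_k - dz̄_k)`; against `dz_k` only the
antiholomorphic part survives. -/
theorem wedgeCons_etaCorrection_one (j : Fin 2) {z : Fin 2 → ℂ} (hz : z ∈ upperHalfProd 2) :
    wedgeCons (fun i : Fin 1 => dz (j.succAbove i)) (fderiv ℝ (etaCorrection F 1 j) z) =
      (Units.regulator F / ((z (j.succAbove 0)).im : ℂ) ^ 2) •
        wedge ![dz (j.succAbove 0), dzbar (j.succAbove 0)] := by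
  rw [(hasFDerivAt_etaCorrection_one hz).fderiv, map_smul]
  congr 1
  ext w
  change wedge _ w = wedge _ w
  rw [wedge_apply, wedge_apply, Matrix.det_fin_two, Matrix.det_fin_two]
  change (w 0 _ - (starRingEnd ℂ) (w 0 _)) * w 1 (j.succAbove 0) -
    w 0 (j.succAbove 0) * (w 1 _ - (starRingEnd ℂ) (w 1 _)) =
    w 0 (j.succAbove 0) * (starRingEnd ℂ) (w 1 (j.succAbove 0)) -
    (starRingEnd ℂ) (w 0 (j.succAbove 0)) * w 1 (j.succAbove 0)
  ring

/-- The form `dz_k ∧ dz̄_k / y_k²` is unchanged by real scaling of `z_k` and changes sign under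
conjugation. So the term at `j` cancels, while the other one doubles, turning `R_F / 2` into `R_F`.
-/
theorem eisCorrection_add_pullback_one (v : Fin 2 → (F →+* ℝ)) (j : Fin 2) (ε : (𝓞 F)ˣ)
    {z : Fin 2 → ℂ} :
    eisCorrection F 1 z + pullback (heckeInfty v j ε) (eisCorrection F 1) z =
      (-(-1) ^ (j : ℕ) * (Units.regulator F / ((z (j.succAbove 0)).im : ℂ) ^ 2)) •
        wedge ![dz (j.succAbove 0), dzbar (j.succAbove 0)] := by
  have hε (k : Fin 2) : ((v k ((ε : 𝓞 F) : F) : ℝ) : ℂ) ≠ 0 :=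
    Complex.ofReal_ne_zero.2 (unit_embedding_ne_zero _ _)
  ext w
  rw [heckeInfty_eq, pullback, ContinuousLinearMap.fderiv]
  have h (k : Fin 2) := DFunLike.congr_fun (wedge_dz_dzbar_comp_heckeCLM v j k ε) w
  have h0 := h 0
  have h1 := h 1
  change wedge ![dz 0, dzbar 0] (fun i => heckeCLM v j ε (w i)) =
    _ * wedge ![dz 0, dzbar 0] w at h0
  change wedge ![dz 1, dzbar 1] (fun i => heckeCLM v j ε (w i)) =
    _ * wedge ![dz 1, dzbar 1] w at h1
  change ((Units.regulator F / 2 : ℝ) : ℂ) *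
      (1 / ((z 0).im : ℂ) ^ 2 * wedge ![dz 0, dzbar 0] w -
        1 / ((z 1).im : ℂ) ^ 2 * wedge ![dz 1, dzbar 1] w) +
    ((Units.regulator F / 2 : ℝ) : ℂ) *
      (1 / ((heckeCLM v j ε z 0).im : ℂ) ^ 2 *
        wedge ![dz 0, dzbar 0] (fun i => heckeCLM v j ε (w i)) -
      1 / ((heckeCLM v j ε z 1).im : ℂ) ^ 2 *
        wedge ![dz 1, dzbar 1] (fun i => heckeCLM v j ε (w i))) =
    (-(-1) ^ (j : ℕ) * (Units.regulator F / ((z (j.succAbove 0)).im : ℂ) ^ 2)) *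
      wedge ![dz (j.succAbove 0), dzbar (j.succAbove 0)] w
  have h2 (k : Fin 2) (a : ℂ) : 1 / ((heckeCLM v j ε z k).im : ℂ) ^ 2 *
      ((a * ((v k ((ε : 𝓞 F) : F) : ℝ) : ℂ) ^ 2) * wedge ![dz k, dzbar k] w) =
      a * (1 / ((z k).im : ℂ) ^ 2 * wedge ![dz k, dzbar k] w) := by
    rw [heckeCLM_im_sq]
    have := hε k
    field_simp
  rw [h0, h1, h2, h2]
  push_cast
  match j with
  | 0 =>
    rw [if_pos rfl, if_neg one_ne_zero]
    change _ = (-(-1) ^ 0 * (Units.regulator F / ((z 1).im : ℂ) ^ 2)) * wedge ![dz 1, dzbar 1] w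
    ring
  | 1 =>
    rw [if_pos rfl, if_neg zero_ne_one]
    change _ = (-(-1) ^ 1 * (Units.regulator F / ((z 0).im : ℂ) ^ 2)) * wedge ![dz 0, dzbar 0] w
    ring

include hm hz in
theorem wedgeCons_etaCorrection (v : Fin (m + 1) → (F →+* ℝ)) (j : Fin (m + 1)) (ε : (𝓞 F)ˣ) :
    (-1 : ℂ) ^ (j : ℕ) • wedgeCons (fun i => dz (j.succAbove i))
        (fderiv ℝ (etaCorrection F m j) z) =
      -(eisCorrection F m z + pullback (heckeInfty v j ε) (eisCorrection F m) z) := by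
  match m, hm, v, j, z, hz with
  | 1, _, v, j, z, hz =>
    rw [eisCorrection_add_pullback_one]
    refine (congrArg _ (wedgeCons_etaCorrection_one j hz)).trans ?_
    ext w
    change (-1 : ℂ) ^ (j : ℕ) * (Units.regulator F / ((z (j.succAbove 0)).im : ℂ) ^ 2 * _) =
      -((-(-1) ^ (j : ℕ) * (Units.regulator F / ((z (j.succAbove 0)).im : ℂ) ^ 2)) * _)
    ring
  | p + 2, _, v, j, z, _ =>
    have h : fderiv ℝ (etaCorrection F (p + 2) j) z = 0 := (hasFDerivAt_const (0 : ℂ) z).fderiv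
    rw [h, map_zero]
    ext w
    change (-1 : ℂ) ^ (j : ℕ) * 0 = -(0 + 0)
    ring

include hF hm hv hδ hδpos hεj hε in
/-- The identity `dη_j = (Id + T_{v_j}^*) ω_Eis`. -/
theorem isPrimitive_etaForm : IsPrimitive (etaForm v δ j) (omegaEisPlus v δ j ε) := by
  intro z hz
  have hD := (hasFDerivAt_dWirtIter_hTilde (j := j) hF hv hδ hz).differentiableAt
  have hc := differentiableAt_etaCorrection (F := F) hm hz j
  have hf := (hD.sub hc).const_mul ((-1 : ℂ) ^ (j : ℕ))
  have h1 : extDeriv (etaForm v δ j) z = _ :=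
    extDeriv_smul_wedge hf (fun k => dz (j.succAbove k))
  have h2 : fderiv ℝ (fun w => (-1 : ℂ) ^ (j : ℕ) *
      (dWirtIter (List.ofFn j.succAbove) (hTilde v δ) - etaCorrection F m j) w) z =
      (-1 : ℂ) ^ (j : ℕ) • (fderiv ℝ (dWirtIter (List.ofFn j.succAbove) (hTilde v δ)) z -
        fderiv ℝ (etaCorrection F m j) z) :=
    ((hD.hasFDerivAt.sub hc.hasFDerivAt).const_mul _).fderiv
  -- Only the `dz_j` and `dz̄_j` components of the differential of the mixed derivative contribute.
  -- They are the Eisenstein part of the form and of its pullback, and the differential of the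
  -- correction supplies the remaining terms.
  rw [h1, h2, map_smul, map_sub, smul_sub, wedgeCons_etaCorrection hm hz v j ε, wedgeCons_dz,
    wirt_fderiv_dWirtIter_hTilde hF hv hδ hδpos hz,
    Finset.sum_eq_single j (fun k _ hk => by
      rw [wirtBar_fderiv_dWirtIter_hTilde_of_ne hF hv hδ hz hk]
      ext w
      exact zero_mul _) (fun h => absurd (Finset.mem_univ j) h),
    wirtBar_fderiv_dWirtIter_hTilde hF hv hδ hδpos hεj hε hz,
    wedgeCons_succAbove j (dzbar j) (fun k => dz k)]
  have h3 := wedge_dz_comp_heckeCLM hv hεj hε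
  ext w
  have h4 := DFunLike.congr_fun h3 w
  change wedge (fun k => dz k) (fun i => heckeCLM v j ε (w i)) = -1 * wedge _ w at h4
  rw [omegaEisPlus, pullback, pullback, heckeInfty_eq, ContinuousLinearMap.fderiv]
  set A := (2 * Complex.I * (Real.pi : ℂ)) ^ (m + 1) / (Real.sqrt (discr F) : ℂ)
  change A * E2 v δ z * wedge (fun k => dz k) w +
    -(A * E2 v δ (heckeCLM v j ε z)) * ((-1 : ℂ) ^ (j : ℕ) *
      ((-1 : ℂ) ^ (j : ℕ) * wedge (Function.update (fun k => dz k) j (dzbar j)) w)) -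
    -(eisCorrection F m z w + eisCorrection F m (heckeCLM v j ε z)
      (fun i => heckeCLM v j ε (w i))) =
    (A * E2 v δ z * wedge (fun k => dz k) w + eisCorrection F m z w) +
    (A * E2 v δ (heckeCLM v j ε z) * wedge (fun k => dz k) (fun i => heckeCLM v j ε (w i)) +
      eisCorrection F m (heckeCLM v j ε z) (fun i => heckeCLM v j ε (w i)))
  rw [h4]
  have h5 : (-1 : ℂ) ^ (j : ℕ) * (-1 : ℂ) ^ (j : ℕ) = 1 := by
    rw [← mul_pow]
    norm_num
  linear_combination -(A * E2 v δ (heckeCLM v j ε z)) *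
    wedge (Function.update (fun k => dz k) j (dzbar j)) w * h5

end Exactness

end HilbertEisenstein

theorem mainTheorem10 {F : Type*} [Field F] [NumberField F] [IsTotallyReal F]
    (hF : HilbertEisenstein.NarrowClassNumberOne F)
    {m : ℕ} (hm : 1 ≤ m)
    (v : Fin (m + 1) → (F →+* ℝ)) (hv : Function.Bijective v)
    (δ : 𝓞 F) (hδ : Ideal.span {δ} = differentIdeal ℤ (𝓞 F)) (hδpos : ∀ k, 0 < v k δ)
    (j : Fin (m + 1))
    (ε : (𝓞 F)ˣ) (hεj : v j ((ε : 𝓞 F) : F) < 0)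
    (hε : ∀ k, k ≠ j → 0 < v k ((ε : 𝓞 F) : F)) :
    HilbertEisenstein.IsExactOnX v (HilbertEisenstein.omegaEisPlus v δ j ε) ∧
      HilbertEisenstein.IsFormOnX v (HilbertEisenstein.etaForm v δ j) ∧
      HilbertEisenstein.IsPrimitive (HilbertEisenstein.etaForm v δ j)
        (HilbertEisenstein.omegaEisPlus v δ j ε) := by
  have hform := HilbertEisenstein.isFormOnX_etaForm hF hm hv hδ j
  have hprim := HilbertEisenstein.isPrimitive_etaForm hF hm hv hδ hδpos hεj hε
  exact ⟨⟨_, hform, hprim⟩, hform, hprim⟩
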